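/- For $\gamma>0$ and $x,y\in\mathbb R$ let $$K_{\mathrm{crit}}(x,y;\gamma)=\int_{1-i\infty}^{1+i\infty}\frac{ds}{2\pi i}\oint_{\Sigma_{-\infty}}\frac{dt}{2\pi i}\,\frac{1}{s-t}\,\frac{\Gamma(t)}{\Gamma(s)}\,\frac{e^{\gamma s^2/2-ys}}{e^{\gamma t^2/2-xt}},$$ where, for fixed $0<c<1$ and $\epsilon>0$, $\Sigma_{-\infty}$ is the anticlockwise contour that comes from $-\infty-i\epsilon$ along a horizontal ray to $c-i\epsilon$, goes up the vertical segment to $c+i\epsilon$, and returns along a horizontal ray to $-\infty+i\epsilon$; it encircles $0,-1,-2,\dots$ and lies in $\{\operatorname{Re}z<1\}$, and the value of the integral does not depend on $c,\epsilon$. Let $$K_{\mathrm{Airy}}(x,y)=\int_{\mathcal C}\frac{ds}{2\pi i}\int_{\Sigma}\frac{dt}{2\pi i}\,\frac{1}{s-t}\,\frac{e^{s^3/3-ys}}{e^{t^3/3-xt}}$$ be the Airy kernel, where $\mathcal C=\{1+re^{5\pi i/3}:r\ge 0\}\cup\{1+re^{\pi i/3}:r\ge 0\}$ and $\Sigma=\{-1+re^{4\pi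 i/3}:r\ge 0\}\cup\{-1+re^{2\pi i/3}:r\ge 0\}$ are oriented upwards. Let $\psi=\Gamma'/\Gamma$ be the digamma function. **Theorem.** For every choice of $0<c<1$ and $\epsilon>0$ as above, the following hold. 1. Uniformly for $x,y$ in any compact subset of $\mathbb R$, $$\lim_{\gamma\to\infty}\sqrt\gamma\,K_{\mathrm{crit}}\big(\sqrt\gamma\,x,\sqrt\gamma\,y;\gamma\big)=\frac{1}{\sqrt{2\pi}}\,e^{-y^2/2}.$$ 2. For every $\gamma>0$ the equation $\psi'(t_0)=\gamma$ has a unique positive solution $t_0=t_0(\gamma)$, and with $k=k(\gamma)=2^{-1/3}\gamma^{2/3}$, uniformly for $x,y$ in any compact subset of $\mathbb R$, $$\lim_{\gamma\to0^+}k\,e^{kt_0(y-x)}\,K_{\mathrm{crit}}\big(\gamma t_0-\psi(t_0)+kx,\ \gamma t_0-\psi(t_0)+ky;\ \gamma\big)=K_{\mathrm{Airy}}(x,y).$$ -/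

import Mathlib

open Filter Topology

noncomputable section

namespace CriticalKernel

/-- `∫ f(z) dz` along the ray that leaves `a` in the direction `d`, i.e. `z = a + r d` with
`r` running from `0` to `+∞`. -/
def rayIntegral (a d : ℂ) (f : ℂ → ℂ) : ℂ :=
  ∫ r in Set.Ioi (0 : ℝ), f (a + (r : ℂ) * d) * d

/-- `∫ f(z) dz` along the contour that comes in from infinity to `a` along the ray
`a + [0, ∞) d₁` and then leaves `a` along the ray `a + [0, ∞) d₂`. -/
def wedgeIntegral (a d₁ d₂ : ℂ) (f : ℂ → ℂ) : ℂ :=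
  -rayIntegral a d₁ f + rayIntegral a d₂ f

/-- `∫ f(z) dz` along the vertical line `Re z = a`, from `a - i∞` to `a + i∞`. -/
def verticalIntegral (a : ℝ) (f : ℂ → ℂ) : ℂ :=
  ∫ v : ℝ, f ((a : ℂ) + (v : ℂ) * Complex.I) * Complex.I

/-- `∫ f(z) dz` along the anticlockwise contour `Σ_{-∞}` that starts at `-∞ - iε`, runs to
`c - iε` along a horizontal ray, goes up the segment from `c - iε` to `c + iε`, and runs back to
`-∞ + iε` along a horizontal ray. For `0 < c` and `0 < ε` it encircles `0, -1, -2, …`; for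
`c < 1` it lies in the half plane `Re z < 1`. -/
def hankelIntegral (c ε : ℝ) (f : ℂ → ℂ) : ℂ :=
  -rayIntegral ((c : ℂ) - (ε : ℂ) * Complex.I) (-1) f
    + (∫ v in (-ε)..ε, f ((c : ℂ) + (v : ℂ) * Complex.I) * Complex.I)
    + rayIntegral ((c : ℂ) + (ε : ℂ) * Complex.I) (-1) f

/-- The critical kernel `K_crit(x, y; γ)`, a double contour integral with `s` on the line
`Re s = 1` and `t` on the contour `Σ_{-∞}` with parameters `c` and `ε`. For `γ > 0` the
integral converges absolutely, and by Cauchy's theorem its value is the same for all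
`0 < c < 1` and `0 < ε`. -/
def Kcrit (c ε : ℝ) (x y γ : ℝ) : ℂ :=
  verticalIntegral 1 fun s =>
    hankelIntegral c ε (fun t =>
        1 / (s - t) * (Complex.Gamma t / Complex.Gamma s)
          * (Complex.exp ((γ : ℂ) * s ^ 2 / 2 - (y : ℂ) * s)
            / Complex.exp ((γ : ℂ) * t ^ 2 / 2 - (x : ℂ) * t))
        / (2 * (Real.pi : ℂ) * Complex.I))
      / (2 * (Real.pi : ℂ) * Complex.I)

/-- The Airy kernel as a double contour integral. The variable `s` runs upwards through the
vertex `1`, from the direction `e^{5πi/3}` to the direction `e^{πi/3}`; the variable `t` runs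
upwards through the vertex `-1`, from the direction `e^{4πi/3}` to the direction `e^{2πi/3}`. -/
def Kairy (x y : ℝ) : ℂ :=
  wedgeIntegral 1 (Complex.exp (5 * (Real.pi : ℂ) * Complex.I / 3))
      (Complex.exp ((Real.pi : ℂ) * Complex.I / 3)) fun s =>
    wedgeIntegral (-1) (Complex.exp (4 * (Real.pi : ℂ) * Complex.I / 3))
        (Complex.exp (2 * (Real.pi : ℂ) * Complex.I / 3)) (fun t =>
        1 / (s - t)
          * (Complex.exp (s ^ 3 / 3 - (y : ℂ) * s) / Complex.exp (t ^ 3 / 3 - (x : ℂ) * t))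
        / (2 * (Real.pi : ℂ) * Complex.I))
      / (2 * (Real.pi : ℂ) * Complex.I)

/-- The digamma function `ψ = Γ' / Γ` of a real variable. -/
def digamma (x : ℝ) : ℝ := logDeriv Real.Gamma x

/-- On the positive half line, `digamma` is Mathlib's complex digamma function. -/
theorem ofReal_digamma {x : ℝ} (hx : 0 < x) : (digamma x : ℂ) = Complex.digamma (x : ℂ) := by
  have hd : DifferentiableAt ℂ Complex.Gamma (x : ℂ) := by
    refine Complex.differentiableAt_Gamma _ fun m h => ?_
    have h' : x = -(m : ℝ) := by exact_mod_cast h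
    have : (0 : ℝ) ≤ m := Nat.cast_nonneg m
    linarith
  have h1 : HasDerivAt (fun y : ℝ => Complex.Gamma (y : ℂ)) (deriv Complex.Gamma (x : ℂ)) x :=
    hd.hasDerivAt.comp_ofReal
  have h2 : HasDerivAt (fun y : ℝ => ((Real.Gamma y : ℝ) : ℂ)) ((deriv Real.Gamma x : ℝ) : ℂ) x := by
    refine HasDerivAt.ofReal_comp (DifferentiableAt.hasDerivAt ?_)
    refine Real.differentiableAt_Gamma fun m h => ?_
    have : (0 : ℝ) ≤ m := Nat.cast_nonneg m
    linarith
  have h3 : deriv Complex.Gamma (x : ℂ) = ((deriv Real.Gamma x : ℝ) : ℂ) := by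
    refine h1.unique ?_
    simpa only [Complex.Gamma_ofReal] using h2
  simp [digamma, Complex.digamma, logDeriv_apply, h3, Complex.Gamma_ofReal]

/-- The spatial scale `k(γ) = 2^{-1/3} γ^{2/3}` of the Airy limit. -/
def scale (γ : ℝ) : ℝ := (2 : ℝ) ^ (-(1 / 3 : ℝ)) * γ ^ (2 / 3 : ℝ)

end CriticalKernel

end

/-!
Both limits start from `1 / (s - t) = ∫₀^∞ e^{-l (s - t)} dl`, valid since the `s`-contour lies to the
right of the `t`-contour. It turns each kernel into `∫₀^∞ F(y + l) G(x + l) dl`, with `F` a single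
integral over `s` and `G` a single integral over `t` (`integral_integral_div_sub`,
`Kcrit_eq_integral`, `Kairy_eq_integral`). It is therefore enough to find the limits of `F`, with an
error `o(1) e^{-u}`, and of `G`, with an error `o(1)`, uniformly for `u ≥ -M`
(`tendstoUniformlyOn_separated`). After a change of contour `F`, and in the Airy limit also `G`, is a
Laplace-type integral `∫ φ(v) e^{-u z(v)} dv`, for which uniformity in `u` comes for free from
dominated convergence of the densities `φ` (`laplace_limit`).

As `γ → ∞`, put `s = w / √γ` on the line `Re w = 1`. Then `1 / Γ(s) = s / Γ(1 + s) ~ s`, and `F`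
becomes a Gaussian integral. In `G` the residue of `Γ` at `0` contributes exactly `1`; the remaining
integral over a wedge with vertex `-1/2` is exponentially small in `γ`
(`exists_norm_hankelIntegral_sub_one_le`).

As `γ → 0`, the exponent `f(s) = γ s²/2 - (γ t₀ - ψ(t₀)) s - log Γ(s)` has a double critical point at
`t₀`. In place of Stirling's formula the proof uses the Weierstrass product: because
`f'(t₀) = f''(t₀) = 0`, `e^{f(t₀ + w) - f(t₀)}` is the product over `j ≥ 0` of the elementary factors
`(1 + z) e^{-z + z²/2}` at `z = w / (t₀ + j)` (`tendsto_prod_elemFactor`). Bounding one factor and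
multiplying gives the cubic expansion with an explicit error (`exists_saddleRatio_eq_exp`), a
Gaussian upper bound on vertical lines (`norm_saddleRatio_vertical_le`) and a lower bound on two rays
to the left (`exp_le_norm_saddleRatio`), all in terms of `∑ j, 1 / (t₀ + j)³ ~ k³`. With `w` of size
`1 / k` and `k t₀ → ∞`, these are the pointwise limit and the domination that turn `F` and `G` into
Airy functions.

Contours are moved with primitives on the plane and on a slit plane (`primitive_add_rayIntegral_eq`).
-/

noncomputable section

namespace CriticalKernel

open MeasureTheory Set

/-! ### Contour integrals and primitives -/

/-- The plane slit along `p + (-∞, 0]` is not convex; `w ↦ p + w²` maps a half plane,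
which is, onto it. -/
theorem exists_primitive_slit {f : ℂ → ℂ} (p : ℂ)
    (hf : ∀ z, z - p ∈ Complex.slitPlane → DifferentiableAt ℂ f z) :
    ∃ P : ℂ → ℂ, ∀ z, z - p ∈ Complex.slitPlane → HasDerivAt P (f z) z := by
  have hopen : IsOpen {w : ℂ | 0 < w.re} := isOpen_lt continuous_const Complex.continuous_re
  have hsq : ∀ w : ℂ, 0 < w.re → w ^ 2 ∈ Complex.slitPlane := by
    intro w hw
    rw [Complex.mem_slitPlane_iff]
    by_cases h : w.im = 0
    · left; simp [pow_two, h]; positivity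
    · right
      have h2 : (w ^ 2).im = 2 * w.re * w.im := by simp [pow_two]; ring
      rw [h2]
      positivity
  obtain ⟨Q, hQ⟩ := (convex_halfSpace_re_gt 0).exists_forall_hasDerivWithinAt
    (f := fun w : ℂ => f (p + w ^ 2) * (2 * w)) (by
      intro w hw
      have h1 : DifferentiableAt ℂ f (p + w ^ 2) := hf _ (by simpa using hsq w hw)
      have h2 : DifferentiableAt ℂ (fun w : ℂ => f (p + w ^ 2)) w :=
        h1.comp (f := fun w : ℂ => p + w ^ 2) w (by fun_prop)
      exact (h2.mul (by fun_prop)).differentiableWithinAt)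
  refine ⟨fun z => Q (Complex.exp (Complex.log (z - p) / 2)), fun z hz => ?_⟩
  set w := Complex.exp (Complex.log (z - p) / 2) with hw
  have hw2 : w ^ 2 = z - p := by
    rw [hw, ← Complex.exp_nat_mul]
    rw [show ((2 : ℕ) : ℂ) * (Complex.log (z - p) / 2) = Complex.log (z - p) by push_cast; ring]
    exact Complex.exp_log (Complex.slitPlane_ne_zero hz)
  have hwre : 0 < w.re := by
    rw [hw, Complex.exp_re]
    have h1 := (Complex.mem_slitPlane_iff_arg.1 hz).1
    have h2 := Complex.arg_le_pi (z - p)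
    have h3 := Complex.neg_pi_lt_arg (z - p)
    have h4 : (Complex.log (z - p) / 2).im = (z - p).arg / 2 := by
      simp [Complex.log_im]
    rw [h4]
    have : (z - p).arg < Real.pi := lt_of_le_of_ne h2 h1
    exact mul_pos (Real.exp_pos _) (Real.cos_pos_of_mem_Ioo ⟨by linarith, by linarith⟩)
  have hw0 : w ≠ 0 := Complex.exp_ne_zero _
  have hQ' : HasDerivAt Q (f (p + w ^ 2) * (2 * w)) w :=
    (hQ w hwre).hasDerivAt (hopen.mem_nhds hwre)
  have hin : HasDerivAt (fun z : ℂ => Complex.exp (Complex.log (z - p) / 2))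
      (w * ((z - p)⁻¹ / 2)) z := by
    have := ((Complex.hasDerivAt_log hz).comp z ((hasDerivAt_id z).sub_const p)).div_const 2
    simpa using this.cexp
  have h := hQ'.comp z hin
  have e : f (p + w ^ 2) * (2 * w) * (w * ((z - p)⁻¹ / 2)) = f z := by
    rw [← hw2]
    field_simp
    rw [hw2, add_sub_cancel]
  rw [e] at h
  exact h

theorem tendsto_primitive_ray {P f : ℂ → ℂ} {a d : ℂ}
    (h : ∀ r : ℝ, 0 ≤ r → HasDerivAt P (f (a + r * d)) (a + r * d))
    (hi : IntegrableOn (fun r : ℝ => f (a + r * d)) (Ioi 0)) :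
    Tendsto (fun R : ℝ => P (a + R * d)) atTop (𝓝 (P a + rayIntegral a d f)) := by
  have hi' : IntegrableOn (fun r : ℝ => f (a + r * d) * d) (Ioi 0) := hi.mul_const d
  have h1 := intervalIntegral_tendsto_integral_Ioi 0 hi' tendsto_id
  refine (h1.const_add (P a)).congr' ?_
  filter_upwards [eventually_ge_atTop 0] with R hR
  rw [id, intervalIntegral.integral_eq_sub_of_hasDerivAt (f := fun r : ℝ => P (a + r * d))]
  · simp
  · intro r hr
    rw [uIcc_of_le hR] at hr
    have hl : HasDerivAt (fun r : ℝ => a + (r : ℂ) * d) d r := by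
      simpa using ((Complex.ofRealCLM.hasDerivAt (x := r)).mul_const d).const_add a
    exact HasDerivAt.comp r (h r hr.1) hl
  · rw [intervalIntegrable_iff_integrableOn_Ioc_of_le hR]
    exact hi'.mono_set Ioc_subset_Ioi_self

/-- Two rays carry the same integral, up to the values of a primitive at their starting points, if
far out they are joined by segments along which the integral tends to `0`. -/
theorem primitive_add_rayIntegral_eq {P f : ℂ → ℂ} {a d a' d' : ℂ} {ρ b : ℝ → ℝ}
    (h₁ : ∀ r : ℝ, 0 ≤ r → HasDerivAt P (f (a + r * d)) (a + r * d))
    (hi₁ : IntegrableOn (fun r : ℝ => f (a + r * d)) (Ioi 0))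
    (h₂ : ∀ r : ℝ, 0 ≤ r → HasDerivAt P (f (a' + r * d')) (a' + r * d'))
    (hi₂ : IntegrableOn (fun r : ℝ => f (a' + r * d')) (Ioi 0))
    (hρ : Tendsto ρ atTop atTop)
    (hseg : ∀ᶠ R : ℝ in atTop, ∀ z ∈ segment ℝ (a + R * d) (a' + ρ R * d'),
      HasDerivAt P (f z) z ∧ ‖f z‖ ≤ b R)
    (hb : Tendsto (fun R : ℝ => b R * ‖(a' + ρ R * d') - (a + R * d)‖) atTop (𝓝 0)) :
    P a + rayIntegral a d f = P a' + rayIntegral a' d' f := by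
  have k1 := tendsto_primitive_ray h₁ hi₁
  have k2 := (tendsto_primitive_ray h₂ hi₂).comp hρ
  have k3 : Tendsto (fun R : ℝ => P (a' + ρ R * d') - P (a + R * d)) atTop (𝓝 0) := by
    refine squeeze_zero_norm' ?_ hb
    filter_upwards [hseg] with R hR
    exact (convex_segment _ _).norm_image_sub_le_of_norm_hasDerivWithin_le
      (fun z hz => (hR z hz).1.hasDerivWithinAt) (fun z hz => (hR z hz).2)
      (left_mem_segment _ _ _) (right_mem_segment _ _ _)
  have := tendsto_nhds_unique (k2.sub k1) k3
  exact (sub_eq_zero.1 this).symm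

/-- Integrability along a ray from continuity and exponential decay. -/
theorem integrableOn_ray {f : ℂ → ℂ} {a d : ℂ} {C A b : ℝ} (hb : 0 < b)
    (hc : ∀ r : ℝ, 0 ≤ r → ContinuousAt f (a + r * d))
    (hd : ∀ r : ℝ, A ≤ r → ‖f (a + r * d)‖ ≤ C * Real.exp (-b * r)) :
    IntegrableOn (fun r : ℝ => f (a + r * d)) (Ioi 0) := by
  have hcont : ContinuousOn (fun r : ℝ => f (a + r * d)) (Ici 0) := by
    intro r hr
    exact (ContinuousAt.comp (f := fun r : ℝ => a + (r : ℂ) * d) (hc r hr)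
      (by fun_prop)).continuousWithinAt
  have h : IntegrableOn (fun r : ℝ => ‖f (a + r * d)‖) (Ioi 0) := by
    refine integrable_of_isBigO_exp_neg hb hcont.norm ?_
    refine Asymptotics.IsBigO.of_bound C ?_
    filter_upwards [eventually_ge_atTop A] with r hr
    rw [norm_norm, Real.norm_of_nonneg (Real.exp_pos _).le]
    exact hd r hr
  exact (integrable_norm_iff ((hcont.mono Ioi_subset_Ici_self).aestronglyMeasurable
    measurableSet_Ioi)).1 h

theorem verticalIntegral_eq_wedgeIntegral {f : ℂ → ℂ} {a : ℝ}
    (hf : Integrable fun v : ℝ => f (a + v * Complex.I)) :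
    verticalIntegral a f = wedgeIntegral a (-Complex.I) Complex.I f := by
  unfold verticalIntegral wedgeIntegral rayIntegral
  have hf' := hf.mul_const Complex.I
  rw [← intervalIntegral.integral_Iic_add_Ioi (b := (0:ℝ)) hf'.integrableOn hf'.integrableOn]
  congr 1
  rw [← integral_neg]
  have := integral_comp_neg_Ioi 0 (fun v : ℝ => f (a + v * Complex.I) * Complex.I)
  rw [neg_zero] at this
  rw [← this]
  congr 1
  ext v
  push_cast
  ring_nf

theorem integral_Ioi_comp_sub (g : ℝ → ℂ) (c : ℝ) (hg : IntegrableOn g (Ioi 0)) :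
    IntegrableOn (fun r => g (r - c)) (Ioi c) ∧
      ∫ r in Ioi c, g (r - c) = ∫ r in Ioi 0, g r := by
  have hp : (fun r : ℝ => r - c) ⁻¹' Ioi 0 = Ioi c := by simp
  have h := measurePreserving_sub_right volume c
  have he := measurableEmbedding_subRight c
  constructor
  · have := (h.integrableOn_comp_preimage he).2 hg
    rwa [hp] at this
  · have := h.setIntegral_preimage_emb he g (Ioi 0)
    rwa [hp] at this

theorem integral_Iic_comp_const_sub (g : ℝ → ℂ) (c : ℝ) (hg : IntegrableOn g (Ioi 0)) :
    IntegrableOn (fun r => g (c - r)) (Iic c) ∧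
      ∫ r in Iic c, g (c - r) = ∫ r in Ioi 0, g r := by
  have hp : (fun r : ℝ => c - r) ⁻¹' Ioi 0 = Iio c := by simp
  have h := Measure.measurePreserving_sub_left volume c
  have he := (MeasurableEquiv.subLeft c).measurableEmbedding
  constructor
  · have := (h.integrableOn_comp_preimage he).2 hg
    rw [hp] at this
    rwa [integrableOn_Iic_iff_integrableOn_Iio]
  · have := h.setIntegral_preimage_emb he g (Ioi 0)
    rwa [hp, ← integral_Iic_eq_integral_Iio] at this

/-- The wedge from `a + [0, ∞) d₁` to `a + [0, ∞) d₂`, as a path indexed by `ℝ`. -/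
def wedgePath (a d₁ d₂ : ℂ) (r : ℝ) : ℂ := if r ≤ 0 then a - r * d₁ else a + r * d₂

/-- The velocity of `wedgePath`. -/
def wedgeVel (d₁ d₂ : ℂ) (r : ℝ) : ℂ := if r ≤ 0 then -d₁ else d₂

/-- The Hankel contour as a path indexed by `ℝ`, with the vertical segment run through for
`r ∈ [-ε, ε]`. -/
def hankelPath (c ε : ℝ) (r : ℝ) : ℂ :=
  ((c - max (|r| - ε) 0 : ℝ) : ℂ) + ((max (-ε) (min r ε) : ℝ) : ℂ) * Complex.I

/-- The velocity of `hankelPath`. -/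
def hankelVel (ε : ℝ) (r : ℝ) : ℂ := if r ≤ -ε then 1 else if r ≤ ε then Complex.I else -1

theorem wedgeIntegral_eq {f : ℂ → ℂ} {a d₁ d₂ : ℂ}
    (h₁ : IntegrableOn (fun r : ℝ => f (a + r * d₁)) (Ioi 0))
    (h₂ : IntegrableOn (fun r : ℝ => f (a + r * d₂)) (Ioi 0)) :
    Integrable (fun r => f (wedgePath a d₁ d₂ r) * wedgeVel d₁ d₂ r) ∧
      wedgeIntegral a d₁ d₂ f = ∫ r, f (wedgePath a d₁ d₂ r) * wedgeVel d₁ d₂ r := by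
  have e₂ : EqOn (fun r : ℝ => f (a + r * d₂) * d₂)
      (fun r => f (wedgePath a d₁ d₂ r) * wedgeVel d₁ d₂ r) (Ioi 0) := by
    intro r hr
    simp [wedgePath, wedgeVel, not_le.2 (show (0:ℝ) < r from hr)]
  have e₁ : EqOn (fun r : ℝ => -(f (a + ((0 - r : ℝ) : ℂ) * d₁) * d₁))
      (fun r => f (wedgePath a d₁ d₂ r) * wedgeVel d₁ d₂ r) (Iic 0) := by
    intro r hr
    have : r ≤ 0 := hr
    simp [wedgePath, wedgeVel, this, sub_eq_add_neg]
  obtain ⟨i₁', v₁⟩ := integral_Iic_comp_const_sub (fun r : ℝ => -(f (a + r * d₁) * d₁)) 0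
    (Integrable.neg (Integrable.mul_const h₁ d₁))
  have i₂ := IntegrableOn.congr_fun (Integrable.mul_const h₂ d₂) e₂ measurableSet_Ioi
  have i₁ := i₁'.congr_fun e₁ measurableSet_Iic
  constructor
  · rw [← integrableOn_univ, ← Iic_union_Ioi (a := (0:ℝ))]
    exact i₁.union i₂
  · rw [← intervalIntegral.integral_Iic_add_Ioi i₁ i₂, ← setIntegral_congr_fun measurableSet_Iic e₁,
      ← setIntegral_congr_fun measurableSet_Ioi e₂, v₁, integral_neg]
    rfl

theorem hankelIntegral_eq {f : ℂ → ℂ} {c ε : ℝ} (hε : 0 < ε)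
    (h₁ : IntegrableOn (fun r : ℝ => f (((c : ℂ) - ε * Complex.I) + r * (-1))) (Ioi 0))
    (h₂ : IntegrableOn (fun r : ℝ => f (((c : ℂ) + ε * Complex.I) + r * (-1))) (Ioi 0))
    (h₃ : ContinuousOn (fun v : ℝ => f ((c : ℂ) + v * Complex.I)) (Icc (-ε) ε)) :
    Integrable (fun r => f (hankelPath c ε r) * hankelVel ε r) ∧
      hankelIntegral c ε f = ∫ r, f (hankelPath c ε r) * hankelVel ε r := by
  have e₁ : EqOn (fun r : ℝ => f (((c : ℂ) - ε * Complex.I) + ((-ε - r : ℝ) : ℂ) * (-1)) * 1)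
      (fun r => f (hankelPath c ε r) * hankelVel ε r) (Iic (-ε)) := by
    intro r hr
    have hr' : r ≤ -ε := hr
    have a1 : |r| = -r := abs_of_nonpos (by linarith)
    have a2 : max (|r| - ε) 0 = -r - ε := by rw [a1]; exact max_eq_left (by linarith)
    have a3 : max (-ε) (min r ε) = -ε := by
      rw [min_eq_left (by linarith)]; exact max_eq_left hr'
    simp only [hankelPath, hankelVel, hr', if_true, a2, a3]
    congr 2
    push_cast
    ring
  have e₂ : EqOn (fun r : ℝ => f (((c : ℂ) + ε * Complex.I) + ((r - ε : ℝ) : ℂ) * (-1)) * (-1))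
      (fun r => f (hankelPath c ε r) * hankelVel ε r) (Ioi ε) := by
    intro r hr
    have hr' : ε < r := hr
    have a1 : |r| = r := abs_of_nonneg (by linarith)
    have a2 : max (|r| - ε) 0 = r - ε := by rw [a1]; exact max_eq_left (by linarith)
    have a3 : max (-ε) (min r ε) = ε := by
      rw [min_eq_right hr'.le]; exact max_eq_right (by linarith)
    simp only [hankelPath, hankelVel, not_le.2 hr', not_le.2 (show -ε < r by linarith), if_false,
      a2, a3]
    congr 2
    push_cast
    ring
  have e₃ : EqOn (fun v : ℝ => f ((c : ℂ) + v * Complex.I) * Complex.I)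
      (fun r => f (hankelPath c ε r) * hankelVel ε r) (Ioc (-ε) ε) := by
    intro r hr
    have a2 : max (|r| - ε) 0 = 0 := max_eq_right (by linarith [abs_le.2 ⟨hr.1.le, hr.2⟩])
    have a3 : max (-ε) (min r ε) = r := by
      rw [min_eq_left hr.2]; exact max_eq_right hr.1.le
    simp only [hankelPath, hankelVel, not_le.2 hr.1, hr.2, if_false, if_true, a2, a3, sub_zero]
  have i₃ : IntegrableOn (fun r => f (hankelPath c ε r) * hankelVel ε r) (Ioc (-ε) ε) :=
    (((h₃.mul continuousOn_const).integrableOn_Icc).mono_set Ioc_subset_Icc_self).congr_fun e₃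
      measurableSet_Ioc
  obtain ⟨i₁', v₁⟩ := integral_Iic_comp_const_sub
    (fun r : ℝ => f (((c : ℂ) - ε * Complex.I) + r * (-1)) * 1) (-ε) (Integrable.mul_const h₁ 1)
  obtain ⟨i₂', v₂⟩ := integral_Ioi_comp_sub
    (fun r : ℝ => f (((c : ℂ) + ε * Complex.I) + r * (-1)) * (-1)) ε (Integrable.mul_const h₂ (-1))
  have i₁ := i₁'.congr_fun e₁ measurableSet_Iic
  have i₂ := i₂'.congr_fun e₂ measurableSet_Ioi
  have i₁₃ : IntegrableOn (fun r => f (hankelPath c ε r) * hankelVel ε r) (Iic ε) := by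
    rw [← Iic_union_Ioc_eq_Iic (show -ε ≤ ε by linarith)]
    exact i₁.union i₃
  constructor
  · rw [← integrableOn_univ, ← Iic_union_Ioi (a := ε)]
    exact i₁₃.union i₂
  · rw [← intervalIntegral.integral_Iic_add_Ioi i₁₃ i₂,
      ← Iic_union_Ioc_eq_Iic (show -ε ≤ ε by linarith),
      setIntegral_union (Iic_disjoint_Ioc le_rfl) measurableSet_Ioc i₁ i₃,
      ← setIntegral_congr_fun measurableSet_Iic e₁, ← setIntegral_congr_fun measurableSet_Ioi e₂,
      ← setIntegral_congr_fun measurableSet_Ioc e₃,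
      ← intervalIntegral.integral_of_le (show -ε ≤ ε by linarith)]
    rw [v₁, v₂]
    simp only [hankelIntegral, rayIntegral, mul_neg, mul_one, integral_neg, neg_neg]

/-- The double integral of `φ(u) ψ(v) / (s(u) - t(v))` over two contours with `t` to the left of `s`
separates, since `1 / (s - t) = ∫₀^∞ e^{-l (s - t)} dl`. -/
theorem integral_integral_div_sub {μ : Measure ℝ} [SFinite μ] {φ ψ s t : ℝ → ℂ} {σ τ : ℝ}
    (hφ : Integrable φ μ)
    (hψ : Integrable ψ) (hs : Measurable s) (ht : Measurable t) (hστ : τ < σ)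
    (hsσ : ∀ u, σ ≤ (s u).re) (htτ : ∀ v, (t v).re ≤ τ) :
    Integrable (fun u => φ u * ∫ v, ψ v / (s u - t v)) μ ∧
    ∫ u, (φ u * ∫ v, ψ v / (s u - t v)) ∂μ =
      ∫ l in Ioi (0 : ℝ), (∫ u, φ u * Complex.exp (-(l * s u)) ∂μ) *
        ∫ v, ψ v * Complex.exp (l * t v) := by
  have hint : Integrable (Function.uncurry fun (p : ℝ × ℝ) (l : ℝ) =>
      (φ p.1 * Complex.exp (-(l * s p.1))) * (ψ p.2 * Complex.exp (l * t p.2)))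
      ((μ.prod volume).prod (volume.restrict (Ioi 0))) := by
    have h1 : Integrable (fun p : (ℝ × ℝ) × ℝ => (φ p.1.1 * ψ p.1.2) *
        Complex.exp (((-(σ - τ) * p.2 : ℝ) : ℂ)))
        ((μ.prod volume).prod (volume.restrict (Ioi 0))) := by
      refine (hφ.mul_prod hψ).mul_prod (ν := volume.restrict (Ioi 0))
        (g := fun l : ℝ => Complex.exp (((-(σ - τ) * l : ℝ) : ℂ))) ?_
      have := (integrableOn_exp_mul_Ioi (a := -(σ - τ)) (by linarith) 0).ofReal (𝕜 := ℂ)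
      simpa using this
    refine h1.mono ?_ ?_
    · refine (AEStronglyMeasurable.mul ?_ ?_)
      · refine AEStronglyMeasurable.mul ?_ ?_
        · exact (hφ.aestronglyMeasurable.comp_fst (ν := (volume : Measure ℝ))).comp_fst
        · exact Measurable.aestronglyMeasurable (by fun_prop)
      · refine AEStronglyMeasurable.mul ?_ ?_
        · exact (hψ.aestronglyMeasurable.comp_snd (μ := μ)).comp_fst
        · exact Measurable.aestronglyMeasurable (by fun_prop)
    · have hpos : ∀ᵐ p ∂((μ.prod (volume : Measure ℝ)).prod (volume.restrict (Ioi (0:ℝ)))),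
          0 < p.2 := by
        have : ∀ᵐ l ∂(volume.restrict (Ioi (0:ℝ))), 0 < l := ae_restrict_mem measurableSet_Ioi
        exact Measure.quasiMeasurePreserving_snd.ae this
      filter_upwards [hpos] with p hp
      simp only [Function.uncurry, norm_mul, Complex.norm_exp, Complex.ofReal_re]
      have e1 : (-((p.2 : ℂ) * s p.1.1)).re = -(p.2 * (s p.1.1).re) := by simp
      have e2 : ((p.2 : ℂ) * t p.1.2).re = p.2 * (t p.1.2).re := by simp
      rw [e1, e2]
      have : Real.exp (-(p.2 * (s p.1.1).re)) * Real.exp (p.2 * (t p.1.2).re) ≤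
          Real.exp (-(σ - τ) * p.2) := by
        rw [← Real.exp_add, Real.exp_le_exp]
        nlinarith [hsσ p.1.1, htτ p.1.2]
      calc _ = ‖φ p.1.1‖ * ‖ψ p.1.2‖ *
            (Real.exp (-(p.2 * (s p.1.1).re)) * Real.exp (p.2 * (t p.1.2).re)) := by ring
        _ ≤ _ := by gcongr
  have hlap : ∀ u v, ∫ l in Ioi (0 : ℝ), (φ u * Complex.exp (-(l * s u))) *
      (ψ v * Complex.exp (l * t v)) = φ u * (ψ v / (s u - t v)) := by
    intro u v
    have hre : (-(s u - t v)).re < 0 := by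
      simp only [Complex.neg_re, Complex.sub_re]; linarith [hsσ u, htτ v]
    have h := integral_exp_mul_complex_Ioi hre 0
    have hne : s u - t v ≠ 0 := by
      intro h0; rw [h0] at hre; simp at hre
    calc _ = ∫ l in Ioi (0 : ℝ), (φ u * ψ v) * Complex.exp (-(s u - t v) * l) := by
          congr 1; ext l
          rw [show -(s u - t v) * (l : ℂ) = -(l * s u) + l * t v by ring, Complex.exp_add]
          ring
      _ = _ := by
          rw [integral_const_mul, h, Complex.ofReal_zero, mul_zero, Complex.exp_zero, neg_div_neg_eq]
          ring
  have hswap := integral_integral_swap hint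
  have hprod : Integrable (fun p : ℝ × ℝ => φ p.1 * (ψ p.2 / (s p.1 - t p.2)))
      (μ.prod volume) := by
    have := hint.integral_prod_left
    simpa only [Function.uncurry, hlap] using this
  simp only [hlap] at hswap
  rw [integral_prod _ hprod] at hswap
  simp only [integral_const_mul] at hswap
  refine ⟨by simpa only [integral_const_mul] using hprod.integral_prod_left, ?_⟩
  rw [hswap]
  congr 1
  ext l
  exact integral_prod_mul (fun u => φ u * Complex.exp (-(l * s u)))
    (fun v => ψ v * Complex.exp (l * t v))

/-- The error made by closing a contour far out, along a segment of affine length. -/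
theorem tendsto_exp_sub_mul_affine (C K α β : ℝ) {b : ℝ} (hb : 0 < b) :
    Tendsto (fun R : ℝ => C * Real.exp (K - b * R) * (α * R + β)) atTop (𝓝 0) := by
  have h1 : Tendsto (fun R : ℝ => R * Real.exp (-b * R)) atTop (𝓝 0) := by
    simpa using tendsto_rpow_mul_exp_neg_mul_atTop_nhds_zero 1 b hb
  have h0 : Tendsto (fun R : ℝ => Real.exp (-b * R)) atTop (𝓝 0) := by
    simpa using tendsto_rpow_mul_exp_neg_mul_atTop_nhds_zero 0 b hb
  have := ((h1.const_mul α).add (h0.const_mul β)).const_mul (C * Real.exp K)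
  simp only [mul_zero, add_zero] at this
  refine this.congr fun R => ?_
  rw [show K - b * R = K + -b * R by ring, Real.exp_add]
  ring

/-- `f` decays exponentially to the left in the region between the lines `|Im z| = ε` and the two
rays of slope `∓ 3/4` that leave `a` to the left. This region is what the Hankel contour sweeps when
it is opened up to those rays. The slope is below `1`, so that `e^{-γ t²/2}` is small there. -/
def DecaysLeft (f : ℂ → ℂ) (a ε : ℝ) : Prop :=
  ∃ C A : ℝ, ∀ z : ℂ, z.re ≤ A → ε ≤ |z.im| → 4 * |z.im| ≤ 3 * (a - z.re) →
    ‖f z‖ ≤ C * Real.exp z.re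

section Hankel

variable {f : ℂ → ℂ} {p a c ε : ℝ}

theorem sub_mem_slitPlane_of_im_ne {z : ℂ} (p : ℝ) (h : z.im ≠ 0) : z - p ∈ Complex.slitPlane := by
  rw [Complex.mem_slitPlane_iff]
  right
  simpa using h

theorem sub_mem_slitPlane_of_lt_re {z : ℂ} {p : ℝ} (h : p < z.re) : z - p ∈ Complex.slitPlane := by
  rw [Complex.mem_slitPlane_iff]
  left
  simpa using h

theorem wedge_sub_mem_slitPlane (hpa : p < a) {σ : ℝ} (hσ : σ ≠ 0) {r : ℝ} (hr : 0 ≤ r) :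
    ((a : ℂ) + r * (-4 + 3 * σ * Complex.I)) - p ∈ Complex.slitPlane := by
  rcases hr.eq_or_lt with rfl | hr
  · exact sub_mem_slitPlane_of_lt_re (by simpa using hpa)
  · exact sub_mem_slitPlane_of_im_ne p (by simp [hr.ne', hσ])

theorem DecaysLeft.integrableOn_wedge (hd : DecaysLeft f a ε)
    (hf : ∀ z : ℂ, z - p ∈ Complex.slitPlane → DifferentiableAt ℂ f z) (hpa : p < a)
    {σ : ℝ} (hσ : |σ| = 1) :
    IntegrableOn (fun r : ℝ => f (a + r * (-4 + 3 * σ * Complex.I))) (Ioi 0) := by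
  obtain ⟨C, A, hd⟩ := hd
  have hσ0 : σ ≠ 0 := by rintro rfl; simp at hσ
  refine integrableOn_ray (C := C * Real.exp a) (A := max (max ((a - A) / 4) (ε / 3)) 0) (b := 4)
    (by norm_num)
    (fun r hr => (hf _ (wedge_sub_mem_slitPlane hpa hσ0 hr)).continuousAt) fun r hr => ?_
  have h1 : (a - A) / 4 ≤ r := ((le_max_left _ _).trans (le_max_left _ _)).trans hr
  have h2 : ε / 3 ≤ r := ((le_max_right _ _).trans (le_max_left _ _)).trans hr
  have h3 : 0 ≤ r := (le_max_right _ _).trans hr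
  have hre : ((a : ℂ) + r * (-4 + 3 * σ * Complex.I)).re = a - 4 * r := by simp; ring
  have him : |((a : ℂ) + r * (-4 + 3 * σ * Complex.I)).im| = 3 * r := by
    simp [abs_mul, hσ, abs_of_nonneg h3]; ring
  have := hd (a + r * (-4 + 3 * σ * Complex.I)) (by rw [hre]; linarith) (by rw [him]; linarith)
    (by rw [hre, him]; linarith)
  rw [hre] at this
  refine this.trans_eq ?_
  rw [mul_assoc C, ← Real.exp_add]
  ring_nf

theorem DecaysLeft.integrableOn_hankel (hd : DecaysLeft f a ε)
    (hf : ∀ z : ℂ, z - p ∈ Complex.slitPlane → DifferentiableAt ℂ f z) (hε : 0 < ε)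
    {σ : ℝ} (hσ : |σ| = 1) :
    IntegrableOn (fun r : ℝ => f (((c : ℂ) + σ * ε * Complex.I) + r * (-1))) (Ioi 0) := by
  obtain ⟨C, A, hd⟩ := hd
  have hσ0 : σ ≠ 0 := by rintro rfl; simp at hσ
  have him : ∀ r : ℝ, (((c : ℂ) + σ * ε * Complex.I) + r * (-1)).im = σ * ε := by
    intro r; simp
  refine integrableOn_ray (C := C * Real.exp c) (A := max (c - A) (c - a + 4 / 3 * ε)) (b := 1)
    (by norm_num)
    (fun r hr => (hf _ (sub_mem_slitPlane_of_im_ne p ?_)).continuousAt) fun r hr => ?_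
  · rw [him]; positivity
  have h1 : c - A ≤ r := (le_max_left _ _).trans hr
  have h2 : c - a + 4 / 3 * ε ≤ r := (le_max_right _ _).trans hr
  have hre : (((c : ℂ) + σ * ε * Complex.I) + r * (-1)).re = c - r := by simp; ring
  have him' : |(((c : ℂ) + σ * ε * Complex.I) + r * (-1)).im| = ε := by
    rw [him, abs_mul, hσ, abs_of_pos hε, one_mul]
  have := hd (((c : ℂ) + σ * ε * Complex.I) + r * (-1)) (by rw [hre]; linarith) (by rw [him'])
    (by rw [hre, him']; linarith)
  rw [hre] at this
  refine this.trans_eq ?_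
  rw [mul_assoc C, ← Real.exp_add]
  ring_nf

theorem continuousOn_hankel_segment
    (hf : ∀ z : ℂ, z - p ∈ Complex.slitPlane → DifferentiableAt ℂ f z) (hpc : p < c) (s : Set ℝ) :
    ContinuousOn (fun v : ℝ => f ((c : ℂ) + v * Complex.I)) s := by
  intro v _
  exact (ContinuousAt.comp (f := fun v : ℝ => (c : ℂ) + (v : ℂ) * Complex.I)
    (hf _ (sub_mem_slitPlane_of_lt_re (by simpa using hpc))).continuousAt
    (by fun_prop)).continuousWithinAt

/-- The Hankel contour around the slit `(-∞, p]` can be opened up to a wedge with vertex `a > p`. -/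
theorem hankelIntegral_eq_wedgeIntegral (hd : DecaysLeft f a ε)
    (hf : ∀ z : ℂ, z - p ∈ Complex.slitPlane → DifferentiableAt ℂ f z) (hpa : p < a) (hpc : p < c)
    (hε : 0 < ε) :
    hankelIntegral c ε f = wedgeIntegral a (-4 - 3 * Complex.I) (-4 + 3 * Complex.I) f := by
  obtain ⟨P, hP⟩ := exists_primitive_slit (p : ℂ) hf
  have key : ∀ σ : ℝ, |σ| = 1 → P a + rayIntegral a (-4 + 3 * σ * Complex.I) f =
      P (c + σ * ε * Complex.I) + rayIntegral (c + σ * ε * Complex.I) (-1) f := by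
    intro σ hσ
    have hσ0 : σ ≠ 0 := by rintro rfl; simp at hσ
    have hi₁ := hd.integrableOn_wedge hf hpa hσ
    have hi₂ := hd.integrableOn_hankel (c := c) hf hε hσ
    obtain ⟨C, A, hd⟩ := hd
    refine primitive_add_rayIntegral_eq (ρ := fun R => c - a + 4 * R)
      (b := fun R => |C| * Real.exp (a - 4 * R))
      (fun r hr => hP _ (wedge_sub_mem_slitPlane hpa hσ0 hr)) hi₁
      (fun r hr => hP _ (sub_mem_slitPlane_of_im_ne p ?_)) hi₂ ?_ ?_ ?_
    · simp only [Complex.add_im, Complex.mul_im]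
      simp
      exact ⟨hσ0, hε.ne'⟩
    · exact tendsto_atTop_add_const_left _ _ (tendsto_id.const_mul_atTop (by norm_num))
    · filter_upwards [eventually_ge_atTop ((a - A) / 4), eventually_ge_atTop (ε / 3)]
        with R h1 h2 z hz
      have hσ2 : σ * σ = 1 := by rw [← abs_mul_abs_self, hσ, one_mul]
      obtain ⟨s, t, hs, ht, hst, rfl⟩ := hz
      set z := s • ((a : ℂ) + R * (-4 + 3 * σ * Complex.I)) +
        t • (c + σ * ε * Complex.I + ((c - a + 4 * R : ℝ) : ℂ) * -1) with hz
      have hre : z.re = a - 4 * R := by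
        rw [hz]; simp
        obtain rfl : s = 1 - t := by linarith
        ring
      have him : z.im = σ * (s * (3 * R) + t * ε) := by
        rw [hz]; simp; ring
      have hb1 : ε ≤ s * (3 * R) + t * ε := by
        obtain rfl : s = 1 - t := by linarith
        nlinarith
      have hb2 : s * (3 * R) + t * ε ≤ 3 * R := by
        obtain rfl : s = 1 - t := by linarith
        nlinarith
      have him' : |z.im| = s * (3 * R) + t * ε := by
        rw [him, abs_mul, hσ, one_mul, abs_of_nonneg (by linarith)]
      refine ⟨hP _ (sub_mem_slitPlane_of_im_ne p ?_), ?_⟩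
      · intro h0
        rw [h0, abs_zero] at him'
        linarith
      · have := hd z (by rw [hre]; linarith) (by rw [him']; exact hb1)
          (by rw [him', hre]; linarith)
        rw [hre] at this
        exact this.trans (by gcongr; exact le_abs_self C)
    · refine squeeze_zero_norm' ?_ (tendsto_exp_sub_mul_affine |C| a 3 ε (b := 4) (by norm_num))
      filter_upwards [eventually_ge_atTop 0] with R hR
      have : c + σ * ε * Complex.I + ((c - a + 4 * R : ℝ) : ℂ) * -1 -
          ((a : ℂ) + R * (-4 + 3 * σ * Complex.I)) = ((σ * (ε - 3 * R) : ℝ) : ℂ) * Complex.I := by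
        push_cast; ring
      have hn : ‖((σ * (ε - 3 * R) : ℝ) : ℂ) * Complex.I‖ = |ε - 3 * R| := by
        rw [norm_mul, Complex.norm_I, mul_one, Complex.norm_real, Real.norm_eq_abs, abs_mul, hσ,
          one_mul]
      rw [this, hn, Real.norm_of_nonneg (by positivity)]
      gcongr
      rw [abs_le]
      constructor <;> linarith
  have h1 := key 1 (by simp)
  have h2 := key (-1) (by simp)
  have h3 : ∫ v in (-ε)..ε, f ((c : ℂ) + v * Complex.I) * Complex.I =
      P (c + (ε : ℂ) * Complex.I) - P (c + ((-ε : ℝ) : ℂ) * Complex.I) := by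
    refine intervalIntegral.integral_eq_sub_of_hasDerivAt
      (f := fun v : ℝ => P (c + v * Complex.I)) (fun v _ => ?_) ?_
    · have hl : HasDerivAt (fun v : ℝ => (c : ℂ) + (v : ℂ) * Complex.I) Complex.I v := by
        simpa using ((Complex.ofRealCLM.hasDerivAt (x := v)).mul_const Complex.I).const_add (c : ℂ)
      exact HasDerivAt.comp v (hP _ (sub_mem_slitPlane_of_lt_re (by simpa using hpc))) hl
    · exact ((continuousOn_hankel_segment hf hpc _).mul continuousOn_const).intervalIntegrable
  unfold hankelIntegral wedgeIntegral
  rw [h3]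
  have e1 : (-4 + 3 * ((1 : ℝ) : ℂ) * Complex.I) = -4 + 3 * Complex.I := by push_cast; ring
  have e2 : (-4 + 3 * ((-1 : ℝ) : ℂ) * Complex.I) = -4 - 3 * Complex.I := by push_cast; ring
  have e3 : (c + ((1 : ℝ) : ℂ) * ε * Complex.I) = c + ε * Complex.I := by push_cast; ring
  have e4 : (c + ((-1 : ℝ) : ℂ) * ε * Complex.I) = c - ε * Complex.I := by push_cast; ring
  have e5 : (c + ((-ε : ℝ) : ℂ) * Complex.I) = c - ε * Complex.I := by push_cast; ring
  rw [e1, e3] at h1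
  rw [e2, e4] at h2
  rw [e5]
  linear_combination h2 - h1

end Hankel

/-! ### Bounds for the Gamma function -/

theorem norm_Gamma_le_Gamma_re {z : ℂ} (hz : 0 < z.re) : ‖Complex.Gamma z‖ ≤ Real.Gamma z.re := by
  rw [Complex.Gamma_eq_integral hz, Complex.GammaIntegral, Real.Gamma_eq_integral hz]
  refine (norm_integral_le_integral_norm _).trans_eq ?_
  refine setIntegral_congr_fun measurableSet_Ioi fun x hx => ?_
  have hx : 0 < x := hx
  simp only [norm_mul, Complex.norm_cpow_eq_rpow_re_of_pos hx, Complex.sub_re, Complex.one_re,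
    Complex.norm_real, Real.norm_eq_abs, Real.abs_exp]

theorem norm_Gamma_le_inv_pow {η : ℝ} (hη : 0 < η) (n : ℕ) {z : ℂ} (h₁ : 1 - n ≤ z.re)
    (h₂ : z.re ≤ 2 - n) (him : η ≤ |z.im|) : ‖Complex.Gamma z‖ ≤ η⁻¹ ^ n := by
  induction n generalizing z with
  | zero =>
    simp only [Nat.cast_zero, sub_zero] at h₁ h₂
    refine (norm_Gamma_le_Gamma_re (by linarith)).trans ?_
    have := Real.convexOn_Gamma.le_max_of_mem_Icc (x := 1) (y := 2) (z := z.re)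
      (by simp) (by simp) ⟨h₁, h₂⟩
    simpa using this
  | succ n ih =>
    push_cast at h₁ h₂
    have hz : z ≠ 0 := by rintro rfl; simp at him; linarith
    have h := ih (z := z + 1) (by simp; linarith) (by simp; linarith) (by simpa using him)
    rw [Complex.Gamma_add_one z hz, norm_mul] at h
    have hzn : η ≤ ‖z‖ := him.trans (Complex.abs_im_le_norm z)
    rw [pow_succ, ← div_eq_mul_inv, le_div_iff₀ hη]
    calc _ ≤ ‖Complex.Gamma z‖ * ‖z‖ := by gcongr
      _ ≤ _ := by rwa [mul_comm]

/-- Away from the real axis `Γ` grows at most exponentially to the left. -/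
theorem exists_norm_Gamma_le_exp {η : ℝ} (hη : 0 < η) :
    ∃ K : ℝ, 0 ≤ K ∧ ∀ z : ℂ, z.re ≤ 2 → η ≤ |z.im| →
      ‖Complex.Gamma z‖ ≤ Real.exp (K * (2 - z.re)) := by
  refine ⟨Real.log (max η⁻¹ 1), Real.log_nonneg (le_max_right _ _), fun z hz him => ?_⟩
  have hn := Nat.floor_le (show 0 ≤ 2 - z.re by linarith)
  have hn' := Nat.lt_floor_add_one (2 - z.re)
  refine (norm_Gamma_le_inv_pow hη ⌊2 - z.re⌋₊ (by linarith) (by linarith) him).trans ?_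
  have h0 : 0 < max η⁻¹ 1 := lt_max_of_lt_right one_pos
  calc _ ≤ (max η⁻¹ 1) ^ ⌊2 - z.re⌋₊ := by gcongr; exact le_max_left _ _
    _ = Real.exp (Real.log (max η⁻¹ 1) * (⌊2 - z.re⌋₊ : ℝ)) := by
        rw [← Real.rpow_natCast, Real.rpow_def_of_pos h0]
    _ ≤ _ := by
        gcongr
        exact Real.log_nonneg (le_max_right _ _)

/-- On vertical lines, `Γ(σ) / |Γ(σ + iv)|` decreases in `σ`. -/
theorem Gamma_mul_norm_Gamma_le {σ σ' : ℝ} (hσ : 0 < σ) (h : σ ≤ σ') (v : ℝ) :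
    Real.Gamma σ' * ‖Complex.Gamma (σ + v * Complex.I)‖ ≤
      Real.Gamma σ * ‖Complex.Gamma (σ' + v * Complex.I)‖ := by
  have t := fun s : ℂ => (Complex.GammaSeq_tendsto_Gamma s).norm
  refine le_of_tendsto_of_tendsto
    ((Real.GammaSeq_tendsto_Gamma σ').mul (t (σ + v * Complex.I)))
    ((Real.GammaSeq_tendsto_Gamma σ).mul (t (σ' + v * Complex.I))) ?_
  filter_upwards [eventually_gt_atTop 0] with n hn
  have hn' : (0 : ℝ) < n := by exact_mod_cast hn
  have hne : ∀ {a : ℝ}, 0 < a → ∀ j : ℕ, ((a : ℂ) + v * Complex.I + j) ≠ 0 := by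
    intro a ha j h0
    have := congrArg Complex.re h0
    simp at this
    have : 0 < a + j := by positivity
    linarith
  have hre : ∀ a : ℝ, ‖((n : ℂ)) ^ ((a : ℂ) + v * Complex.I)‖ = (n : ℝ) ^ a := by
    intro a
    rw [Complex.norm_natCast_cpow_of_pos hn]
    simp
  simp only [Complex.GammaSeq, Real.GammaSeq, norm_div, norm_mul, hre, norm_prod,
    Complex.norm_natCast]
  have hprod : (∏ j ∈ Finset.range (n + 1), (σ + j)) *
      (∏ j ∈ Finset.range (n + 1), ‖(σ' : ℂ) + v * Complex.I + j‖) ≤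
      (∏ j ∈ Finset.range (n + 1), (σ' + j)) *
      (∏ j ∈ Finset.range (n + 1), ‖(σ : ℂ) + v * Complex.I + j‖) := by
    rw [← Finset.prod_mul_distrib, ← Finset.prod_mul_distrib]
    refine Finset.prod_le_prod (fun j _ => by positivity) fun j _ => ?_
    have hnorm : ∀ a : ℝ, ‖(a : ℂ) + v * Complex.I + j‖ = √((a + j) ^ 2 + v ^ 2) := by
      intro a
      rw [show (a : ℂ) + v * Complex.I + j = ((a + j : ℝ) : ℂ) + v * Complex.I by push_cast; ring,
        Complex.norm_add_mul_I]
    rw [hnorm, hnorm]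
    have hj : (0 : ℝ) ≤ j := Nat.cast_nonneg j
    have h1 : 0 < σ + j := by linarith
    have h2 : 0 < σ' + j := by linarith
    refine abs_le_of_sq_le_sq' ?_ (by positivity) |>.2
    rw [mul_pow, mul_pow, Real.sq_sqrt (by positivity), Real.sq_sqrt (by positivity)]
    have : (σ + j) ^ 2 ≤ (σ' + j) ^ 2 := by gcongr
    nlinarith [sq_nonneg v]
  have p1 : ∀ {a : ℝ}, 0 < a → 0 < ∏ j ∈ Finset.range (n + 1), (a + j) :=
    fun ha => Finset.prod_pos fun j _ => by positivity
  have p2 : ∀ {a : ℝ}, 0 < a → 0 < ∏ j ∈ Finset.range (n + 1), ‖(a : ℂ) + v * Complex.I + j‖ :=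
    fun ha => Finset.prod_pos fun j _ => norm_pos_iff.2 (hne ha j)
  have hσ' := hσ.trans_le h
  rw [div_mul_div_comm, div_mul_div_comm, div_le_div_iff₀ (mul_pos (p1 hσ') (p2 hσ))
    (mul_pos (p1 hσ) (p2 hσ'))]
  rw [show (n : ℝ) ^ σ * n.factorial * ((n : ℝ) ^ σ' * n.factorial) =
    (n : ℝ) ^ σ' * n.factorial * ((n : ℝ) ^ σ * n.factorial) by ring]
  gcongr

/-- From the reflection formula `|Γ(1 + iv)|² = π v / sinh (π v)`. -/
theorem norm_inv_Gamma_one_add_le (v : ℝ) :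
    ‖(Complex.Gamma (1 + v * Complex.I))⁻¹‖ ≤ Real.exp (2 * |v|) := by
  by_cases hv : v = 0
  · simp [hv]
  have hconj : Complex.Gamma (1 - v * Complex.I) =
      (starRingEnd ℂ) (Complex.Gamma (1 + v * Complex.I)) := by
    rw [← Complex.Gamma_conj]; simp [sub_eq_add_neg]
  have hvI : (v : ℂ) * Complex.I ≠ 0 := by simp [hv]
  have hrefl := Complex.Gamma_mul_Gamma_one_sub (v * Complex.I)
  have h1 : Complex.Gamma (1 + v * Complex.I) = v * Complex.I * Complex.Gamma (v * Complex.I) := by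
    rw [add_comm, Complex.Gamma_add_one _ hvI]
  have h2 : Complex.Gamma (1 + v * Complex.I) * (starRingEnd ℂ) (Complex.Gamma (1 + v * Complex.I))
      = v * Complex.I * (Real.pi / Complex.sin (Real.pi * (v * Complex.I))) := by
    rw [← hconj, ← hrefl, h1]; ring
  have h3 := congrArg norm h2
  rw [norm_mul, RCLike.norm_conj, ← mul_assoc (Real.pi : ℂ), Complex.sin_mul_I] at h3
  have h4 : ‖(v : ℂ) * Complex.I * (Real.pi / (Complex.sinh (Real.pi * v) * Complex.I))‖ =
      Real.pi * |v| / Real.sinh (Real.pi * |v|) := by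
    rw [← Complex.ofReal_mul, ← Complex.ofReal_sinh]
    simp only [norm_mul, norm_div, Complex.norm_real, Complex.norm_I, mul_one, Real.norm_eq_abs,
      Real.abs_sinh, abs_mul, abs_of_pos Real.pi_pos]
    ring
  rw [h4] at h3
  have hx : 0 < Real.pi * |v| := by positivity
  set x := Real.pi * |v| with hxdef
  have hsinh : 0 < Real.sinh x := Real.sinh_pos_iff.2 hx
  -- `sinh x ≤ x eˣ`, from `1 - e^{-2x} ≤ 2x`
  have hle : Real.sinh x ≤ x * Real.exp x := by
    rw [Real.sinh_eq]
    have e1 := Real.add_one_le_exp (-(2 * x))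
    have e2 : Real.exp (-x) = Real.exp (-(2 * x)) * Real.exp x := by
      rw [← Real.exp_add]; congr 1; ring
    rw [e2]
    nlinarith [Real.exp_pos x]
  set g := ‖Complex.Gamma (1 + v * Complex.I)‖ with hg
  have hg2 : g * g ≠ 0 := by rw [h3]; positivity
  have hg0 : 0 < g := lt_of_le_of_ne (norm_nonneg _) fun h0 => hg2 (by rw [← h0]; simp)
  have hinv : g⁻¹ * g⁻¹ ≤ Real.exp x := by
    rw [← mul_inv, h3, inv_div, div_le_iff₀ hx]
    linarith
  rw [norm_inv]
  refine abs_le_of_sq_le_sq' ?_ (Real.exp_pos _).le |>.2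
  rw [sq, sq, ← Real.exp_add]
  refine hinv.trans (Real.exp_le_exp.2 ?_)
  rw [hxdef]
  nlinarith [Real.pi_le_four, abs_nonneg v]

/-- In a vertical strip of the right half plane, `1 / Γ` grows at most exponentially. -/
theorem exists_norm_inv_Gamma_le (B : ℝ) :
    ∃ C : ℝ, 0 ≤ C ∧ (∀ s : ℂ, 1 ≤ s.re → s.re ≤ B →
      ‖(Complex.Gamma s)⁻¹‖ ≤ C * Real.exp (2 * |s.im|)) := by
  have hc : ContinuousOn (fun x : ℝ => (Real.Gamma x)⁻¹) (Icc 1 B) := by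
    refine ContinuousOn.inv₀ (Real.differentiableOn_Gamma_Ioi.continuousOn.mono fun x hx => ?_)
      fun x hx => (Real.Gamma_pos_of_pos (by linarith [hx.1])).ne'
    exact lt_of_lt_of_le one_pos hx.1
  obtain ⟨C, hC⟩ := isCompact_Icc.exists_bound_of_continuousOn hc
  refine ⟨|C|, abs_nonneg C, fun s hs hsB => ?_⟩
  have h := Gamma_mul_norm_Gamma_le one_pos hs s.im
  rw [Complex.re_add_im, Real.Gamma_one, one_mul, Complex.ofReal_one] at h
  have hΓ : 0 < Real.Gamma s.re := Real.Gamma_pos_of_pos (by linarith)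
  have h1 : 0 < ‖Complex.Gamma (1 + s.im * Complex.I)‖ :=
    norm_pos_iff.2 (Complex.Gamma_ne_zero_of_re_pos (by simp))
  have h2 := (hC s.re ⟨hs, hsB⟩).trans (le_abs_self C)
  rw [Real.norm_of_nonneg (by positivity)] at h2
  calc ‖(Complex.Gamma s)⁻¹‖ ≤ (Real.Gamma s.re * ‖Complex.Gamma (1 + s.im * Complex.I)‖)⁻¹ := by
        rw [norm_inv]; exact inv_anti₀ (by positivity) h
    _ = (Real.Gamma s.re)⁻¹ * ‖(Complex.Gamma (1 + s.im * Complex.I))⁻¹‖ := by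
        rw [mul_inv, norm_inv]
    _ ≤ _ := by gcongr; exact norm_inv_Gamma_one_add_le _

/-! ### The digamma function -/

theorem hasDerivAt_log_Gamma {x : ℝ} (hx : 0 < x) :
    HasDerivAt (fun y => Real.log (Real.Gamma y)) (digamma x) x := by
  have hd : DifferentiableAt ℝ Real.Gamma x :=
    (Real.differentiableOn_Gamma_Ioi x hx).differentiableAt (Ioi_mem_nhds hx)
  have := hd.hasDerivAt.log (Real.Gamma_pos_of_pos hx).ne'
  rwa [← logDeriv_apply] at this

theorem digamma_add_one {x : ℝ} (hx : 0 < x) : digamma (x + 1) = digamma x + 1 / x := by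
  have h1 : HasDerivAt (fun y => Real.log (Real.Gamma (y + 1))) (digamma (x + 1)) x :=
    (hasDerivAt_log_Gamma (x := x + 1) (by linarith)).comp_add_const x 1
  have h2 := (hasDerivAt_log_Gamma hx).add (Real.hasDerivAt_log hx.ne')
  rw [one_div]
  refine h1.unique (h2.congr_of_eventuallyEq ?_)
  filter_upwards [Ioi_mem_nhds hx] with y hy
  have hy : 0 < y := hy
  rw [Real.Gamma_add_one hy.ne', Real.log_mul hy.ne' (Real.Gamma_pos_of_pos hy).ne', add_comm]
  rfl

/-- By convexity of `log Γ`, `ψ` is at most its slope between `x` and `x + 1`. -/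
theorem digamma_le_log {x : ℝ} (hx : 0 < x) : digamma x ≤ Real.log x := by
  have h := Real.convexOn_log_Gamma.le_slope_of_hasDerivAt (x := x) (y := x + 1) hx
    (show 0 < x + 1 by linarith) (by linarith) (hasDerivAt_log_Gamma hx)
  rw [slope_def_field, add_sub_cancel_left, div_one] at h
  simp only [Function.comp] at h
  rw [Real.Gamma_add_one hx.ne', Real.log_mul hx.ne' (Real.Gamma_pos_of_pos hx).ne'] at h
  linarith

/-- By convexity of `log Γ`, `ψ` at `x + 1` is at least the slope between `x` and `x + 1`. -/
theorem log_le_digamma {x : ℝ} (hx : 0 < x) : Real.log x ≤ digamma (x + 1) := by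
  have h := Real.convexOn_log_Gamma.slope_le_of_hasDerivAt (x := x) (y := x + 1) hx
    (show 0 < x + 1 by linarith) (by linarith) (hasDerivAt_log_Gamma (by linarith))
  rw [slope_def_field, add_sub_cancel_left, div_one] at h
  simp only [Function.comp] at h
  rw [Real.Gamma_add_one hx.ne', Real.log_mul hx.ne' (Real.Gamma_pos_of_pos hx).ne'] at h
  linarith

theorem digamma_add_nat {x : ℝ} (hx : 0 < x) (n : ℕ) :
    digamma (x + n) = digamma x + ∑ j ∈ Finset.range n, 1 / (x + j) := by
  induction n with
  | zero => simp
  | succ n ih =>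
    rw [Finset.sum_range_succ, ← add_assoc, ← ih, ← digamma_add_one (by positivity)]
    push_cast; ring_nf

/-- The series for the digamma function, from `ψ(x + n) - log n → 0`, which follows from the
convexity of `log Γ`. -/
theorem tendsto_log_sub_sum {x : ℝ} (hx : 0 < x) :
    Tendsto (fun n : ℕ => Real.log n - ∑ j ∈ Finset.range (n + 1), 1 / (x + j)) atTop
      (𝓝 (digamma x)) := by
  have hlog : ∀ a : ℝ, 0 < a →
      Tendsto (fun n : ℕ => Real.log (a + n) - Real.log n) atTop (𝓝 0) := by
    intro a ha
    have h1 : Tendsto (fun n : ℕ => a / (n : ℝ) + 1) atTop (𝓝 (0 + 1)) :=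
      (tendsto_const_div_atTop_nhds_zero_nat a).add_const 1
    rw [zero_add] at h1
    have h2 := (Real.continuousAt_log one_ne_zero).tendsto.comp h1
    rw [Real.log_one] at h2
    refine h2.congr' ?_
    filter_upwards [eventually_gt_atTop 0] with n hn
    have hn' : (0 : ℝ) < n := by exact_mod_cast hn
    rw [← Real.log_div (by positivity) hn'.ne', Function.comp, add_div, div_self hn'.ne']
  have hd : Tendsto (fun n : ℕ => digamma (x + n + 1) - Real.log n) atTop (𝓝 0) := by
    refine tendsto_of_tendsto_of_tendsto_of_le_of_le (hlog x hx) (hlog (x + 1) (by linarith))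
      (fun n => ?_) fun n => ?_
    · exact sub_le_sub_right (log_le_digamma (by positivity)) _
    · refine sub_le_sub_right ?_ _
      rw [show x + 1 + (n : ℝ) = x + n + 1 by ring]
      exact digamma_le_log (by positivity)
  have := hd.const_sub (digamma x)
  rw [sub_zero] at this
  refine this.congr fun n => ?_
  have := digamma_add_nat hx (n + 1)
  push_cast at this
  rw [← add_assoc] at this
  rw [this]
  ring

/-- The sums `∑ j, 1 / (x + j) ^ p` over `j ≥ 0`, which up to sign and a factorial are the derivatives
of `digamma` when `2 ≤ p`; for `p ≤ 1` the series diverges and the value is `0`. -/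
def recipPowSum (p : ℕ) (x : ℝ) : ℝ := ∑' j : ℕ, 1 / (x + j) ^ p

theorem summable_recipPow {p : ℕ} (hp : 2 ≤ p) {x : ℝ} (hx : 0 < x) :
    Summable fun j : ℕ => 1 / (x + j) ^ p := by
  have h := (Real.summable_one_div_nat_add_rpow x p).2 (by exact_mod_cast hp)
  refine h.congr fun j => ?_
  rw [abs_of_pos (by positivity), Real.rpow_natCast, add_comm]

/-- A lower telescoping bound for the sum of a series. -/
theorem le_tsum_of_telescope {u g : ℕ → ℝ} (hg : Summable g) (hu : Tendsto u atTop (𝓝 0))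
    (h : ∀ j, u j - u (j + 1) ≤ g j) : u 0 ≤ ∑' j, g j := by
  refine le_of_tendsto_of_tendsto (by simpa using hu.const_sub (u 0)) hg.hasSum.tendsto_sum_nat
    (Eventually.of_forall fun n => ?_)
  rw [← Finset.sum_range_sub']
  exact Finset.sum_le_sum fun j _ => h j

theorem tsum_le_of_telescope {u g : ℕ → ℝ} (hg : Summable g) (hu : Tendsto u atTop (𝓝 0))
    (h : ∀ j, g (j + 1) ≤ u j - u (j + 1)) : ∑' j, g j ≤ u 0 + g 0 := by
  rw [hg.tsum_eq_zero_add, add_comm]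
  gcongr
  refine le_of_tendsto_of_tendsto ((summable_nat_add_iff 1).2 hg).hasSum.tendsto_sum_nat
    (by simpa using hu.const_sub (u 0)) (Eventually.of_forall fun n => ?_)
  rw [← Finset.sum_range_sub']
  exact Finset.sum_le_sum fun j _ => h j

theorem tendsto_inv_add_nat (x : ℝ) : Tendsto (fun j : ℕ => (x + j)⁻¹) atTop (𝓝 0) :=
  (tendsto_atTop_add_const_left _ x tendsto_natCast_atTop_atTop).inv_tendsto_atTop

theorem recipPowSum_two_bounds {x : ℝ} (hx : 0 < x) :
    1 / x ≤ recipPowSum 2 x ∧ recipPowSum 2 x ≤ 1 / x + 1 / x ^ 2 := by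
  have hs := summable_recipPow le_rfl hx
  have hu := tendsto_inv_add_nat x
  constructor
  · refine le_of_eq_of_le (by simp) (le_tsum_of_telescope hs hu fun j => ?_)
    have : 0 < x + j := by positivity
    push_cast
    rw [← add_assoc, inv_sub_inv (by positivity) (by positivity), div_le_div_iff₀ (by positivity)
      (by positivity)]
    nlinarith
  · refine (tsum_le_of_telescope hs hu fun j => ?_).trans_eq (by simp)
    have : 0 < x + j := by positivity
    push_cast
    rw [← add_assoc, inv_sub_inv (by positivity) (by positivity), div_le_div_iff₀ (by positivity)
      (by positivity)]
    nlinarith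

theorem recipPowSum_three_bounds {x : ℝ} (hx : 0 < x) :
    1 / (2 * x ^ 2) ≤ recipPowSum 3 x ∧ recipPowSum 3 x ≤ 1 / (2 * x ^ 2) + 1 / x ^ 3 := by
  have hs := summable_recipPow (p := 3) (by norm_num) hx
  have hu : Tendsto (fun j : ℕ => 1 / (2 * (x + j) ^ 2)) atTop (𝓝 0) := by
    have := ((tendsto_inv_add_nat x).pow 2).const_mul (1 / 2)
    simp only [ne_eq, OfNat.ofNat_ne_zero, not_false_eq_true, zero_pow, mul_zero] at this
    refine this.congr fun j => ?_
    rw [inv_pow]; field_simp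
  constructor
  · refine le_of_eq_of_le (by simp) (le_tsum_of_telescope hs hu fun j => ?_)
    have h : 0 < x + j := by positivity
    push_cast
    rw [← add_assoc, div_sub_div _ _ (by positivity) (by positivity), div_le_div_iff₀
      (by positivity) (by positivity)]
    generalize x + (j : ℝ) = y at h
    nlinarith [pow_pos h 2, pow_pos h 3, pow_pos h 4]
  · refine (tsum_le_of_telescope hs hu fun j => ?_).trans_eq (by simp)
    have h : 0 < x + j := by positivity
    push_cast
    rw [← add_assoc, div_sub_div _ _ (by positivity) (by positivity), div_le_div_iff₀
      (by positivity) (by positivity)]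
    generalize x + (j : ℝ) = y at h
    nlinarith [pow_pos h 2, pow_pos h 3, pow_pos h 4]

theorem recipPowSum_four_le {x : ℝ} (hx : 0 < x) :
    recipPowSum 4 x ≤ 1 / x * recipPowSum 3 x := by
  unfold recipPowSum
  rw [← tsum_mul_left]
  refine Summable.tsum_le_tsum (fun j => ?_) (summable_recipPow (by norm_num) hx)
    ((summable_recipPow (by norm_num) hx).mul_left _)
  rw [pow_succ' _ 3, ← one_div_mul_one_div]
  gcongr
  simp

theorem hasDerivAt_digamma {x : ℝ} (hx : 0 < x) : HasDerivAt digamma (recipPowSum 2 x) x := by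
  have hser : ∀ y : ℝ, 0 < y →
      HasSum (fun j : ℕ => 1 / (1 + (j : ℝ)) - 1 / (y + j)) (digamma y - digamma 1) := by
    intro y hy
    have hsum : Summable fun j : ℕ => 1 / (1 + (j : ℝ)) - 1 / (y + j) := by
      have h1 := summable_recipPow le_rfl (lt_min one_pos hy)
      refine Summable.of_norm_bounded (h1.mul_left |y - 1|) fun j => ?_
      have hm : 0 < min 1 y + j := add_pos_of_pos_of_nonneg (lt_min one_pos hy) (Nat.cast_nonneg j)
      rw [div_sub_div _ _ (by positivity) (by positivity), norm_div, Real.norm_eq_abs,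
        Real.norm_eq_abs, abs_of_pos (show 0 < (1 + (j : ℝ)) * (y + j) by positivity),
        mul_one_div]
      rw [show 1 * (y + (j : ℝ)) - (1 + j) * 1 = y - 1 by ring, sq]
      gcongr
      · exact min_le_left _ _
      · exact min_le_right _ _
    have h1 := (tendsto_log_sub_sum hy).sub (tendsto_log_sub_sum one_pos)
    have h2 := (hsum.hasSum.tendsto_sum_nat).comp (tendsto_add_atTop_nat 1)
    have : ∑' j : ℕ, (1 / (1 + (j : ℝ)) - 1 / (y + j)) = digamma y - digamma 1 := by
      refine tendsto_nhds_unique h2 (h1.congr fun n => ?_)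
      simp only [Function.comp, Finset.sum_sub_distrib]
      ring
    rw [← this]
    exact hsum.hasSum
  have hx2 : 0 < x / 2 := by linarith
  have hder := hasDerivAt_tsum_of_isPreconnected (𝕜 := ℝ) (t := Ioi (x / 2)) (y₀ := x) (y := x)
    (g := fun (j : ℕ) (y : ℝ) => 1 / (1 + (j : ℝ)) - 1 / (y + j))
    (g' := fun (j : ℕ) (y : ℝ) => 1 / (y + j) ^ 2)
    (summable_recipPow le_rfl hx2) isOpen_Ioi isPreconnected_Ioi
    (fun j y hy => by
      have hy0 : 0 < y := hx2.trans hy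
      have h := ((hasDerivAt_id y).add_const (j : ℝ)).inv (by positivity : id y + (j : ℝ) ≠ 0)
      have h' := h.const_sub (1 / (1 + (j : ℝ)))
      simpa [one_div, neg_div] using h')
    (fun j y hy => by
      have hy' : x / 2 < y := hy
      have hy0 : 0 < y := hx2.trans hy
      rw [Real.norm_of_nonneg (by positivity)]
      gcongr)
    (show x / 2 < x by linarith) (hser x hx).summable (show x / 2 < x by linarith)
  refine (hder.add_const (digamma 1)).congr_of_eventuallyEq ?_
  filter_upwards [Ioi_mem_nhds hx] with y hy
  simp only [(hser y hy).tsum_eq]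
  ring

theorem strictAntiOn_recipPowSum : StrictAntiOn (recipPowSum 2) (Ioi 0) := by
  intro x hx y hy hxy
  have hx : 0 < x := hx
  have hy : 0 < y := hy
  refine Summable.tsum_lt_tsum (i := 0) (fun j => ?_) ?_ (summable_recipPow le_rfl hy)
    (summable_recipPow le_rfl hx)
  · gcongr
  · simp only [Nat.cast_zero, add_zero]
    gcongr

theorem continuousOn_recipPowSum {δ : ℝ} (hδ : 0 < δ) : ContinuousOn (recipPowSum 2) (Ici δ) := by
  refine continuousOn_tsum (fun j x hx => ?_) (summable_recipPow le_rfl hδ) fun j x hx => ?_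
  · have hx : δ ≤ x := hx
    have hx0 : 0 < x := hδ.trans_le hx
    have : (x + j) ^ 2 ≠ 0 := by positivity
    exact (ContinuousAt.div (f := fun _ : ℝ => (1 : ℝ)) (g := fun x : ℝ => (x + j) ^ 2)
      continuousAt_const (by fun_prop) this).continuousWithinAt
  · have hx : δ ≤ x := hx
    rw [Real.norm_of_nonneg (by positivity)]
    gcongr

theorem existsUnique_deriv_digamma_eq {γ : ℝ} (hγ : 0 < γ) :
    ∃! t : ℝ, 0 < t ∧ deriv digamma t = γ := by
  have hγ' : 0 < 1 / γ := by positivity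
  have hle : 1 / γ ≤ 1 + 2 / γ := by
    have : 1 / γ ≤ 2 / γ := by gcongr; norm_num
    linarith
  have h1 : γ ≤ recipPowSum 2 (1 / γ) := by simpa using (recipPowSum_two_bounds hγ').1
  have h2 : recipPowSum 2 (1 + 2 / γ) ≤ γ := by
    refine (recipPowSum_two_bounds (by positivity)).2.trans ?_
    have h3 : 1 / (1 + 2 / γ) = γ / (γ + 2) := by field_simp
    have h4 : γ / (γ + 2) ≤ γ / 2 := by gcongr; linarith
    have h5 : γ / (γ + 2) ≤ 1 := by rw [div_le_one (by positivity)]; linarith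
    have h6 : 0 ≤ γ / (γ + 2) := by positivity
    rw [← one_div_pow, h3]
    nlinarith
  obtain ⟨t, ht, hteq⟩ := intermediate_value_Icc' hle
    ((continuousOn_recipPowSum hγ').mono Icc_subset_Ici_self) ⟨h2, h1⟩
  have ht0 : 0 < t := hγ'.trans_le ht.1
  refine ⟨t, ⟨ht0, by rw [(hasDerivAt_digamma ht0).deriv, hteq]⟩, fun y hy => ?_⟩
  have := hy.2
  rw [(hasDerivAt_digamma hy.1).deriv, ← hteq] at this
  exact strictAntiOn_recipPowSum.injOn hy.1 ht0 this

/-! ### The Weierstrass product at a double critical point -/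

/-- The Weierstrass elementary factor of genus two. -/
def elemFactor (z : ℂ) : ℂ := (1 + z) * Complex.exp (-z + z ^ 2 / 2)

theorem norm_elemFactor_sq (z : ℂ) :
    ‖elemFactor z‖ ^ 2 =
      ((1 + z.re) ^ 2 + z.im ^ 2) * Real.exp (-2 * z.re + z.re ^ 2 - z.im ^ 2) := by
  rw [elemFactor, norm_mul, mul_pow, Complex.norm_exp, ← Real.exp_nat_mul,
    ← Complex.normSq_eq_norm_sq, Complex.normSq_apply]
  congr 1
  · simp; ring
  · congr 1
    simp [sq]
    ring

/-- Along a vertical line to the right of the origin the factor is dominated by a Gaussian. -/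
theorem norm_elemFactor_vertical_le {a : ℝ} (ha : 0 < a) (ha1 : a ≤ 1) (v : ℝ) :
    ‖elemFactor (a + v * Complex.I)‖ ≤ ‖elemFactor a‖ * Real.exp (-(a * v ^ 2 / 4)) := by
  refine abs_le_of_sq_le_sq' ?_ (by positivity) |>.2
  rw [mul_pow, norm_elemFactor_sq, norm_elemFactor_sq, ← Real.exp_nat_mul]
  simp only [Complex.add_re, Complex.ofReal_re, Complex.mul_re, Complex.I_re, mul_zero,
    Complex.ofReal_im, Complex.I_im, mul_one, sub_self, add_zero, Complex.add_im, Complex.mul_im,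
    zero_add, ne_eq, OfNat.ofNat_ne_zero, not_false_eq_true, zero_pow, sub_zero, Nat.cast_ofNat]
  have h1 : (1 + a) ^ 2 + v ^ 2 ≤ (1 + a) ^ 2 * Real.exp (v ^ 2 / (1 + a) ^ 2) := by
    have := Real.add_one_le_exp (v ^ 2 / (1 + a) ^ 2)
    calc (1 + a) ^ 2 + v ^ 2 = (1 + a) ^ 2 * (v ^ 2 / (1 + a) ^ 2 + 1) := by field_simp; ring
      _ ≤ _ := by gcongr
  calc _ ≤ (1 + a) ^ 2 * Real.exp (v ^ 2 / (1 + a) ^ 2) * Real.exp (-2 * a + a ^ 2 - v ^ 2) := by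
        gcongr
    _ = (1 + a) ^ 2 * Real.exp (v ^ 2 / (1 + a) ^ 2 + (-2 * a + a ^ 2 - v ^ 2)) := by
        rw [mul_assoc, ← Real.exp_add]
    _ ≤ (1 + a) ^ 2 * Real.exp (-2 * a + a ^ 2 + 2 * -(a * v ^ 2 / 4)) := by
        refine mul_le_mul_of_nonneg_left (Real.exp_le_exp.2 ?_) (by positivity)
        have h2 : v ^ 2 / (1 + a) ^ 2 ≤ v ^ 2 * (1 - a / 2) := by
          rw [div_le_iff₀ (by positivity)]
          have : 0 ≤ v ^ 2 * (a * (3 / 2 - a ^ 2 / 2)) := by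
            have : a ^ 2 ≤ 1 := by nlinarith
            have : 0 ≤ 3 / 2 - a ^ 2 / 2 := by linarith
            positivity
          nlinarith
        linarith
    _ = _ := by rw [Real.exp_add, mul_assoc]

/-- Along the rays of slope `∓ 3/4` to the left the factor grows; the growth is cubic near the
origin and quadratic far out. -/
theorem exp_le_norm_elemFactor {ρ : ℝ} (hρ : 0 ≤ ρ) {σ : ℝ} (hσ : |σ| = 1) :
    Real.exp (ρ ^ 3 / (1 + ρ) / 2) ≤ ‖elemFactor (ρ * (-4 + 3 * σ * Complex.I))‖ := by
  have hσ2 : σ ^ 2 = 1 := by rw [← sq_abs, hσ, one_pow]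
  have hQ : ∀ x : ℝ, 0 < 1 - 8 * x + 25 * x ^ 2 := by intro x; nlinarith [sq_nonneg (5 * x - 4 / 5)]
  -- the logarithm of the squared modulus exceeds `ρ³ / (1 + ρ)`: compare derivatives
  have hmono : MonotoneOn (fun x : ℝ => Real.log (1 - 8 * x + 25 * x ^ 2) + (8 * x + 7 * x ^ 2) -
      x ^ 3 / (1 + x)) (Ici 0) := by
    have hder : ∀ x : ℝ, 0 ≤ x → HasDerivAt (fun x : ℝ => Real.log (1 - 8 * x + 25 * x ^ 2) +
        (8 * x + 7 * x ^ 2) - x ^ 3 / (1 + x))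
        ((-8 + 50 * x) / (1 - 8 * x + 25 * x ^ 2) + (8 + 14 * x) -
          (3 * x ^ 2 * (1 + x) - x ^ 3 * 1) / (1 + x) ^ 2) x := by
      intro x hx
      have d1 : HasDerivAt (fun x : ℝ => 1 - 8 * x + 25 * x ^ 2) (-8 + 50 * x) x := by
        have := (((hasDerivAt_id x).const_mul 8).const_sub 1).add
          (((hasDerivAt_id x).pow 2).const_mul 25)
        refine this.congr_deriv ?_
        simp; ring
      have d2 : HasDerivAt (fun x : ℝ => 8 * x + 7 * x ^ 2) (8 + 14 * x) x := by
        have := ((hasDerivAt_id x).const_mul 8).add (((hasDerivAt_id x).pow 2).const_mul 7)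
        refine this.congr_deriv ?_
        simp; ring
      have d3 : HasDerivAt (fun x : ℝ => x ^ 3 / (1 + x))
          ((3 * x ^ 2 * (1 + x) - x ^ 3 * 1) / (1 + x) ^ 2) x := by
        have := (hasDerivAt_pow 3 x).div ((hasDerivAt_id x).const_add 1) (by simp; linarith)
        refine HasDerivAt.congr_deriv (f := fun x : ℝ => x ^ 3 / (1 + x)) this ?_
        simp
      exact ((d1.log (hQ x).ne').add d2).sub d3
    refine monotoneOn_of_deriv_nonneg (convex_Ici 0)
      (fun x hx => (hder x hx).continuousAt.continuousWithinAt)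
      (fun x hx => ?_) fun x hx => ?_
    · rw [interior_Ici] at hx
      exact (hder x (le_of_lt hx)).differentiableAt.differentiableWithinAt
    · rw [interior_Ici] at hx
      have hx : 0 < x := hx
      rw [(hder x hx.le).deriv]
      have e : (-8 + 50 * x) / (1 - 8 * x + 25 * x ^ 2) + (8 + 14 * x) =
          x ^ 2 * (88 + 350 * x) / (1 - 8 * x + 25 * x ^ 2) := by
        have := (hQ x).ne'
        rw [eq_div_iff this, add_mul, div_mul_cancel₀ _ this]
        ring
      rw [e, sub_nonneg, div_le_div_iff₀ (by positivity) (hQ x)]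
      have h3 : 0 ≤ x ^ 2 * (85 + 548 * x + 729 * x ^ 2 + 300 * x ^ 3) := by positivity
      nlinarith
  have h0 := hmono (show (0 : ℝ) ∈ Ici 0 by simp) (show ρ ∈ Ici 0 from hρ) hρ
  simp only [mul_zero, ne_eq, OfNat.ofNat_ne_zero, not_false_eq_true, zero_pow, add_zero, sub_zero,
    Real.log_one, zero_div] at h0
  refine abs_le_of_sq_le_sq' ?_ (norm_nonneg _) |>.2
  rw [norm_elemFactor_sq, ← Real.exp_nat_mul]
  have hre : ((ρ : ℂ) * (-4 + 3 * σ * Complex.I)).re = -4 * ρ := by simp; ring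
  have him : ((ρ : ℂ) * (-4 + 3 * σ * Complex.I)).im = 3 * σ * ρ := by simp; ring
  rw [hre, him]
  have e1 : (1 + -4 * ρ) ^ 2 + (3 * σ * ρ) ^ 2 = 1 - 8 * ρ + 25 * ρ ^ 2 := by
    linear_combination 9 * ρ ^ 2 * hσ2
  have e2 : -2 * (-4 * ρ) + (-4 * ρ) ^ 2 - (3 * σ * ρ) ^ 2 = 8 * ρ + 7 * ρ ^ 2 := by
    linear_combination -9 * ρ ^ 2 * hσ2
  rw [e1, e2, ← Real.exp_log (hQ ρ), ← Real.exp_add, Real.exp_le_exp]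
  push_cast
  linarith

/-- The elementary factor of genus two has no linear and no quadratic term in its exponent. -/
theorem exists_elemFactor_eq_exp {z : ℂ} (hz : ‖z‖ ≤ 1 / 2) :
    ∃ e : ℂ, ‖e‖ ≤ ‖z‖ ^ 4 ∧ elemFactor z = Complex.exp (z ^ 3 / 3 + e) := by
  have hz1 : ‖z‖ < 1 := by linarith
  refine ⟨Complex.log (1 + z) - Complex.logTaylor 4 z, ?_, ?_⟩
  · refine (Complex.norm_log_sub_logTaylor_le 3 hz1).trans ?_
    have h1 : (1 - ‖z‖)⁻¹ ≤ 2 := by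
      rw [inv_le_comm₀ (by linarith) (by norm_num)]; linarith
    have h2 : 0 ≤ (1 - ‖z‖)⁻¹ := inv_nonneg.2 (by linarith)
    have h3 := mul_le_mul_of_nonneg_left h1 (show 0 ≤ ‖z‖ ^ 4 by positivity)
    have h4 : 0 ≤ ‖z‖ ^ 4 := by positivity
    norm_num
    linarith
  · have hne : 1 + z ≠ 0 := by
      intro h
      have : z = -1 := by linear_combination h
      rw [this] at hz1
      simp at hz1
    have ht : Complex.logTaylor 4 z = z - z ^ 2 / 2 + z ^ 3 / 3 := by
      simp [Complex.logTaylor_succ, Complex.logTaylor_zero]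
      ring
    rw [ht, elemFactor, show z ^ 3 / 3 + (Complex.log (1 + z) - (z - z ^ 2 / 2 + z ^ 3 / 3)) =
      Complex.log (1 + z) + (-z + z ^ 2 / 2) by ring, Complex.exp_add (Complex.log _),
      Complex.exp_log hne]

/-- With `f(s) = ψ'(t₀) s² / 2 - (ψ'(t₀) t₀ - ψ(t₀)) s - log Γ(s)`, which has a double critical point
at `t₀`, this is `exp (f(t₀ + w) - f(t₀))`; here `ψ'(t₀)` is written as a series. -/
def saddleRatio (t₀ : ℝ) (w : ℂ) : ℂ :=
  Complex.Gamma t₀ / Complex.Gamma (t₀ + w) *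
    Complex.exp (digamma t₀ * w + recipPowSum 2 t₀ * w ^ 2 / 2)

section Saddle

variable {t₀ : ℝ}

/-- The Weierstrass product of `saddleRatio`, with zeros at `-(t₀ + j)`. Since the linear and the
quadratic term of the exponent cancel at a double critical point, its factors are exactly
elementary factors. -/
theorem tendsto_prod_elemFactor (ht : 0 < t₀) {w : ℂ} (hw : Complex.Gamma (t₀ + w) ≠ 0) :
    Tendsto (fun n : ℕ => ∏ j ∈ Finset.range (n + 1), elemFactor (w / (t₀ + j))) atTop
      (𝓝 (saddleRatio t₀ w)) := by
  have h1 := (Complex.GammaSeq_tendsto_Gamma t₀).div (Complex.GammaSeq_tendsto_Gamma (t₀ + w)) hw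
  have h2 := (Complex.continuous_ofReal.tendsto _).comp (tendsto_log_sub_sum ht)
  have h3 := (Complex.continuous_ofReal.tendsto _).comp
    (((summable_recipPow le_rfl ht).hasSum.tendsto_sum_nat).comp (tendsto_add_atTop_nat 1))
  have h4 := ((h2.mul_const w).add ((h3.mul_const (w ^ 2)).div_const 2)).cexp
  refine (h1.mul h4).congr' ?_
  filter_upwards [eventually_gt_atTop 0] with n hn
  have hnC : (n : ℂ) ≠ 0 := by exact_mod_cast hn.ne'
  have hnR : (0 : ℝ) < n := by exact_mod_cast hn
  have hj : ∀ j : ℕ, (t₀ : ℂ) + j ≠ 0 := by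
    intro j h0
    have : t₀ + j ≠ 0 := by positivity
    exact this (by exact_mod_cast h0)
  have hfac : (n.factorial : ℂ) ≠ 0 := by exact_mod_cast n.factorial_ne_zero
  simp only [Pi.div_apply, Complex.GammaSeq, Function.comp, elemFactor, Finset.prod_mul_distrib,
    ← Complex.exp_sum]
  have hprod : ∏ j ∈ Finset.range (n + 1), (1 + w / (t₀ + j)) =
      (∏ j ∈ Finset.range (n + 1), ((t₀ : ℂ) + w + j)) /
        ∏ j ∈ Finset.range (n + 1), ((t₀ : ℂ) + j) := by
    rw [← Finset.prod_div_distrib]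
    refine Finset.prod_congr rfl fun j _ => ?_
    have := hj j
    field_simp
    ring
  have hP : ∏ j ∈ Finset.range (n + 1), ((t₀ : ℂ) + j) ≠ 0 :=
    Finset.prod_ne_zero_iff.2 fun j _ => hj j
  have hpow : (n : ℂ) ^ ((t₀ : ℂ) + w) = (n : ℂ) ^ (t₀ : ℂ) * Complex.exp (Complex.log n * w) := by
    rw [Complex.cpow_add _ _ hnC, Complex.cpow_def_of_ne_zero hnC w]
  have hexp : ∑ j ∈ Finset.range (n + 1), (-(w / (t₀ + j)) + (w / (t₀ + j)) ^ 2 / 2) =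
      -(Complex.log n * w) + (((Real.log n - ∑ j ∈ Finset.range (n + 1), 1 / (t₀ + j) : ℝ) : ℂ) * w +
        ((∑ j ∈ Finset.range (n + 1), 1 / (t₀ + j) ^ 2 : ℝ) : ℂ) * w ^ 2 / 2) := by
    push_cast
    rw [Finset.sum_add_distrib, sub_mul, Finset.sum_mul, Finset.sum_mul,
      Finset.sum_div, Finset.sum_neg_distrib]
    have e1 : ∀ j : ℕ, 1 / ((t₀ : ℂ) + j) * w = w / (t₀ + j) := fun j => by ring
    have e2 : ∀ j : ℕ, 1 / ((t₀ : ℂ) + j) ^ 2 * w ^ 2 / 2 = (w / (t₀ + j)) ^ 2 / 2 :=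
      fun j => by rw [div_pow]; ring
    simp only [e1, e2]
    ring
  rw [hprod, hexp, hpow, Complex.exp_add (-(Complex.log n * w)), Complex.exp_neg]
  have hpn : (n : ℂ) ^ (t₀ : ℂ) ≠ 0 := by
    rw [Complex.cpow_def_of_ne_zero hnC]; exact Complex.exp_ne_zero _
  have he := Complex.exp_ne_zero (Complex.log n * w)
  generalize Complex.exp _ = X at *
  field_simp

/-- The Taylor expansion at the critical point, with an error that is uniform in `t₀`. -/
theorem exists_saddleRatio_eq_exp (ht : 0 < t₀) {w : ℂ} (hw : ‖w‖ ≤ t₀ / 2) :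
    ∃ e : ℂ, ‖e‖ ≤ ‖w‖ ^ 4 * recipPowSum 4 t₀ ∧
      saddleRatio t₀ w = Complex.exp (w ^ 3 / 3 * recipPowSum 3 t₀ + e) := by
  have hΓ : Complex.Gamma (t₀ + w) ≠ 0 := by
    refine Complex.Gamma_ne_zero_of_re_pos ?_
    have := (abs_le.1 ((Complex.abs_re_le_norm w).trans hw)).1
    simp
    linarith
  have hnorm : ∀ j : ℕ, ‖(t₀ : ℂ) + j‖ = t₀ + j := by
    intro j
    rw [show (t₀ : ℂ) + j = ((t₀ + j : ℝ) : ℂ) by push_cast; rfl, Complex.norm_real,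
      Real.norm_of_nonneg (by positivity)]
  have hz : ∀ j : ℕ, ‖w / (t₀ + j)‖ ≤ 1 / 2 := by
    intro j
    rw [norm_div, hnorm, div_le_iff₀ (by positivity)]
    have : (0 : ℝ) ≤ j := Nat.cast_nonneg j
    linarith
  choose e he heq using fun j => exists_elemFactor_eq_exp (hz j)
  have hb : ∀ j, ‖e j‖ ≤ ‖w‖ ^ 4 * (1 / (t₀ + j) ^ 4) := by
    intro j
    refine (he j).trans_eq ?_
    rw [norm_div, hnorm, div_pow]
    ring
  have hs4 := (summable_recipPow (p := 4) (by norm_num) ht).mul_left (‖w‖ ^ 4)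
  have hse : Summable e := Summable.of_norm_bounded hs4 hb
  have hs3 : HasSum (fun j : ℕ => w ^ 3 / 3 * ((1 / (t₀ + j) ^ 3 : ℝ) : ℂ))
      (w ^ 3 / 3 * recipPowSum 3 t₀) :=
    (Complex.hasSum_ofReal.2 (summable_recipPow (p := 3) (by norm_num) ht).hasSum).mul_left _
  refine ⟨∑' j, e j, ?_, ?_⟩
  · refine (tsum_of_norm_bounded hs4.hasSum hb).trans_eq ?_
    rw [tsum_mul_left]
    rfl
  · refine tendsto_nhds_unique (tendsto_prod_elemFactor ht hΓ) ?_
    have := (((hs3.add hse.hasSum).tendsto_sum_nat).comp (tendsto_add_atTop_nat 1)).cexp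
    refine this.congr fun n => ?_
    rw [Function.comp, Complex.exp_sum]
    refine Finset.prod_congr rfl fun j _ => ?_
    rw [heq j]
    congr 1
    push_cast
    rw [div_pow]
    ring

/-- The factorwise Gaussian bounds add up to a Gaussian bound on vertical lines. -/
theorem norm_saddleRatio_vertical_le (ht : 0 < t₀) {a : ℝ} (ha : 0 < a) (hat : a ≤ t₀) (v : ℝ) :
    ‖saddleRatio t₀ (a + v * Complex.I)‖ ≤
      ‖saddleRatio t₀ a‖ * Real.exp (-(a * v ^ 2 / 4 * recipPowSum 3 t₀)) := by
  have hΓ : ∀ v : ℝ, Complex.Gamma (t₀ + (a + v * Complex.I)) ≠ 0 := by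
    intro v
    refine Complex.Gamma_ne_zero_of_re_pos ?_
    simp
    positivity
  have h1 := (tendsto_prod_elemFactor ht (hΓ v)).norm
  have h2 := (tendsto_prod_elemFactor ht (by simpa using hΓ 0)).norm
  have h3 := (((summable_recipPow (p := 3) (by norm_num) ht).hasSum.tendsto_sum_nat).comp
    (tendsto_add_atTop_nat 1)).const_mul (a * v ^ 2 / 4)
  have h4 := (Real.continuous_exp.tendsto _).comp h3.neg
  refine le_of_tendsto_of_tendsto' h1 (h2.mul h4) fun n => ?_
  simp only [norm_prod, Function.comp]
  rw [Finset.mul_sum, ← Finset.sum_neg_distrib, Real.exp_sum, ← Finset.prod_mul_distrib]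
  refine Finset.prod_le_prod (fun _ _ => norm_nonneg _) fun j _ => ?_
  have hj : 0 < t₀ + j := by positivity
  have hj0 : (0 : ℝ) ≤ j := Nat.cast_nonneg j
  have := norm_elemFactor_vertical_le (a := a / (t₀ + j)) (by positivity)
    (by rw [div_le_one hj]; linarith) (v / (t₀ + j))
  have e1 : ((a / (t₀ + j) : ℝ) : ℂ) + ((v / (t₀ + j) : ℝ) : ℂ) * Complex.I =
      (a + v * Complex.I) / (t₀ + j) := by push_cast; ring
  have e2 : ((a / (t₀ + j) : ℝ) : ℂ) = a / (t₀ + j) := by push_cast; rfl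
  have e3 : a / (t₀ + j) * (v / (t₀ + j)) ^ 2 / 4 = a * v ^ 2 / 4 * (1 / (t₀ + j) ^ 3) := by
    field_simp
  rwa [e1, e2, e3] at this

/-- The factorwise growth adds up; the factor `j = 0` has the weakest exponent. -/
theorem exp_le_norm_saddleRatio (ht : 0 < t₀) {ρ : ℝ} (hρ : 0 ≤ ρ) {σ : ℝ} (hσ : |σ| = 1) :
    Real.exp (ρ ^ 3 / (1 + ρ / t₀) / 2 * recipPowSum 3 t₀) ≤
      ‖saddleRatio t₀ (ρ * (-4 + 3 * σ * Complex.I))‖ := by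
  have hΓ : Complex.Gamma (t₀ + ρ * (-4 + 3 * σ * Complex.I)) ≠ 0 := by
    refine Complex.Gamma_ne_zero fun m h0 => ?_
    have him := congrArg Complex.im h0
    have hσ0 : σ ≠ 0 := by rintro rfl; simp at hσ
    simp [hσ0] at him
    rw [him] at h0
    have hre := congrArg Complex.re h0
    simp at hre
    have : (0 : ℝ) ≤ m := Nat.cast_nonneg m
    linarith
  have h1 := (tendsto_prod_elemFactor ht hΓ).norm
  have h3 := (((summable_recipPow (p := 3) (by norm_num) ht).hasSum.tendsto_sum_nat).comp
    (tendsto_add_atTop_nat 1)).const_mul (ρ ^ 3 / (1 + ρ / t₀) / 2)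
  have h4 := (Real.continuous_exp.tendsto _).comp h3
  refine le_of_tendsto_of_tendsto' h4 h1 fun n => ?_
  simp only [norm_prod, Function.comp]
  rw [Finset.mul_sum, Real.exp_sum]
  refine Finset.prod_le_prod (fun _ _ => (Real.exp_pos _).le) fun j _ => ?_
  have hj : 0 < t₀ + j := by positivity
  have hj0 : (0 : ℝ) ≤ j := Nat.cast_nonneg j
  have := exp_le_norm_elemFactor (ρ := ρ / (t₀ + j)) (by positivity) hσ
  refine le_trans (Real.exp_le_exp.2 ?_) (this.trans_eq ?_)
  · calc ρ ^ 3 / (1 + ρ / t₀) / 2 * (1 / (t₀ + j) ^ 3)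
        = (ρ / (t₀ + j)) ^ 3 / (1 + ρ / t₀) / 2 := by field_simp
      _ ≤ _ := by
        gcongr
        linarith
  · congr 2
    push_cast
    ring

end Saddle

/-! ### Moving contours of entire functions -/

theorem exists_primitive_entire {f : ℂ → ℂ} (hf : Differentiable ℂ f) :
    ∃ P : ℂ → ℂ, ∀ z, HasDerivAt P (f z) z := by
  obtain ⟨P, hP⟩ := (convex_univ (𝕜 := ℝ) (E := ℂ)).exists_forall_hasDerivWithinAt
    hf.differentiableOn
  exact ⟨P, fun z => by simpa using hP z (mem_univ z)⟩

theorem integrable_of_norm_le_exp_neg_abs {g : ℝ → ℂ} (hg : Continuous g) {C : ℝ}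
    (h : ∀ v, ‖g v‖ ≤ C * Real.exp (-|v|)) : Integrable g := by
  refine (integrable_inv_one_add_sq.const_mul (2 * |C|)).mono' hg.aestronglyMeasurable
    (Eventually.of_forall fun v => (h v).trans ?_)
  have h1 : 1 + v ^ 2 ≤ 2 * Real.exp |v| := by
    have := Real.quadratic_le_exp_of_nonneg (abs_nonneg v)
    rw [sq_abs] at this
    linarith [abs_nonneg v]
  rw [Real.exp_neg, ← div_eq_mul_inv, ← div_eq_mul_inv, div_le_div_iff₀ (Real.exp_pos _)
    (by positivity)]
  calc C * (1 + v ^ 2) ≤ |C| * (2 * Real.exp |v|) := by gcongr; exact le_abs_self C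
    _ = _ := by ring

/-- Moving a vertical line of integration. -/
theorem verticalIntegral_eq_of_le {f : ℂ → ℂ} (hf : Differentiable ℂ f) {α β C : ℝ} (hαβ : α ≤ β)
    (h : ∀ z : ℂ, α ≤ z.re → z.re ≤ β → ‖f z‖ ≤ C * Real.exp (-|z.im|)) :
    verticalIntegral α f = verticalIntegral β f := by
  have hint : ∀ x : ℝ, α ≤ x → x ≤ β → Integrable fun v : ℝ => f (x + v * Complex.I) := by
    intro x h1 h2
    refine integrable_of_norm_le_exp_neg_abs (hf.continuous.comp (by fun_prop)) (C := C) fun v => ?_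
    simpa using h (x + v * Complex.I) (by simpa using h1) (by simpa using h2)
  have i₁ := hint α le_rfl hαβ
  have i₂ := hint β hαβ le_rfl
  rw [verticalIntegral_eq_wedgeIntegral i₁, verticalIntegral_eq_wedgeIntegral i₂]
  obtain ⟨P, hP⟩ := exists_primitive_entire hf
  have key : ∀ σ : ℝ, |σ| = 1 →
      P α + rayIntegral α (σ * Complex.I) f = P β + rayIntegral β (σ * Complex.I) f := by
    intro σ hσ
    have hray : ∀ x : ℝ, Integrable (fun v : ℝ => f (x + v * Complex.I)) →
        IntegrableOn (fun r : ℝ => f (x + r * (σ * Complex.I))) (Ioi 0) := by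
      intro x hx
      have hσ0 : σ ≠ 0 := by rintro rfl; simp at hσ
      have := (hx.comp_mul_left' hσ0).integrableOn (s := Ioi 0)
      refine this.congr_fun (fun r _ => ?_) measurableSet_Ioi
      push_cast
      ring_nf
    refine primitive_add_rayIntegral_eq (ρ := id) (b := fun R => |C| * Real.exp (0 - 1 * R))
      (fun r _ => hP _) (hray α i₁) (fun r _ => hP _) (hray β i₂) tendsto_id ?_ ?_
    · filter_upwards [eventually_ge_atTop 0] with R hR z hz
      refine ⟨hP z, ?_⟩
      obtain ⟨s, t, hs, ht, hst, rfl⟩ := hz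
      set z := s • ((α : ℂ) + R * (σ * Complex.I)) + t • ((β : ℂ) + (id R : ℝ) * (σ * Complex.I))
        with hz
      have hre : z.re = s * α + t * β := by rw [hz]; simp
      have him : z.im = R * σ := by
        rw [hz]; simp
        obtain rfl : s = 1 - t := by linarith
        ring
      have hS : s = 1 - t := by linarith
      have := h z (by rw [hre, hS]; nlinarith) (by rw [hre, hS]; nlinarith)
      rw [him, abs_mul, hσ, mul_one, abs_of_nonneg hR] at this
      refine this.trans ?_
      rw [show 0 - 1 * R = -R by ring]
      gcongr
      exact le_abs_self C
    · refine (tendsto_exp_sub_mul_affine |C| 0 0 ‖(β : ℂ) - α‖ (b := 1) one_pos).congr fun R => ?_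
      simp
  have h1 := key 1 (by simp)
  have h2 := key (-1) (by simp)
  simp only [Complex.ofReal_one, one_mul, Complex.ofReal_neg, neg_mul] at h1 h2
  unfold wedgeIntegral
  linear_combination h1 - h2

/-! ### Contours for the Airy function -/

/-- The integrand of the Airy function. -/
def airyIntegrand (u : ℝ) (s : ℂ) : ℂ := Complex.exp (s ^ 3 / 3 - u * s)

theorem differentiable_airyIntegrand (u : ℝ) : Differentiable ℂ (airyIntegrand u) := by
  unfold airyIntegrand
  fun_prop

theorem norm_airyIntegrand (u : ℝ) (s : ℂ) :
    ‖airyIntegrand u s‖ = Real.exp (s.re ^ 3 / 3 - s.re * s.im ^ 2 - u * s.re) := by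
  rw [airyIntegrand, Complex.norm_exp]
  congr 1
  have : (s ^ 3).re = s.re ^ 3 - 3 * s.re * s.im ^ 2 := by
    simp [pow_succ]; ring
  have h3 : (s ^ 3 / 3).re = (s ^ 3).re / 3 := by
    rw [show (3 : ℂ) = ((3 : ℝ) : ℂ) by norm_num, Complex.div_ofReal_re]
  simp [h3, this]
  ring

theorem exists_norm_airyIntegrand_le (u : ℝ) :
    ∃ V : ℝ, 1 ≤ V ∧ ∀ z : ℂ, V ≤ |z.im| → 1 ≤ z.re → z.re ≤ 1 + 4 / 3 * |z.im| →
      ‖airyIntegrand u z‖ ≤ Real.exp (-|z.im|) := by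
  refine ⟨6 + 3 * |u|, by linarith [abs_nonneg u], fun z hV h1 h2 => ?_⟩
  rw [norm_airyIntegrand, Real.exp_le_exp, ← sq_abs z.im]
  set v := |z.im|
  set x := z.re
  have hu := neg_abs_le u
  have hu0 := abs_nonneg u
  have hx2 : x ^ 2 ≤ (1 + 4 / 3 * v) ^ 2 := by gcongr
  have hin : x ^ 2 / 3 - v ^ 2 - u ≤ -v := by nlinarith
  calc x ^ 3 / 3 - x * v ^ 2 - u * x = x * (x ^ 2 / 3 - v ^ 2 - u) := by ring
    _ ≤ x * (-v) := by gcongr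
    _ ≤ -v := by nlinarith

/-- All rays that stay in the sector of `exists_norm_airyIntegrand_le` can be turned into the
vertical ray from `1`. -/
theorem airy_ray {u : ℝ} {P : ℂ → ℂ} (hP : ∀ z, HasDerivAt P (airyIntegrand u z) z) {a : ℝ} {d : ℂ}
    {b σ r₀ : ℝ} (hσ : |σ| = 1) (hb : 0 < b) (him : d.im = σ * b)
    (h₁ : ∀ r : ℝ, r₀ ≤ r → 1 ≤ a + r * d.re)
    (h₂ : ∀ r : ℝ, r₀ ≤ r → a + r * d.re ≤ 1 + 4 / 3 * (b * r)) :
    IntegrableOn (fun r : ℝ => airyIntegrand u (a + r * d)) (Ioi 0) ∧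
      P a + rayIntegral a d (airyIntegrand u) =
        P 1 + rayIntegral 1 (σ * Complex.I) (airyIntegrand u) := by
  obtain ⟨V, hV1, hV⟩ := exists_norm_airyIntegrand_le u
  have hcont := (differentiable_airyIntegrand u).continuous
  have hint : ∀ {a : ℝ} {d : ℂ} {b r₀ : ℝ}, 0 < b → d.im = σ * b →
      (∀ r : ℝ, r₀ ≤ r → 1 ≤ a + r * d.re) →
      (∀ r : ℝ, r₀ ≤ r → a + r * d.re ≤ 1 + 4 / 3 * (b * r)) →
      IntegrableOn (fun r : ℝ => airyIntegrand u (a + r * d)) (Ioi 0) := by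
    intro a d b r₀ hb him h₁ h₂
    refine integrableOn_ray (C := 1) (A := max r₀ (V / b)) hb
      (fun r _ => hcont.continuousAt) fun r hr => ?_
    have hr1 := (le_max_left _ _).trans hr
    have hr2 : V ≤ b * r := by
      have := (le_max_right _ _).trans hr
      rwa [div_le_iff₀' hb] at this
    have hi : |((a : ℂ) + r * d).im| = b * r := by
      have : 0 ≤ r * b := by linarith
      simp only [Complex.add_im, Complex.ofReal_im, Complex.mul_im, Complex.ofReal_re, zero_mul,
        zero_add, add_zero, him]
      rw [show r * (σ * b) = σ * (r * b) by ring, abs_mul, hσ, one_mul, abs_of_nonneg this,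
        mul_comm]
    have hre : ((a : ℂ) + r * d).re = a + r * d.re := by simp
    have := hV (a + r * d) (by rw [hi]; exact hr2) (by rw [hre]; exact h₁ r hr1)
      (by rw [hre, hi]; exact h₂ r hr1)
    rw [hi] at this
    rw [one_mul, neg_mul]
    exact this
  have i₁ := hint hb him h₁ h₂
  have i₂ : IntegrableOn (fun r : ℝ => airyIntegrand u (1 + r * (σ * Complex.I))) (Ioi 0) := by
    have := hint (a := 1) (d := σ * Complex.I) (b := 1) (r₀ := 0) one_pos (by simp) (by simp)
      (by simp)
    simpa using this
  refine ⟨i₁, ?_⟩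
  refine primitive_add_rayIntegral_eq (ρ := fun R => b * R)
    (b := fun R => 1 * Real.exp (0 - b * R)) (fun r _ => hP _) i₁ (fun r _ => hP _) i₂
    (tendsto_id.const_mul_atTop hb) ?_ ?_
  · filter_upwards [eventually_ge_atTop r₀, eventually_ge_atTop (V / b)] with R hR1 hR2 z hz
    refine ⟨hP z, ?_⟩
    rw [div_le_iff₀' hb] at hR2
    obtain ⟨s, t, hs, ht, hst, rfl⟩ := hz
    set z := s • ((a : ℂ) + R * d) + t • ((1 : ℂ) + (b * R : ℝ) * (σ * Complex.I)) with hz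
    have hre : z.re = s * (a + R * d.re) + t := by rw [hz]; simp; ring
    have hi : z.im = σ * (b * R) := by
      rw [hz]; simp
      obtain rfl : s = 1 - t := by linarith
      rw [him]
      ring
    have hi' : |z.im| = b * R := by
      rw [hi, abs_mul, hσ, one_mul, abs_of_nonneg (by linarith)]
    have hS : t = 1 - s := by linarith
    have hs1 : s ≤ 1 := by linarith
    have q1 := h₁ R hR1
    have q2 := h₂ R hR1
    have := hV z (by rw [hi']; exact hR2) (by rw [hre, hS]; nlinarith)
      (by rw [hre, hi', hS]; nlinarith)
    rw [hi'] at this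
    rwa [one_mul, zero_sub]
  · refine squeeze_zero_norm' ?_ (tendsto_exp_sub_mul_affine 1 0 (4 / 3 * b) 0 hb)
    filter_upwards [eventually_ge_atTop r₀] with R hR
    have e : (1 : ℂ) + (b * R : ℝ) * (σ * Complex.I) - (a + R * d) =
        ((1 - (a + R * d.re) : ℝ) : ℂ) := by
      apply Complex.ext
      · simp
      · simp [him]
        ring
    have hn : ‖((1 - (a + R * d.re) : ℝ) : ℂ)‖ = |1 - (a + R * d.re)| := Complex.norm_real _
    rw [e, hn, Real.norm_of_nonneg (by positivity)]
    gcongr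
    rw [abs_le]
    have q1 := h₁ R hR
    have q2 := h₂ R hR
    constructor <;> linarith

/-- Every upward wedge that ends up in the sectors of `exists_norm_airyIntegrand_le` gives the same
Airy integral. -/
theorem airy_wedge {u a : ℝ} {d₁ d₂ : ℂ} {b r₀ : ℝ} (hb : 0 < b) (him₁ : d₁.im = -b)
    (him₂ : d₂.im = b) (hre : d₁.re = d₂.re)
    (h₁ : ∀ r : ℝ, r₀ ≤ r → 1 ≤ a + r * d₂.re)
    (h₂ : ∀ r : ℝ, r₀ ≤ r → a + r * d₂.re ≤ 1 + 4 / 3 * (b * r)) :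
    IntegrableOn (fun r : ℝ => airyIntegrand u (a + r * d₁)) (Ioi 0) ∧
    IntegrableOn (fun r : ℝ => airyIntegrand u (a + r * d₂)) (Ioi 0) ∧
    wedgeIntegral a d₁ d₂ (airyIntegrand u) =
      wedgeIntegral 1 (-Complex.I) Complex.I (airyIntegrand u) := by
  obtain ⟨P, hP⟩ := exists_primitive_entire (differentiable_airyIntegrand u)
  obtain ⟨i₂, e₂⟩ := airy_ray hP (σ := 1) (by simp) hb (by rw [him₂, one_mul]) h₁ h₂
  obtain ⟨i₁, e₁⟩ := airy_ray hP (d := d₁) (σ := -1) (by simp) hb (by rw [him₁]; ring)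
    (by rwa [hre]) (by rwa [hre])
  refine ⟨i₁, i₂, ?_⟩
  simp only [Complex.ofReal_one, one_mul, Complex.ofReal_neg, neg_mul] at e₁ e₂
  unfold wedgeIntegral
  linear_combination e₂ - e₁

theorem wedgeIntegral_comp_neg (f : ℂ → ℂ) (a d₁ d₂ : ℂ) :
    wedgeIntegral (-a) d₁ d₂ (fun z => f (-z)) = wedgeIntegral a (-d₂) (-d₁) f := by
  have h : ∀ d : ℂ, rayIntegral (-a) d (fun z => f (-z)) = -rayIntegral a (-d) f := by
    intro d
    unfold rayIntegral
    rw [← integral_neg]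
    congr 1
    ext r
    simp only [show -(-a + r * d) = a + r * -d by ring]
    ring
  unfold wedgeIntegral
  rw [h, h]
  ring

/-! ### Separation of the double integrals -/

theorem measurable_hankelPath (c ε : ℝ) : Measurable (hankelPath c ε) := by
  have : Continuous (hankelPath c ε) := by
    unfold hankelPath
    fun_prop
  exact this.measurable

theorem re_hankelPath_le (c ε r : ℝ) : (hankelPath c ε r).re ≤ c := by
  simp [hankelPath]

theorem measurable_wedgePath (a d₁ d₂ : ℂ) : Measurable (wedgePath a d₁ d₂) :=
  Measurable.ite measurableSet_Iic (by fun_prop) (by fun_prop)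

theorem measurable_wedgeVel (d₁ d₂ : ℂ) : Measurable (wedgeVel d₁ d₂) :=
  Measurable.ite measurableSet_Iic measurable_const measurable_const

theorem le_re_wedgePath {a d₁ d₂ : ℂ} (h₁ : 0 ≤ d₁.re) (h₂ : 0 ≤ d₂.re) (r : ℝ) :
    a.re ≤ (wedgePath a d₁ d₂ r).re := by
  unfold wedgePath
  split_ifs with h
  · simp
    nlinarith
  · simp
    nlinarith

theorem re_wedgePath_le {a d₁ d₂ : ℂ} (h₁ : d₁.re ≤ 0) (h₂ : d₂.re ≤ 0) (r : ℝ) :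
    (wedgePath a d₁ d₂ r).re ≤ a.re := by
  unfold wedgePath
  split_ifs with h
  · simp
    nlinarith
  · simp
    nlinarith

theorem integrableOn_ray_mul {g q : ℂ → ℂ} {a d : ℂ} {c B : ℝ}
    (hg : IntegrableOn (fun r : ℝ => g (a + r * d)) (Ioi 0)) (ha : a.re ≤ c) (hd : d.re ≤ 0)
    (hq : ContinuousOn q {z | z.re ≤ c}) (hB : ∀ z : ℂ, z.re ≤ c → ‖q z‖ ≤ B) :
    IntegrableOn (fun r : ℝ => g (a + r * d) * q (a + r * d)) (Ioi 0) := by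
  have hmem : ∀ r ∈ Ioi (0 : ℝ), (a + r * d).re ≤ c := by
    intro r hr
    have hr : 0 < r := hr
    simp
    nlinarith
  refine Integrable.mul_bdd (c := B) hg ?_ ?_
  · exact (hq.comp (f := fun r : ℝ => a + (r : ℂ) * d) (by fun_prop) hmem).aestronglyMeasurable
      measurableSet_Ioi
  · filter_upwards [ae_restrict_mem measurableSet_Ioi] with r hr
    exact hB _ (hmem r hr)

theorem hankelIntegral_mul_eq {g q : ℂ → ℂ} {c ε B : ℝ} (hε : 0 < ε)
    (h₁ : IntegrableOn (fun r : ℝ => g (((c : ℂ) - ε * Complex.I) + r * (-1))) (Ioi 0))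
    (h₂ : IntegrableOn (fun r : ℝ => g (((c : ℂ) + ε * Complex.I) + r * (-1))) (Ioi 0))
    (h₃ : ContinuousOn (fun v : ℝ => g ((c : ℂ) + v * Complex.I)) (Icc (-ε) ε))
    (hq : ContinuousOn q {z | z.re ≤ c}) (hB : ∀ z : ℂ, z.re ≤ c → ‖q z‖ ≤ B) :
    hankelIntegral c ε (fun z => g z * q z) =
      ∫ r, g (hankelPath c ε r) * hankelVel ε r * q (hankelPath c ε r) := by
  refine (hankelIntegral_eq hε (integrableOn_ray_mul h₁ (by simp) (by simp) hq hB)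
    (integrableOn_ray_mul h₂ (by simp) (by simp) hq hB) (h₃.mul ?_)).2.trans ?_
  · exact hq.comp (f := fun v : ℝ => (c : ℂ) + (v : ℂ) * Complex.I) (by fun_prop)
      (fun v _ => by simp)
  · congr 1
    ext r
    ring

theorem wedgeIntegral_mul_eq {g q : ℂ → ℂ} {a d₁ d₂ : ℂ} {B : ℝ}
    (h₁ : IntegrableOn (fun r : ℝ => g (a + r * d₁)) (Ioi 0))
    (h₂ : IntegrableOn (fun r : ℝ => g (a + r * d₂)) (Ioi 0)) (hd₁ : d₁.re ≤ 0) (hd₂ : d₂.re ≤ 0)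
    (hq : ContinuousOn q {z | z.re ≤ a.re}) (hB : ∀ z : ℂ, z.re ≤ a.re → ‖q z‖ ≤ B) :
    wedgeIntegral a d₁ d₂ (fun z => g z * q z) =
      ∫ r, g (wedgePath a d₁ d₂ r) * wedgeVel d₁ d₂ r * q (wedgePath a d₁ d₂ r) := by
  refine (wedgeIntegral_eq (integrableOn_ray_mul h₁ le_rfl hd₁ hq hB)
    (integrableOn_ray_mul h₂ le_rfl hd₂ hq hB)).2.trans ?_
  congr 1
  ext r
  ring

theorem norm_one_div_sub_le {s z : ℂ} {σ τ : ℝ} (hs : σ ≤ s.re) (hz : z.re ≤ τ) (h : τ < σ) :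
    ‖1 / (s - z)‖ ≤ 1 / (σ - τ) := by
  rw [norm_div, norm_one]
  have : σ - τ ≤ ‖s - z‖ := by
    refine le_trans ?_ (Complex.re_le_norm _)
    simp
    linarith
  exact one_div_le_one_div_of_le (by linarith) this

theorem continuousOn_one_div_sub {s : ℂ} {σ τ : ℝ} (hs : σ ≤ s.re) (h : τ < σ) :
    ContinuousOn (fun z => 1 / (s - z)) {z : ℂ | z.re ≤ τ} := by
  refine continuousOn_const.div (by fun_prop) fun z hz h0 => ?_
  have hz : z.re ≤ τ := hz
  have := congrArg Complex.re h0
  simp at this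
  linarith

/-- The `s`-dependence of the integrand of `Kcrit`, apart from `1 / (s - t)`. -/
def gammaInvIntegrand (γ u : ℝ) (s : ℂ) : ℂ :=
  (Complex.Gamma s)⁻¹ * Complex.exp (γ * s ^ 2 / 2 - u * s)

/-- The `t`-dependence of the integrand of `Kcrit`, apart from `1 / (s - t)`. -/
def gammaIntegrand (γ u : ℝ) (t : ℂ) : ℂ :=
  Complex.Gamma t * Complex.exp (-(γ * t ^ 2 / 2) + u * t)

theorem norm_exp_sq (γ u : ℝ) (s : ℂ) :
    ‖Complex.exp (γ * s ^ 2 / 2 - u * s)‖ =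
      Real.exp (γ * (s.re ^ 2 - s.im ^ 2) / 2 - u * s.re) := by
  rw [Complex.norm_exp]
  congr 1
  have : (s ^ 2).re = s.re ^ 2 - s.im ^ 2 := by simp [sq]
  have h2 : ((γ : ℂ) * s ^ 2 / 2).re = γ * (s ^ 2).re / 2 := by
    rw [show (2 : ℂ) = ((2 : ℝ) : ℂ) by norm_num, Complex.div_ofReal_re, Complex.re_ofReal_mul]
  rw [Complex.sub_re, h2, this, Complex.re_ofReal_mul]

/-- A Gaussian in the direction of the real axis beats every exponential. -/
theorem decaysLeft_mul_exp {h : ℂ → ℂ} {B K ε γ : ℝ} (hγ : 0 < γ)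
    (hh : ∀ z : ℂ, z.re ≤ 0 → ε ≤ |z.im| → ‖h z‖ ≤ B * Real.exp (K * -z.re)) (u a : ℝ) :
    DecaysLeft (fun t => h t * Complex.exp (-(γ * t ^ 2 / 2) + u * t)) a ε := by
  set m := K + |u| + 1 with hm
  refine ⟨|B| * Real.exp (9 / 8 * γ * a ^ 2 + 2 * m ^ 2 / γ), 0, fun z hz hi hs => ?_⟩
  have e : Complex.exp (-(γ * z ^ 2 / 2) + u * z) =
      Complex.exp (((-γ : ℝ) : ℂ) * z ^ 2 / 2 - ((-u : ℝ) : ℂ) * z) := by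
    congr 1; push_cast; ring
  simp only
  rw [norm_mul, e, norm_exp_sq]
  have h1 := hh z hz hi
  have hy : z.im ^ 2 ≤ 9 / 16 * (4 / 3 * z.re ^ 2 + 4 * a ^ 2) := by
    have h3 : (4 * |z.im|) ^ 2 ≤ (3 * (a - z.re)) ^ 2 := by
      have := abs_nonneg z.im
      gcongr
    rw [mul_pow, sq_abs] at h3
    nlinarith [sq_nonneg (z.re + 3 * a)]
  have hc : 0 ≤ γ / 8 * (z.re + 4 * m / γ) ^ 2 := by positivity
  have hc' : γ / 8 * (z.re + 4 * m / γ) ^ 2 = γ / 8 * z.re ^ 2 + m * z.re + 2 * m ^ 2 / γ := by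
    field_simp; ring
  rw [hc'] at hc
  have hu : u * z.re ≤ |u| * -z.re := by
    nlinarith [neg_abs_le u]
  calc ‖h z‖ * Real.exp (-γ * (z.re ^ 2 - z.im ^ 2) / 2 - -u * z.re)
      ≤ |B| * Real.exp (K * -z.re) * Real.exp (-γ * (z.re ^ 2 - z.im ^ 2) / 2 - -u * z.re) := by
        gcongr
        exact h1.trans (by gcongr; exact le_abs_self B)
    _ = |B| * Real.exp (K * -z.re + (-γ * (z.re ^ 2 - z.im ^ 2) / 2 - -u * z.re)) := by
        rw [mul_assoc, ← Real.exp_add]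
    _ ≤ |B| * Real.exp (9 / 8 * γ * a ^ 2 + 2 * m ^ 2 / γ + z.re) := by
        refine mul_le_mul_of_nonneg_left (Real.exp_le_exp.2 ?_) (abs_nonneg B)
        have hγy : γ * z.im ^ 2 ≤ γ * (9 / 16 * (4 / 3 * z.re ^ 2 + 4 * a ^ 2)) := by gcongr
        nlinarith
    _ = _ := by rw [Real.exp_add, ← mul_assoc]

theorem decaysLeft_gammaIntegrand {γ ε : ℝ} (hγ : 0 < γ) (hε : 0 < ε) (u a : ℝ) :
    DecaysLeft (gammaIntegrand γ u) a ε := by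
  obtain ⟨K, hK, h⟩ := exists_norm_Gamma_le_exp hε
  refine decaysLeft_mul_exp (B := Real.exp (2 * K)) (K := K) hγ (fun z hz hi => ?_) u a
  rw [← Real.exp_add]
  refine (h z (by linarith) hi).trans_eq ?_
  ring_nf

theorem differentiableAt_gammaIntegrand (γ u : ℝ) {z : ℂ} (hz : z - (0 : ℝ) ∈ Complex.slitPlane) :
    DifferentiableAt ℂ (gammaIntegrand γ u) z := by
  have h : DifferentiableAt ℂ Complex.Gamma z := by
    refine Complex.differentiableAt_Gamma z fun m hm => ?_
    rw [hm, Complex.mem_slitPlane_iff] at hz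
    rcases hz with hz | hz
    · simp at hz
      have : (0 : ℝ) ≤ m := Nat.cast_nonneg m
      linarith
    · simp at hz
  unfold gammaIntegrand
  fun_prop

theorem differentiable_gammaInvIntegrand (γ u : ℝ) : Differentiable ℂ (gammaInvIntegrand γ u) := by
  have := Complex.differentiable_one_div_Gamma
  unfold gammaInvIntegrand
  fun_prop

theorem exists_norm_gammaInvIntegrand_le {γ : ℝ} (hγ : 0 < γ) (u B : ℝ) :
    ∃ C : ℝ, ∀ s : ℂ, 0 ≤ s.re → s.re ≤ B →
      ‖gammaInvIntegrand γ u s‖ ≤ C * Real.exp (-|s.im|) := by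
  obtain ⟨C, hC, h⟩ := exists_norm_inv_Gamma_le (B + 1)
  refine ⟨(|B| + 1) * C * Real.exp (γ * B ^ 2 / 2 + |u| * |B| + 8 / γ), fun s hs hsB => ?_⟩
  have hB : |B| = B := abs_of_nonneg (hs.trans hsB)
  have h1 := h (s + 1) (by simpa using hs) (by simpa using hsB)
  simp only [Complex.add_im, Complex.one_im, add_zero] at h1
  set v := |s.im| with hv
  have hv0 : 0 ≤ v := abs_nonneg _
  have hns : ‖s‖ ≤ (|B| + 1) * Real.exp v := by
    have h2 := Complex.norm_le_abs_re_add_abs_im s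
    rw [abs_of_nonneg hs] at h2
    have h3 := Real.add_one_le_exp v
    nlinarith [abs_nonneg B]
  rw [gammaInvIntegrand, Complex.one_div_Gamma_eq_self_mul_one_div_Gamma_add_one, norm_mul,
    norm_mul, norm_exp_sq, ← sq_abs s.im, ← hv]
  have hu : -(u * s.re) ≤ |u| * |B| := by
    rw [hB]
    calc -(u * s.re) = -u * s.re := by ring
      _ ≤ |u| * s.re := by gcongr; exact neg_le_abs u
      _ ≤ _ := by gcongr
  have hx : s.re ^ 2 ≤ B ^ 2 := by gcongr
  have hc : 0 ≤ γ / 2 * (v - 4 / γ) ^ 2 := by positivity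
  have hc' : γ / 2 * (v - 4 / γ) ^ 2 = γ / 2 * v ^ 2 - 4 * v + 8 / γ := by
    field_simp; ring
  rw [hc'] at hc
  calc ‖s‖ * ‖(Complex.Gamma (s + 1))⁻¹‖ * Real.exp (γ * (s.re ^ 2 - v ^ 2) / 2 - u * s.re)
      ≤ ((|B| + 1) * Real.exp v) * (C * Real.exp (2 * v)) *
          Real.exp (γ * (s.re ^ 2 - v ^ 2) / 2 - u * s.re) := by gcongr
    _ = (|B| + 1) * C * Real.exp (v + 2 * v + (γ * (s.re ^ 2 - v ^ 2) / 2 - u * s.re)) := by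
        rw [Real.exp_add, Real.exp_add]; ring
    _ ≤ (|B| + 1) * C * Real.exp (γ * B ^ 2 / 2 + |u| * |B| + 8 / γ + -v) := by
        refine mul_le_mul_of_nonneg_left (Real.exp_le_exp.2 ?_) (by positivity)
        have : γ * s.re ^ 2 ≤ γ * B ^ 2 := by gcongr
        linarith
    _ = _ := by rw [Real.exp_add, ← mul_assoc]

/-- The critical kernel in separated form. -/
theorem Kcrit_eq_integral {c ε γ : ℝ} (hc₀ : 0 < c) (hc₁ : c < 1) (hε : 0 < ε) (hγ : 0 < γ)
    (x y : ℝ) :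
    Kcrit c ε x y γ = ∫ l in Ioi (0 : ℝ),
      (verticalIntegral 1 (gammaInvIntegrand γ (y + l)) / (2 * (Real.pi : ℂ) * Complex.I)) *
        (hankelIntegral c ε (gammaIntegrand γ (x + l)) / (2 * (Real.pi : ℂ) * Complex.I)) := by
  have hdiff := fun (u : ℝ) (z : ℂ) (hz : z - (0 : ℝ) ∈ Complex.slitPlane) =>
    differentiableAt_gammaIntegrand γ u hz
  have hr₁ : ∀ u : ℝ, IntegrableOn
      (fun r : ℝ => gammaIntegrand γ u (((c : ℂ) - ε * Complex.I) + r * (-1))) (Ioi 0) := by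
    intro u
    have := (decaysLeft_gammaIntegrand hγ hε u 0).integrableOn_hankel (c := c) (hdiff u) hε
      (σ := -1) (by simp)
    simpa [sub_eq_add_neg] using this
  have hr₂ : ∀ u : ℝ, IntegrableOn
      (fun r : ℝ => gammaIntegrand γ u (((c : ℂ) + ε * Complex.I) + r * (-1))) (Ioi 0) := by
    intro u
    have := (decaysLeft_gammaIntegrand hγ hε u 0).integrableOn_hankel (c := c) (hdiff u) hε
      (σ := 1) (by simp)
    simpa using this
  have hr₃ := fun u : ℝ => continuousOn_hankel_segment (c := c) (hdiff u) hc₀ (Icc (-ε) ε)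
  obtain ⟨C, hC⟩ := exists_norm_gammaInvIntegrand_le hγ y 1
  set φ : ℝ → ℂ := fun v => gammaInvIntegrand γ y (((1 : ℝ) : ℂ) + v * Complex.I) * Complex.I /
    (2 * (Real.pi : ℂ) * Complex.I) with hφ
  set ψ : ℝ → ℂ := fun r => gammaIntegrand γ x (hankelPath c ε r) * hankelVel ε r /
    (2 * (Real.pi : ℂ) * Complex.I) with hψ
  have iφ : Integrable φ := by
    refine Integrable.div_const (Integrable.mul_const ?_ _) _
    refine integrable_of_norm_le_exp_neg_abs (C := C)
      ((differentiable_gammaInvIntegrand γ y).continuous.comp (by fun_prop)) fun v => ?_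
    simpa using hC (((1 : ℝ) : ℂ) + v * Complex.I) (by simp) (by simp)
  have iψ : Integrable ψ := (hankelIntegral_eq hε (hr₁ x) (hr₂ x) (hr₃ x)).1.div_const _
  have h := (integral_integral_div_sub (s := fun v : ℝ => ((1 : ℝ) : ℂ) + v * Complex.I)
    (t := hankelPath c ε) (σ := 1) (τ := c) iφ iψ (by fun_prop) (measurable_hankelPath c ε) hc₁
    (fun v => by simp) (re_hankelPath_le c ε)).2
  rw [Kcrit, verticalIntegral]
  refine Eq.trans ?_ (h.trans ?_)
  · congr 1
    ext v
    set s : ℂ := ((1 : ℝ) : ℂ) + v * Complex.I with hs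
    have hsre : (1 : ℝ) ≤ s.re := by simp [hs]
    have e := hankelIntegral_mul_eq (q := fun z => 1 / (s - z) *
      (gammaInvIntegrand γ y s / (2 * (Real.pi : ℂ) * Complex.I)))
      (B := 1 / (1 - c) * ‖gammaInvIntegrand γ y s / (2 * (Real.pi : ℂ) * Complex.I)‖)
      hε (hr₁ x) (hr₂ x) (hr₃ x)
      ((continuousOn_one_div_sub hsre hc₁).mul continuousOn_const)
      (fun z hz => by
        rw [norm_mul]
        gcongr
        exact norm_one_div_sub_le hsre hz hc₁)
    have e' : (fun t => 1 / (s - t) * (Complex.Gamma t / Complex.Gamma s) *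
        (Complex.exp (γ * s ^ 2 / 2 - y * s) / Complex.exp (γ * t ^ 2 / 2 - x * t)) /
        (2 * (Real.pi : ℂ) * Complex.I)) = fun z => gammaIntegrand γ x z * (1 / (s - z) *
        (gammaInvIntegrand γ y s / (2 * (Real.pi : ℂ) * Complex.I))) := by
      ext t
      rw [gammaIntegrand, gammaInvIntegrand, show -(γ * t ^ 2 / 2) + x * t =
        -((γ : ℂ) * t ^ 2 / 2 - x * t) by ring, Complex.exp_neg]
      ring
    rw [e', e, hφ, hψ]
    simp only
    rw [← integral_const_mul, ← integral_div, ← integral_mul_const]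
    congr 1
    ext r
    ring
  · congr 1
    ext l
    have e1 : (∫ v, φ v * Complex.exp (-(l * (((1 : ℝ) : ℂ) + v * Complex.I)))) =
        verticalIntegral 1 (gammaInvIntegrand γ (y + l)) / (2 * (Real.pi : ℂ) * Complex.I) := by
      rw [verticalIntegral, ← integral_div]
      congr 1
      ext v
      simp only [hφ, gammaInvIntegrand]
      generalize ((1 : ℝ) : ℂ) + v * Complex.I = s
      rw [show (γ : ℂ) * s ^ 2 / 2 - ((y + l : ℝ) : ℂ) * s = (γ * s ^ 2 / 2 - y * s) + -(l * s) by
        push_cast; ring, Complex.exp_add]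
      ring
    have e2 : (∫ r, ψ r * Complex.exp (l * hankelPath c ε r)) =
        hankelIntegral c ε (gammaIntegrand γ (x + l)) / (2 * (Real.pi : ℂ) * Complex.I) := by
      rw [(hankelIntegral_eq hε (hr₁ _) (hr₂ _) (hr₃ _)).2, ← integral_div]
      congr 1
      ext r
      simp only [hψ, gammaIntegrand]
      generalize hankelPath c ε r = t
      rw [show -((γ : ℂ) * t ^ 2 / 2) + ((x + l : ℝ) : ℂ) * t =
        (-(γ * t ^ 2 / 2) + x * t) + l * t by push_cast; ring,
        Complex.exp_add (-(γ * t ^ 2 / 2) + x * t)]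
      ring
    rw [e1, e2]

/-- The Airy function as an integral along the vertical line through `1`. -/
def airyFun (u : ℝ) : ℂ :=
  wedgeIntegral 1 (-Complex.I) Complex.I (airyIntegrand u) / (2 * (Real.pi : ℂ) * Complex.I)

/-- The Airy kernel in separated form; the `t`-contour is the reflection of the `s`-contour, so both
factors are the same function. -/
theorem Kairy_eq_integral (x y : ℝ) :
    Kairy x y = ∫ l in Ioi (0 : ℝ), airyFun (y + l) * airyFun (x + l) := by
  set d₁ := Complex.exp (5 * (Real.pi : ℂ) * Complex.I / 3) with hd₁
  set d₂ := Complex.exp ((Real.pi : ℂ) * Complex.I / 3) with hd₂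
  have hπ₂ : Complex.exp (4 * (Real.pi : ℂ) * Complex.I / 3) = -d₂ := by
    rw [show 4 * (Real.pi : ℂ) * Complex.I / 3 = (Real.pi : ℂ) * Complex.I / 3 +
      Real.pi * Complex.I by ring, Complex.exp_add, Complex.exp_pi_mul_I]
    ring
  have hπ₁ : Complex.exp (2 * (Real.pi : ℂ) * Complex.I / 3) = -d₁ := by
    rw [hd₁, show 5 * (Real.pi : ℂ) * Complex.I / 3 = 2 * (Real.pi : ℂ) * Complex.I / 3 +
      Real.pi * Complex.I by ring, Complex.exp_add, Complex.exp_pi_mul_I]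
    ring
  have hd₂' : d₂ = Complex.exp (((Real.pi / 3 : ℝ) : ℂ) * Complex.I) := by
    rw [hd₂]; congr 1; push_cast; ring
  have hd₁' : d₁ = Complex.exp (((-(Real.pi / 3) : ℝ) : ℂ) * Complex.I) := by
    rw [hd₁, show 5 * (Real.pi : ℂ) * Complex.I / 3 =
      ((-(Real.pi / 3) : ℝ) : ℂ) * Complex.I + 2 * Real.pi * Complex.I by push_cast; ring,
      Complex.exp_add, Complex.exp_two_pi_mul_I, mul_one]
  have re₂ : d₂.re = 1 / 2 := by rw [hd₂', Complex.exp_ofReal_mul_I_re, Real.cos_pi_div_three]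
  have im₂ : d₂.im = √3 / 2 := by rw [hd₂', Complex.exp_ofReal_mul_I_im, Real.sin_pi_div_three]
  have re₁ : d₁.re = 1 / 2 := by
    rw [hd₁', Complex.exp_ofReal_mul_I_re, Real.cos_neg, Real.cos_pi_div_three]
  have im₁ : d₁.im = -(√3 / 2) := by
    rw [hd₁', Complex.exp_ofReal_mul_I_im, Real.sin_neg, Real.sin_pi_div_three]
  have h3 : 1 ≤ √3 := by rw [Real.one_le_sqrt]; norm_num
  obtain ⟨N, hN⟩ : ∃ N : ℂ, N = 2 * (Real.pi : ℂ) * Complex.I := ⟨_, rfl⟩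
  have hw : ∀ u : ℝ, IntegrableOn (fun r : ℝ => airyIntegrand u (1 + r * d₁)) (Ioi 0) ∧
      IntegrableOn (fun r : ℝ => airyIntegrand u (1 + r * d₂)) (Ioi 0) ∧
      wedgeIntegral 1 d₁ d₂ (airyIntegrand u) / N = airyFun u := by
    intro u
    obtain ⟨i₁, i₂, e⟩ := airy_wedge (u := u) (a := 1) (b := √3 / 2) (r₀ := 0) (by positivity) im₁
      im₂ (by rw [re₁, re₂]) (fun r hr => by rw [re₂]; linarith)
      (fun r hr => by rw [re₂]; nlinarith)
    simp only [Complex.ofReal_one] at i₁ i₂ e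
    exact ⟨i₁, i₂, by rw [e, hN]; rfl⟩
  have j₁ : ∀ u : ℝ, IntegrableOn (fun r : ℝ => airyIntegrand u (-(-1 + r * -d₂))) (Ioi 0) := by
    intro u
    refine (hw u).2.1.congr_fun (fun r _ => ?_) measurableSet_Ioi
    simp only; congr 1; ring
  have j₂ : ∀ u : ℝ, IntegrableOn (fun r : ℝ => airyIntegrand u (-(-1 + r * -d₁))) (Ioi 0) := by
    intro u
    refine (hw u).1.congr_fun (fun r _ => ?_) measurableSet_Ioi
    simp only; congr 1; ring
  set ψ : ℝ → ℂ := fun r => airyIntegrand x (-(wedgePath (-1) (-d₂) (-d₁) r)) *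
    wedgeVel (-d₂) (-d₁) r / N with hψ
  set J : ℂ → ℂ := fun s => ∫ r, ψ r / (s - wedgePath (-1) (-d₂) (-d₁) r) with hJ
  have iψ : Integrable ψ :=
    (wedgeIntegral_eq (f := fun z => airyIntegrand x (-z)) (j₁ x) (j₂ x)).1.div_const _
  have hre : ∀ r, (wedgePath (-1) (-d₂) (-d₁) r).re ≤ -1 := fun r =>
    (re_wedgePath_le (by simp [re₂]) (by simp [re₁]) r).trans_eq (by simp)
  have hinner : ∀ s : ℂ, 1 ≤ s.re → wedgeIntegral (-1) (-d₂) (-d₁) (fun t =>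
      1 / (s - t) * (Complex.exp (s ^ 3 / 3 - y * s) / Complex.exp (t ^ 3 / 3 - x * t)) / N) =
      airyIntegrand y s * J s := by
    intro s hs
    have hqc : ContinuousOn (fun z => 1 / (s - z) * (airyIntegrand y s / N))
        {z : ℂ | z.re ≤ (-1 : ℂ).re} := by
      rw [show (-1 : ℂ).re = -1 by simp]
      exact (continuousOn_one_div_sub hs (by norm_num)).mul continuousOn_const
    have e := wedgeIntegral_mul_eq (g := fun z => airyIntegrand x (-z))
      (q := fun z => 1 / (s - z) * (airyIntegrand y s / N))
      (B := 1 / (1 - -1) * ‖airyIntegrand y s / N‖)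
      (j₁ x) (j₂ x) (by simp [re₂]) (by simp [re₁])
      hqc
      (fun z hz => by
        rw [norm_mul]
        gcongr
        exact norm_one_div_sub_le hs (by simpa using hz) (by norm_num))
    have e' : (fun t => 1 / (s - t) *
        (Complex.exp (s ^ 3 / 3 - y * s) / Complex.exp (t ^ 3 / 3 - x * t)) / N) =
        fun z => airyIntegrand x (-z) * (1 / (s - z) * (airyIntegrand y s / N)) := by
      ext t
      simp only [airyIntegrand]
      rw [show (-t) ^ 3 / 3 - x * -t = -(t ^ 3 / 3 - x * t) by ring, Complex.exp_neg]
      ring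
    rw [e', e, hJ]
    simp only [hψ]
    rw [← integral_const_mul]
    congr 1
    ext r
    ring
  have hout : ∀ d : ℂ, d.re = 1 / 2 →
      IntegrableOn (fun r : ℝ => airyIntegrand y (1 + r * d)) (Ioi 0) →
      IntegrableOn (fun r : ℝ => wedgeIntegral (-1) (-d₂) (-d₁) (fun t => 1 / ((1 + r * d) - t) *
        (Complex.exp ((1 + r * d) ^ 3 / 3 - y * (1 + r * d)) /
          Complex.exp (t ^ 3 / 3 - x * t)) / N) / N) (Ioi 0) := by
    intro d hd hi
    have h := (integral_integral_div_sub (μ := volume.restrict (Ioi (0 : ℝ)))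
      (s := fun r : ℝ => 1 + ((|r| : ℝ) : ℂ) * d) (t := wedgePath (-1) (-d₂) (-d₁)) (σ := 1)
      (τ := -1) hi iψ (by fun_prop) (measurable_wedgePath _ _ _) (by norm_num)
      (fun r => by simp [hd]) hre).1
    refine IntegrableOn.congr_fun (Integrable.div_const h N) (fun r hr => ?_) measurableSet_Ioi
    have hr : 0 < r := hr
    simp only [abs_of_pos hr]
    rw [hinner _ (by simp [hd]; linarith)]
  have iφ : Integrable (fun r => airyIntegrand y (wedgePath 1 d₁ d₂ r) * wedgeVel d₁ d₂ r / N) :=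
    (wedgeIntegral_eq (hw y).1 (hw y).2.1).1.div_const _
  have h := (integral_integral_div_sub (s := wedgePath 1 d₁ d₂) (t := wedgePath (-1) (-d₂) (-d₁))
    (σ := 1) (τ := -1) iφ iψ (measurable_wedgePath _ _ _) (measurable_wedgePath _ _ _)
    (by norm_num) (fun r => le_re_wedgePath (a := 1) (by simp [re₁]) (by simp [re₂]) r) hre).2
  rw [Kairy, hπ₁, hπ₂, ← hN, (wedgeIntegral_eq (hout d₁ re₁ (hw y).1) (hout d₂ re₂ (hw y).2.1)).2]
  refine Eq.trans ?_ (h.trans ?_)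
  · congr 1
    ext r
    rw [hinner _ (le_re_wedgePath (a := 1) (d₁ := d₁) (d₂ := d₂) (by simp [re₁]) (by simp [re₂]) r)]
    ring
  · congr 1
    ext l
    have e1 : (∫ r, airyIntegrand y (wedgePath 1 d₁ d₂ r) * wedgeVel d₁ d₂ r / N *
        Complex.exp (-(l * wedgePath 1 d₁ d₂ r))) = airyFun (y + l) := by
      rw [← (hw _).2.2, (wedgeIntegral_eq (hw _).1 (hw _).2.1).2, ← integral_div]
      congr 1
      ext r
      simp only [airyIntegrand]
      generalize wedgePath 1 d₁ d₂ r = s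
      rw [show s ^ 3 / 3 - ((y + l : ℝ) : ℂ) * s = (s ^ 3 / 3 - y * s) + -(l * s) by
        push_cast; ring, Complex.exp_add]
      ring
    have e2 : (∫ r, ψ r * Complex.exp (l * wedgePath (-1) (-d₂) (-d₁) r)) = airyFun (x + l) := by
      have hflip := wedgeIntegral_comp_neg (airyIntegrand (x + l)) 1 (-d₂) (-d₁)
      rw [neg_neg, neg_neg] at hflip
      rw [← (hw _).2.2, ← hflip, (wedgeIntegral_eq (j₁ _) (j₂ _)).2, ← integral_div]
      congr 1
      ext r
      simp only [hψ, airyIntegrand]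
      generalize wedgePath (-1) (-d₂) (-d₁) r = t
      rw [show (-t) ^ 3 / 3 - ((x + l : ℝ) : ℂ) * -t = ((-t) ^ 3 / 3 - x * -t) + l * t by
        push_cast; ring, Complex.exp_add]
      ring
    rw [e1, e2]

/-! ### Convergence of kernels in separated form -/

/-- Convergence of Laplace-type integrals with an error that is uniform in `u`, by dominated
convergence of the densities. -/
theorem laplace_limit {ι : Type*} {L : Filter ι} [L.IsCountablyGenerated] {φ : ι → ℝ → ℂ}
    {φ₀ z : ℝ → ℂ} {g : ℝ → ℝ} {σ M : ℝ} (hφ : ∀ᶠ i in L, Measurable (φ i))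
    (hφ₀ : Measurable φ₀) (hz : Measurable z) (hzσ : ∀ v, σ ≤ (z v).re) (hg : Integrable g)
    (hdom : ∀ᶠ i in L, ∀ v, ‖φ i v‖ * Real.exp (M * ((z v).re - σ)) ≤ g v)
    (hdom₀ : ∀ v, ‖φ₀ v‖ * Real.exp (M * ((z v).re - σ)) ≤ g v)
    (hlim : ∀ v, Tendsto (fun i => φ i v) L (𝓝 (φ₀ v))) :
    ∃ (C : ℝ) (δ : ι → ℝ), Tendsto δ L (𝓝 0) ∧
      (∀ u, -M ≤ u → ‖∫ v, φ₀ v * Complex.exp (-(u * z v))‖ ≤ C * Real.exp (-(σ * u))) ∧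
      ∀ᶠ i in L, ∀ u, -M ≤ u →
        ‖(∫ v, φ i v * Complex.exp (-(u * z v))) - ∫ v, φ₀ v * Complex.exp (-(u * z v))‖ ≤
          δ i * Real.exp (-(σ * u)) := by
  have hexp : ∀ u v, -M ≤ u → ‖Complex.exp (-(u * z v))‖ ≤
      Real.exp (M * ((z v).re - σ)) * Real.exp (-(σ * u)) := by
    intro u v hu
    rw [Complex.norm_exp, ← Real.exp_add, Real.exp_le_exp]
    simp only [Complex.neg_re, Complex.re_ofReal_mul]
    nlinarith [hzσ v]
  have hbound : ∀ (f : ℝ → ℂ) (u v : ℝ), -M ≤ u → ‖f v * Complex.exp (-(u * z v))‖ ≤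
      ‖f v‖ * Real.exp (M * ((z v).re - σ)) * Real.exp (-(σ * u)) := by
    intro f u v hu
    rw [norm_mul, mul_assoc]
    gcongr
    exact hexp u v hu
  have hint : ∀ (f : ℝ → ℂ) (u : ℝ), Measurable f → -M ≤ u →
      (∀ v, ‖f v‖ * Real.exp (M * ((z v).re - σ)) ≤ g v) →
      Integrable fun v => f v * Complex.exp (-(u * z v)) := by
    intro f u hf hu h
    refine (hg.mul_const (Real.exp (-(σ * u)))).mono'
      (Measurable.aestronglyMeasurable (by fun_prop)) (Eventually.of_forall fun v => ?_)
    exact (hbound f u v hu).trans (by gcongr; exact h v)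
  refine ⟨∫ v, g v, fun i => ∫ v, ‖φ i v - φ₀ v‖ * Real.exp (M * ((z v).re - σ)), ?_, ?_, ?_⟩
  · rw [← integral_zero ℝ ℝ]
    refine tendsto_integral_filter_of_dominated_convergence (fun v => 2 * g v) ?_ ?_
      (hg.const_mul 2) ?_
    · filter_upwards [hφ] with i hi
      exact Measurable.aestronglyMeasurable (by fun_prop)
    · filter_upwards [hdom] with i hi
      refine Eventually.of_forall fun v => ?_
      rw [Real.norm_of_nonneg (by positivity)]
      have := norm_sub_le (φ i v) (φ₀ v)
      have e := Real.exp_pos (M * ((z v).re - σ))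
      nlinarith [hi v, hdom₀ v]
    · refine Eventually.of_forall fun v => ?_
      have h := ((hlim v).sub_const (φ₀ v)).norm.mul_const (Real.exp (M * ((z v).re - σ)))
      simpa using h
  · intro u hu
    rw [← integral_mul_const]
    refine norm_integral_le_of_norm_le (hg.mul_const _) (Eventually.of_forall fun v => ?_)
    exact (hbound φ₀ u v hu).trans (by gcongr; exact hdom₀ v)
  · filter_upwards [hφ, hdom] with i hi hd u hu
    rw [← integral_sub (hint _ u hi hu hd) (hint _ u hφ₀ hu hdom₀), ← integral_mul_const]
    refine norm_integral_le_of_norm_le ?_ (Eventually.of_forall fun v => ?_)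
    · refine Integrable.mul_const ((hg.const_mul 2).mono'
        (Measurable.aestronglyMeasurable (by fun_prop)) (Eventually.of_forall fun v => ?_)) _
      rw [Real.norm_of_nonneg (by positivity)]
      have := norm_sub_le (φ i v) (φ₀ v)
      have e := Real.exp_pos (M * ((z v).re - σ))
      nlinarith [hd v, hdom₀ v]
    · rw [← sub_mul]
      exact hbound (fun v => φ i v - φ₀ v) u v hu

theorem measurable_laplace {φ z : ℝ → ℂ} (hφ : Measurable φ) (hz : Measurable z) :
    Measurable fun u : ℝ => ∫ v, φ v * Complex.exp (-(u * z v)) := by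
  have : Measurable (Function.uncurry fun (u v : ℝ) => φ v * Complex.exp (-(u * z v))) := by
    unfold Function.uncurry
    fun_prop
  exact (this.stronglyMeasurable.integral_prod_right (ν := volume)).measurable

/-- If `F i → F₀` relative to the weight `e^{-u}` and `G i → G₀`, both uniformly on `[-M, ∞)`, then
the kernels `∫₀^∞ F (y + l) G (x + l) dl` converge uniformly on the square `[-M, M]²`. -/
theorem tendstoUniformlyOn_separated {ι : Type*} {L : Filter ι} {F G : ι → ℝ → ℂ} {F₀ G₀ : ℝ → ℂ}
    {C C' M : ℝ} {δ δ' : ι → ℝ} (hF : ∀ᶠ i in L, Measurable (F i)) (hF₀ : Measurable F₀)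
    (hG : ∀ᶠ i in L, Measurable (G i)) (hG₀ : Measurable G₀)
    (bF₀ : ∀ u, -M ≤ u → ‖F₀ u‖ ≤ C * Real.exp (-u)) (bG₀ : ∀ u, -M ≤ u → ‖G₀ u‖ ≤ C')
    (hδ : Tendsto δ L (𝓝 0)) (hδ' : Tendsto δ' L (𝓝 0))
    (bF : ∀ᶠ i in L, ∀ u, -M ≤ u → ‖F i u - F₀ u‖ ≤ δ i * Real.exp (-u))
    (bG : ∀ᶠ i in L, ∀ u, -M ≤ u → ‖G i u - G₀ u‖ ≤ δ' i) :
    TendstoUniformlyOn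
      (fun i (p : ℝ × ℝ) => ∫ l in Ioi (0 : ℝ), F i (p.2 + l) * G i (p.1 + l))
      (fun p => ∫ l in Ioi (0 : ℝ), F₀ (p.2 + l) * G₀ (p.1 + l)) L
      (Icc (-M) M ×ˢ Icc (-M) M) := by
  rw [Metric.tendstoUniformlyOn_iff]
  intro η hη
  have hlim : Tendsto (fun i => (δ i * (C' + δ' i) + C * δ' i) * Real.exp M) L (𝓝 0) := by
    have := ((hδ.mul (hδ'.const_add C')).add (hδ'.const_mul C)).mul_const (Real.exp M)
    simpa using this
  filter_upwards [hF, hG, bF, bG, hlim.eventually (gt_mem_nhds hη)] with i hFi hGi bFi bGi hi p hp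
  obtain ⟨⟨hx, -⟩, hy, -⟩ := hp
  have hexpint : IntegrableOn (fun l : ℝ => Real.exp (-(p.2 + l))) (Ioi 0) := by
    have := (integrableOn_exp_neg_Ioi 0).const_mul (Real.exp (-p.2))
    refine this.congr (Eventually.of_forall fun l => ?_)
    simp only
    rw [← Real.exp_add, neg_add]
  have hexpval : ∫ l in Ioi (0 : ℝ), Real.exp (-(p.2 + l)) ≤ Real.exp M := by
    have : ∀ l : ℝ, Real.exp (-(p.2 + l)) = Real.exp (-p.2) * Real.exp (-l) := by
      intro l; rw [← Real.exp_add, neg_add]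
    simp only [this]
    rw [integral_const_mul, integral_exp_neg_Ioi_zero, mul_one, Real.exp_le_exp]
    linarith
  have hpt : ∀ l ∈ Ioi (0 : ℝ), -M ≤ p.2 + l ∧ -M ≤ p.1 + l := by
    intro l hl
    have hl : 0 < l := hl
    constructor <;> linarith
  have hδ0 : ∀ l ∈ Ioi (0 : ℝ), 0 ≤ δ' i ∧ 0 ≤ C' ∧ 0 ≤ δ i ∧ 0 ≤ C := fun l hl =>
    ⟨(norm_nonneg _).trans (bGi _ (hpt l hl).2), (norm_nonneg _).trans (bG₀ _ (hpt l hl).2),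
      nonneg_of_mul_nonneg_left ((norm_nonneg _).trans (bFi _ (hpt l hl).1)) (Real.exp_pos _),
      nonneg_of_mul_nonneg_left ((norm_nonneg _).trans (bF₀ _ (hpt l hl).1)) (Real.exp_pos _)⟩
  obtain ⟨p1, p2, p3, p4⟩ := hδ0 1 (by simp)
  have b1 : ∀ l ∈ Ioi (0 : ℝ), ‖G i (p.1 + l)‖ ≤ C' + δ' i := by
    intro l hl
    calc ‖G i (p.1 + l)‖ = ‖G₀ (p.1 + l) + (G i (p.1 + l) - G₀ (p.1 + l))‖ := by congr 1; ring
      _ ≤ _ := (norm_add_le _ _).trans (add_le_add (bG₀ _ (hpt l hl).2) (bGi _ (hpt l hl).2))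
  have b2 : ∀ l ∈ Ioi (0 : ℝ), ‖F i (p.2 + l)‖ ≤ (C + δ i) * Real.exp (-(p.2 + l)) := by
    intro l hl
    calc ‖F i (p.2 + l)‖ = ‖F₀ (p.2 + l) + (F i (p.2 + l) - F₀ (p.2 + l))‖ := by congr 1; ring
      _ ≤ C * Real.exp (-(p.2 + l)) + δ i * Real.exp (-(p.2 + l)) :=
        (norm_add_le _ _).trans (add_le_add (bF₀ _ (hpt l hl).1) (bFi _ (hpt l hl).1))
      _ = _ := by ring
  have i1 : IntegrableOn (fun l => F i (p.2 + l) * G i (p.1 + l)) (Ioi 0) := by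
    refine Integrable.mono' (hexpint.const_mul ((C + δ i) * (C' + δ' i)))
      (Measurable.aestronglyMeasurable (by fun_prop)) ?_
    filter_upwards [ae_restrict_mem measurableSet_Ioi] with l hl
    rw [norm_mul]
    calc _ ≤ (C + δ i) * Real.exp (-(p.2 + l)) * (C' + δ' i) := by
          gcongr
          · exact b2 l hl
          · exact b1 l hl
      _ = _ := by ring
  have i2 : IntegrableOn (fun l => F₀ (p.2 + l) * G₀ (p.1 + l)) (Ioi 0) := by
    refine Integrable.mono' (hexpint.const_mul (C * C'))
      (Measurable.aestronglyMeasurable (by fun_prop)) ?_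
    filter_upwards [ae_restrict_mem measurableSet_Ioi] with l hl
    rw [norm_mul]
    calc _ ≤ C * Real.exp (-(p.2 + l)) * C' := by
          gcongr
          · exact bF₀ _ (hpt l hl).1
          · exact bG₀ _ (hpt l hl).2
      _ = _ := by ring
  rw [dist_comm, dist_eq_norm, ← integral_sub i1 i2]
  refine lt_of_le_of_lt ?_ hi
  calc _ ≤ ∫ l in Ioi (0 : ℝ), (δ i * (C' + δ' i) + C * δ' i) * Real.exp (-(p.2 + l)) := by
        refine norm_integral_le_of_norm_le (hexpint.const_mul _) ?_
        filter_upwards [ae_restrict_mem measurableSet_Ioi] with l hl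
        calc _ = ‖(F i (p.2 + l) - F₀ (p.2 + l)) * G i (p.1 + l) +
              F₀ (p.2 + l) * (G i (p.1 + l) - G₀ (p.1 + l))‖ := by congr 1; ring
          _ ≤ δ i * Real.exp (-(p.2 + l)) * (C' + δ' i) +
              C * Real.exp (-(p.2 + l)) * δ' i := by
            refine (norm_add_le _ _).trans (add_le_add ?_ ?_)
            · rw [norm_mul]
              gcongr
              · exact bFi _ (hpt l hl).1
              · exact b1 l hl
            · rw [norm_mul]
              gcongr
              · exact bF₀ _ (hpt l hl).1
              · exact bGi _ (hpt l hl).2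
          _ = _ := by ring
    _ ≤ _ := by
        rw [integral_const_mul]
        gcongr

theorem integrable_exp_neg_abs : Integrable fun v : ℝ => Real.exp (-|v|) := by
  have h := integrable_of_norm_le_exp_neg_abs (g := fun v : ℝ => ((Real.exp (-|v|) : ℝ) : ℂ))
    (C := 1) (by fun_prop) (fun v => by
      rw [Complex.norm_real, Real.norm_of_nonneg (Real.exp_pos _).le, one_mul])
  exact (Complex.reCLM.integrable_comp h).congr (Eventually.of_forall fun v => Complex.ofReal_re _)

theorem measurable_Gamma : Measurable Complex.Gamma := by
  have e : Complex.Gamma = (fun s => (Complex.Gamma s)⁻¹)⁻¹ := by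
    ext s
    simp
  rw [e]
  exact Complex.differentiable_one_div_Gamma.continuous.measurable.inv

theorem integral_eq_inv_mul_integral_comp {k : ℝ} (hk : 0 < k) (g : ℝ → ℂ) :
    ∫ v, g v = (k⁻¹ : ℝ) * ∫ v, g (k⁻¹ * v) := by
  rw [Measure.integral_comp_mul_left g k⁻¹, inv_inv, abs_of_pos hk, Complex.real_smul, ← mul_assoc,
    ← Complex.ofReal_mul, inv_mul_cancel₀ hk.ne', Complex.ofReal_one, one_mul]

/-- The factorisation of `Kcrit`, with its variables scaled by `k` about `A`. -/
theorem Kcrit_scaled_eq_integral {c ε γ : ℝ} (hc₀ : 0 < c) (hc₁ : c < 1) (hε : 0 < ε) (hγ : 0 < γ)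
    {k : ℝ} (hk : 0 < k) (A x y : ℝ) :
    Kcrit c ε (A + k * x) (A + k * y) γ = k * ∫ l in Ioi (0 : ℝ),
      (verticalIntegral 1 (gammaInvIntegrand γ (A + k * (y + l))) /
        (2 * (Real.pi : ℂ) * Complex.I)) *
        (hankelIntegral c ε (gammaIntegrand γ (A + k * (x + l))) /
          (2 * (Real.pi : ℂ) * Complex.I)) := by
  rw [Kcrit_eq_integral hc₀ hc₁ hε hγ]
  have h := integral_comp_mul_left_Ioi (fun l : ℝ =>
    (verticalIntegral 1 (gammaInvIntegrand γ (A + k * y + l)) /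
      (2 * (Real.pi : ℂ) * Complex.I)) * (hankelIntegral c ε (gammaIntegrand γ (A + k * x + l)) /
      (2 * (Real.pi : ℂ) * Complex.I))) 0 hk
  rw [mul_zero] at h
  have e : ∀ w l : ℝ, A + k * (w + l) = A + k * w + k * l := fun w l => by ring
  simp only [e]
  rw [h, Complex.real_smul, ← mul_assoc, ← Complex.ofReal_mul, mul_inv_cancel₀ hk.ne',
    Complex.ofReal_one, one_mul]

/-! ### The Gaussian limit -/

/-- The Gaussian part of `gammaIntegrand`. -/
def gaussExp (γ u : ℝ) (t : ℂ) : ℂ := Complex.exp (-(γ * t ^ 2 / 2) + u * t)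

theorem norm_gaussExp (γ u : ℝ) (t : ℂ) :
    ‖gaussExp γ u t‖ = Real.exp (-(γ * (t.re ^ 2 - t.im ^ 2) / 2) + u * t.re) := by
  have e : gaussExp γ u t = Complex.exp (((-γ : ℝ) : ℂ) * t ^ 2 / 2 - ((-u : ℝ) : ℂ) * t) := by
    rw [gaussExp]; congr 1; push_cast; ring
  rw [e, norm_exp_sq]
  congr 1
  ring

theorem differentiable_gaussExp (γ u : ℝ) : Differentiable ℂ (gaussExp γ u) := by
  unfold gaussExp
  fun_prop

theorem tendsto_arg_sub_real {c ε : ℝ} (hε : 0 < ε) :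
    Tendsto (fun R : ℝ => Complex.arg ((c : ℂ) + ε * Complex.I - R)) atTop (𝓝 Real.pi) := by
  have h1 : Tendsto (fun R : ℝ => (((R⁻¹ : ℝ)) : ℂ) * ((c : ℂ) + ε * Complex.I) - 1) atTop
      (𝓝 (-1)) := by
    have := (((Complex.continuous_ofReal.tendsto 0).comp tendsto_inv_atTop_zero).mul_const
      ((c : ℂ) + ε * Complex.I)).sub_const 1
    simpa using this
  have h2 : Tendsto (fun R : ℝ => (((R⁻¹ : ℝ)) : ℂ) * ((c : ℂ) + ε * Complex.I) - 1) atTop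
      (𝓝[{z : ℂ | 0 ≤ z.im}] (-1)) := by
    refine tendsto_nhdsWithin_iff.2 ⟨h1, ?_⟩
    filter_upwards [eventually_gt_atTop 0] with R hR
    simp
    positivity
  have h3 := (Complex.continuousWithinAt_arg_of_re_neg_of_im_zero (z := -1) (by simp)
    (by simp)).tendsto.comp h2
  rw [Complex.arg_neg_one] at h3
  refine h3.congr' ?_
  filter_upwards [eventually_gt_atTop 0] with R hR
  have hR' : (R : ℂ) ≠ 0 := by exact_mod_cast hR.ne'
  rw [Function.comp, ← Complex.arg_real_mul _ hR]
  congr 1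
  push_cast
  field_simp

theorem decaysLeft_inv_mul_gaussExp {γ ε : ℝ} (hγ : 0 < γ) (hε : 0 < ε) (u : ℝ) :
    DecaysLeft (fun t => t⁻¹ * gaussExp γ u t) 0 ε := by
  refine decaysLeft_mul_exp (h := fun t => t⁻¹) (B := ε⁻¹) (K := 0) hγ (fun z _ hz => ?_) u 0
  rw [zero_mul, Real.exp_zero, mul_one, norm_inv]
  exact inv_anti₀ hε (hz.trans (Complex.abs_im_le_norm z))

theorem differentiableAt_inv_mul_gaussExp (γ u : ℝ) {z : ℂ}
    (hz : z - (0 : ℝ) ∈ Complex.slitPlane) :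
    DifferentiableAt ℂ (fun t => t⁻¹ * gaussExp γ u t) z := by
  rw [Complex.ofReal_zero, sub_zero] at hz
  exact (differentiableAt_inv (Complex.slitPlane_ne_zero hz)).mul (differentiable_gaussExp γ u z)

/-- The residue at the origin: with `1 / t` in place of `Γ(t)` the Hankel integral is `2 π i`. A
primitive is `log t` plus an entire function, and only the jump of the logarithm survives. -/
theorem hankelIntegral_gaussExp_div {c ε γ : ℝ} (hc : 0 < c) (hε : 0 < ε) (hγ : 0 < γ) (u : ℝ) :
    hankelIntegral c ε (fun t => t⁻¹ * gaussExp γ u t) = 2 * (Real.pi : ℂ) * Complex.I := by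
  have hdec := decaysLeft_inv_mul_gaussExp hγ hε u
  have hdiff := fun z => differentiableAt_inv_mul_gaussExp γ u (z := z)
  have hg0 : gaussExp γ u 0 = 1 := by simp [gaussExp]
  -- a primitive: an entire function plus the logarithm
  have hent : Differentiable ℂ (dslope (gaussExp γ u) 0) := by
    have := (Complex.differentiableOn_dslope (f := gaussExp γ u) (c := 0) (s := univ)
      univ_mem).2 (differentiable_gaussExp γ u).differentiableOn
    exact fun z => (this z (mem_univ z)).differentiableAt univ_mem
  obtain ⟨Q, hQ⟩ := exists_primitive_entire hent
  have hdsl : ∀ z : ℂ, z ≠ 0 → dslope (gaussExp γ u) 0 z = z⁻¹ * (gaussExp γ u z - 1) := by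
    intro z hz
    rw [dslope_of_ne _ hz, slope_def_module, sub_zero, hg0, smul_eq_mul]
  have hP : ∀ z : ℂ, z - (0 : ℝ) ∈ Complex.slitPlane →
      HasDerivAt (fun z => Q z + Complex.log z) (z⁻¹ * gaussExp γ u z) z := by
    intro z hz
    rw [Complex.ofReal_zero, sub_zero] at hz
    have := (hQ z).add (Complex.hasDerivAt_log hz)
    refine this.congr_deriv ?_
    rw [hdsl z (Complex.slitPlane_ne_zero hz)]
    ring
  set P : ℂ → ℂ := fun z => Q z + Complex.log z with hPdef
  have hray : ∀ σ : ℝ, |σ| = 1 → Tendsto (fun R : ℝ => P ((c + σ * ε * Complex.I) + R * (-1)))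
      atTop (𝓝 (P (c + σ * ε * Complex.I) + rayIntegral (c + σ * ε * Complex.I) (-1)
        (fun t => t⁻¹ * gaussExp γ u t))) := by
    intro σ hσ
    have hσ0 : σ ≠ 0 := by rintro rfl; simp at hσ
    refine tendsto_primitive_ray (fun r hr => hP _ (sub_mem_slitPlane_of_im_ne 0 ?_))
      (hdec.integrableOn_hankel hdiff hε hσ)
    simp
    exact ⟨hσ0, hε.ne'⟩
  have hseg : ∫ v in (-ε)..ε, (fun t => t⁻¹ * gaussExp γ u t) ((c : ℂ) + v * Complex.I) * Complex.I =
      P (c + (ε : ℂ) * Complex.I) - P (c + ((-ε : ℝ) : ℂ) * Complex.I) := by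
    refine intervalIntegral.integral_eq_sub_of_hasDerivAt
      (f := fun v : ℝ => P (c + v * Complex.I)) (fun v _ => ?_) ?_
    · have hl : HasDerivAt (fun v : ℝ => (c : ℂ) + (v : ℂ) * Complex.I) Complex.I v := by
        simpa using ((Complex.ofRealCLM.hasDerivAt (x := v)).mul_const Complex.I).const_add (c : ℂ)
      exact HasDerivAt.comp v (hP _ (sub_mem_slitPlane_of_lt_re (by simpa using hc))) hl
    · exact ((continuousOn_hankel_segment hdiff hc _).mul continuousOn_const).intervalIntegrable
  have h1 := hray 1 (by simp)
  have h2 := hray (-1) (by simp)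
  have e1 : (c + ((1 : ℝ) : ℂ) * ε * Complex.I) = c + ε * Complex.I := by push_cast; ring
  have e2 : (c + ((-1 : ℝ) : ℂ) * ε * Complex.I) = c - ε * Complex.I := by push_cast; ring
  have e3 : (c + ((-ε : ℝ) : ℂ) * Complex.I) = c - ε * Complex.I := by push_cast; ring
  rw [e1] at h1
  rw [e2] at h2
  have hval : hankelIntegral c ε (fun t => t⁻¹ * gaussExp γ u t) =
      (P (c + ε * Complex.I) + rayIntegral (c + ε * Complex.I) (-1)
        (fun t => t⁻¹ * gaussExp γ u t)) -
      (P (c - ε * Complex.I) + rayIntegral (c - ε * Complex.I) (-1)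
        (fun t => t⁻¹ * gaussExp γ u t)) := by
    unfold hankelIntegral
    rw [hseg, e3]
    ring
  rw [hval]
  refine tendsto_nhds_unique (h1.sub h2) ?_
  -- the entire part of the primitive does not contribute in the limit
  have hQlim : Tendsto (fun R : ℝ => Q ((c + ε * Complex.I) + R * (-1)) -
      Q ((c - ε * Complex.I) + R * (-1))) atTop (𝓝 0) := by
    set D := 1 + Real.exp (γ * ε ^ 2 / 2 + u ^ 2 / (2 * γ)) with hD
    have hlim : Tendsto (fun R : ℝ => D * (R - c)⁻¹ * (2 * ε)) atTop (𝓝 0) := by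
      have := ((tendsto_atTop_add_const_right atTop (-c) tendsto_id).inv_tendsto_atTop.const_mul
        D).mul_const (2 * ε)
      simpa [sub_eq_add_neg] using this
    refine squeeze_zero_norm' ?_ hlim
    filter_upwards [eventually_gt_atTop c] with R hR
    have hR' : 0 < R - c := by linarith
    have hn : ‖((c + ε * Complex.I) + R * (-1)) - ((c - ε * Complex.I) + R * (-1))‖ = 2 * ε := by
      rw [show ((c + ε * Complex.I) + R * (-1)) - ((c - ε * Complex.I) + R * (-1)) =
        ((2 * ε : ℝ) : ℂ) * Complex.I by push_cast; ring, norm_mul, Complex.norm_I, mul_one,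
        Complex.norm_real, Real.norm_of_nonneg (by positivity)]
    rw [← hn]
    refine (convex_segment ((c - ε * Complex.I) + R * (-1) : ℂ)
      ((c + ε * Complex.I) + R * (-1))).norm_image_sub_le_of_norm_hasDerivWithin_le (𝕜 := ℂ)
      (fun z _ => (hQ z).hasDerivWithinAt) (fun z hz => ?_)
      (left_mem_segment _ _ _) (right_mem_segment _ _ _)
    obtain ⟨s, t, hs, ht, hst, rfl⟩ := hz
    set z := s • ((c - ε * Complex.I) + R * (-1) : ℂ) + t • ((c + ε * Complex.I) + R * (-1))
      with hz
    have hS : s = 1 - t := by linarith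
    have hre : z.re = -(R - c) := by
      rw [hz]; simp; rw [hS]; ring
    have him : z.im = (t - s) * ε := by
      rw [hz]; simp; ring
    have hz0 : z ≠ 0 := by
      intro h0; rw [h0] at hre; simp at hre; linarith
    have him2 : z.im ^ 2 ≤ ε ^ 2 := by
      rw [him, mul_pow]
      have : (t - s) ^ 2 ≤ 1 := by rw [hS]; nlinarith
      nlinarith [sq_nonneg ε]
    have hzn : R - c ≤ ‖z‖ := by
      have := Complex.abs_re_le_norm z
      rwa [hre, abs_neg, abs_of_pos hR'] at this
    rw [hdsl z hz0, norm_mul, norm_inv, mul_comm]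
    gcongr
    refine (norm_sub_le _ _).trans ?_
    rw [norm_one, add_comm, hD, norm_gaussExp]
    refine add_le_add le_rfl (Real.exp_le_exp.2 ?_)
    have hsq : 0 ≤ (γ * z.re - u) ^ 2 / (2 * γ) := by positivity
    have hsq' : (γ * z.re - u) ^ 2 / (2 * γ) = γ * z.re ^ 2 / 2 - u * z.re + u ^ 2 / (2 * γ) := by
      field_simp; ring
    have : γ * z.im ^ 2 ≤ γ * ε ^ 2 := by gcongr
    linarith
  have hlog : Tendsto (fun R : ℝ => Complex.log ((c + ε * Complex.I) + R * (-1)) -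
      Complex.log ((c - ε * Complex.I) + R * (-1))) atTop (𝓝 (2 * (Real.pi : ℂ) * Complex.I)) := by
    have h := ((Complex.continuous_ofReal.tendsto _).comp
      (tendsto_arg_sub_real (c := c) hε)).const_mul (2 * Complex.I)
    rw [show 2 * Complex.I * (Real.pi : ℂ) = 2 * (Real.pi : ℂ) * Complex.I by ring] at h
    refine h.congr fun R => ?_
    have hconj : (c - ε * Complex.I) + R * (-1) =
        (starRingEnd ℂ) ((c : ℂ) + ε * Complex.I - R) := by
      simp; ring
    have hne : Complex.arg ((c : ℂ) + ε * Complex.I - R) ≠ Real.pi := by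
      intro h
      have := (Complex.arg_eq_pi_iff.1 h).2
      simp at this
      exact hε.ne' this
    rw [hconj, Complex.log_conj _ hne, show (c + ε * Complex.I) + R * (-1) =
      (c : ℂ) + ε * Complex.I - R by ring, Complex.sub_conj, Complex.log_im]
    simp only [Function.comp]
    push_cast
    ring
  have := hQlim.add hlog
  rw [zero_add] at this
  refine this.congr fun R => ?_
  simp only [hPdef]
  ring

/-- `(Γ(t + 1) - 1) / t`, that is, `Γ(t) - 1 / t` with the singularity at `0` removed. -/
def gammaRegular : ℂ → ℂ := dslope (fun t => Complex.Gamma (t + 1)) 0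

theorem gammaRegular_eq {t : ℂ} (ht : t ≠ 0) : gammaRegular t = Complex.Gamma t - t⁻¹ := by
  rw [gammaRegular, dslope_of_ne _ ht, slope_def_module, sub_zero, smul_eq_mul,
    Complex.Gamma_add_one t ht, zero_add, Complex.Gamma_one]
  field_simp

theorem differentiableAt_gammaRegular {z : ℂ} (hz : z - ((-1 : ℝ) : ℂ) ∈ Complex.slitPlane) :
    DifferentiableAt ℂ gammaRegular z := by
  have hopen : IsOpen {z : ℂ | z - ((-1 : ℝ) : ℂ) ∈ Complex.slitPlane} :=
    Complex.isOpen_slitPlane.preimage (by fun_prop)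
  have h0 : {z : ℂ | z - ((-1 : ℝ) : ℂ) ∈ Complex.slitPlane} ∈ 𝓝 (0 : ℂ) := by
    refine hopen.mem_nhds ?_
    show (0 : ℂ) - ((-1 : ℝ) : ℂ) ∈ Complex.slitPlane
    exact sub_mem_slitPlane_of_lt_re (by simp)
  have hd : DifferentiableOn ℂ (fun t => Complex.Gamma (t + 1))
      {z : ℂ | z - ((-1 : ℝ) : ℂ) ∈ Complex.slitPlane} := by
    intro w hw
    have hw : w - ((-1 : ℝ) : ℂ) ∈ Complex.slitPlane := hw
    have h : DifferentiableAt ℂ Complex.Gamma (w + 1) := by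
      refine Complex.differentiableAt_Gamma _ fun m hm => ?_
      have e : w - ((-1 : ℝ) : ℂ) = -m := by rw [← hm]; push_cast; ring
      rw [e, Complex.mem_slitPlane_iff] at hw
      rcases hw with hw | hw
      · simp at hw
        have : (0 : ℝ) ≤ m := Nat.cast_nonneg m
        linarith
      · simp at hw
    exact (h.comp (f := fun t : ℂ => t + 1) w (by fun_prop)).differentiableWithinAt
  exact (((Complex.differentiableOn_dslope h0).2 hd) z hz).differentiableAt (hopen.mem_nhds hz)

theorem exists_norm_gammaRegular_le {η : ℝ} (hη : 0 < η) :
    ∃ K B : ℝ, 0 ≤ K ∧ 0 ≤ B ∧ ∀ z : ℂ, z.re ≤ 0 → η ≤ |z.im| →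
      ‖gammaRegular z‖ ≤ B * Real.exp (K * -z.re) := by
  obtain ⟨K, hK, h⟩ := exists_norm_Gamma_le_exp hη
  refine ⟨K, Real.exp (2 * K) + η⁻¹, hK, by positivity, fun z hz hi => ?_⟩
  have hz0 : z ≠ 0 := by rintro rfl; simp at hi; linarith
  rw [gammaRegular_eq hz0, add_mul]
  refine (norm_sub_le _ _).trans (add_le_add ?_ ?_)
  · rw [← Real.exp_add]
    refine (h z (by linarith) hi).trans_eq ?_
    ring_nf
  · rw [norm_inv]
    calc ‖z‖⁻¹ ≤ η⁻¹ * 1 := by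
          rw [mul_one]; exact inv_anti₀ hη (hi.trans (Complex.abs_im_le_norm z))
      _ ≤ _ := by
          gcongr
          exact Real.one_le_exp (by nlinarith)

/-- Splitting off the residue at `0` leaves an integral over a wedge with vertex `-1/2`. -/
theorem hankelIntegral_gammaIntegrand_eq {c ε γ : ℝ} (hc : 0 < c) (hε : 0 < ε) (hγ : 0 < γ)
    (u : ℝ) :
    hankelIntegral c ε (gammaIntegrand γ u) = 2 * (Real.pi : ℂ) * Complex.I +
      wedgeIntegral ((-(1 / 2) : ℝ) : ℂ) (-4 - 3 * Complex.I) (-4 + 3 * Complex.I)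
        (fun t => gammaRegular t * gaussExp γ u t) := by
  have hdec₁ := decaysLeft_inv_mul_gaussExp hγ hε u
  have hdiff₁ := fun z => differentiableAt_inv_mul_gaussExp γ u (z := z)
  obtain ⟨K, B, -, -, hKB⟩ := exists_norm_gammaRegular_le hε
  have hdec₂ : DecaysLeft (fun t => gammaRegular t * gaussExp γ u t) (-(1 / 2)) ε :=
    decaysLeft_mul_exp hγ hKB u _
  have hdiff₂ : ∀ z : ℂ, z - ((-1 : ℝ) : ℂ) ∈ Complex.slitPlane →
      DifferentiableAt ℂ (fun t => gammaRegular t * gaussExp γ u t) z := fun z hz =>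
    (differentiableAt_gammaRegular hz).mul (differentiable_gaussExp γ u z)
  have hdec₃ := decaysLeft_gammaIntegrand hγ hε u 0
  have hdiff₃ := fun (z : ℂ) (hz : z - (0 : ℝ) ∈ Complex.slitPlane) =>
    differentiableAt_gammaIntegrand γ u hz
  have hrays : ∀ {f : ℂ → ℂ} {a p : ℝ}, DecaysLeft f a ε →
      (∀ z : ℂ, z - (p : ℂ) ∈ Complex.slitPlane → DifferentiableAt ℂ f z) → p < c →
      Integrable (fun r => f (hankelPath c ε r) * hankelVel ε r) ∧
      hankelIntegral c ε f = ∫ r, f (hankelPath c ε r) * hankelVel ε r := by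
    intro f a p hd hf hp
    refine hankelIntegral_eq hε ?_ ?_ (continuousOn_hankel_segment hf hp _)
    · have := hd.integrableOn_hankel (c := c) hf hε (σ := -1) (by simp)
      simpa [sub_eq_add_neg] using this
    · have := hd.integrableOn_hankel (c := c) hf hε (σ := 1) (by simp)
      simpa using this
  obtain ⟨i₁, v₁⟩ := hrays hdec₁ hdiff₁ hc
  obtain ⟨i₂, v₂⟩ := hrays hdec₂ hdiff₂ (by linarith)
  obtain ⟨i₃, v₃⟩ := hrays hdec₃ hdiff₃ hc
  rw [← hankelIntegral_gaussExp_div hc hε hγ u,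
    ← hankelIntegral_eq_wedgeIntegral (c := c) hdec₂ hdiff₂ (by norm_num) (by linarith) hε,
    v₁, v₂, v₃, ← integral_add i₁ i₂]
  congr 1
  ext r
  have hne : hankelPath c ε r ≠ 0 := by
    intro h0
    have hi := congrArg Complex.im h0
    have hr := congrArg Complex.re h0
    simp [hankelPath] at hi hr
    have hr0 : r = 0 := by
      rcases le_total r ε with h | h
      · rw [min_eq_left h] at hi
        rcases le_total (-ε) r with h' | h'
        · rwa [max_eq_right h'] at hi
        · rw [max_eq_left h'] at hi; linarith
      · rw [min_eq_right h, max_eq_right (by linarith)] at hi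
        linarith
    rw [hr0, abs_zero, max_eq_right (by linarith)] at hr
    linarith
  rw [gammaRegular_eq hne, gammaIntegrand, gaussExp]
  ring

theorem norm_rayIntegral_le {f : ℂ → ℂ} {a d : ℂ} {D : ℝ}
    (h : ∀ r : ℝ, 0 < r → ‖f (a + r * d)‖ ≤ D * Real.exp (-r)) :
    ‖rayIntegral a d f‖ ≤ D * ‖d‖ := by
  have h1 : ∫ r in Ioi (0 : ℝ), D * ‖d‖ * Real.exp (-r) = D * ‖d‖ := by
    rw [integral_const_mul, integral_exp_neg_Ioi_zero, mul_one]
  rw [← h1]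
  refine norm_integral_le_of_norm_le ((integrableOn_exp_neg_Ioi 0).const_mul _) ?_
  filter_upwards [ae_restrict_mem measurableSet_Ioi] with r hr
  rw [norm_mul, mul_right_comm]
  gcongr
  exact h r hr

theorem exists_norm_gammaRegular_wedge_le :
    ∃ K D : ℝ, 0 ≤ D ∧ ∀ σ : ℝ, |σ| = 1 → ∀ r : ℝ, 0 ≤ r →
      ‖gammaRegular (((-(1 / 2) : ℝ) : ℂ) + r * (-4 + 3 * σ * Complex.I))‖ ≤
        D * Real.exp (K * r) := by
  obtain ⟨K, B, hK, hB, h⟩ := exists_norm_gammaRegular_le one_pos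
  have hcpt : ∀ σ : ℝ, |σ| = 1 → ∃ D : ℝ, ∀ r ∈ Icc (0 : ℝ) 1,
      ‖gammaRegular (((-(1 / 2) : ℝ) : ℂ) + r * (-4 + 3 * σ * Complex.I))‖ ≤ D := by
    intro σ hσ
    have hσ0 : σ ≠ 0 := by rintro rfl; simp at hσ
    refine isCompact_Icc.exists_bound_of_continuousOn fun r hr => ?_
    refine ContinuousAt.continuousWithinAt (ContinuousAt.comp
      (f := fun r : ℝ => ((-(1 / 2) : ℝ) : ℂ) + r * (-4 + 3 * σ * Complex.I)) ?_ (by fun_prop))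
    exact (differentiableAt_gammaRegular
      (wedge_sub_mem_slitPlane (by norm_num) hσ0 hr.1)).continuousAt
  obtain ⟨D₁, h₁⟩ := hcpt 1 (by simp)
  obtain ⟨D₂, h₂⟩ := hcpt (-1) (by simp)
  refine ⟨4 * K, |D₁| + |D₂| + B * Real.exp (K / 2), by positivity, fun σ hσ r hr => ?_⟩
  have hexp : 1 ≤ Real.exp (4 * K * r) := Real.one_le_exp (by positivity)
  rcases le_total r 1 with hr1 | hr1
  · have hb : ‖gammaRegular (((-(1 / 2) : ℝ) : ℂ) + r * (-4 + 3 * σ * Complex.I))‖ ≤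
        |D₁| + |D₂| := by
      rcases (abs_eq (zero_le_one' ℝ)).1 hσ with rfl | rfl
      · exact (h₁ r ⟨hr, hr1⟩).trans ((le_abs_self _).trans (by linarith [abs_nonneg D₂]))
      · exact (h₂ r ⟨hr, hr1⟩).trans ((le_abs_self _).trans (by linarith [abs_nonneg D₁]))
    refine hb.trans ?_
    have h0 : 0 ≤ B * Real.exp (K / 2) := by positivity
    nlinarith [abs_nonneg D₁, abs_nonneg D₂]
  · have hre : (((-(1 / 2) : ℝ) : ℂ) + r * (-4 + 3 * σ * Complex.I)).re = -(1 / 2) - 4 * r := by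
      simp; ring
    have him : |(((-(1 / 2) : ℝ) : ℂ) + r * (-4 + 3 * σ * Complex.I)).im| = 3 * r := by
      simp [abs_mul, hσ, abs_of_nonneg hr]; ring
    refine (h _ (by rw [hre]; linarith) (by rw [him]; linarith)).trans ?_
    rw [hre, show K * -(-(1 / 2) - 4 * r) = K / 2 + 4 * K * r by ring, Real.exp_add, ← mul_assoc]
    gcongr
    linarith [abs_nonneg D₁, abs_nonneg D₂]

/-- At scale `√γ` the `t`-integral tends to its residue `1` at the origin. -/
theorem exists_norm_hankelIntegral_sub_one_le {c ε : ℝ} (hc : 0 < c) (hε : 0 < ε) (M : ℝ) :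
    ∃ D : ℝ, ∀ᶠ γ : ℝ in atTop, ∀ u : ℝ, -M ≤ u →
      ‖hankelIntegral c ε (gammaIntegrand γ (√γ * u)) / (2 * (Real.pi : ℂ) * Complex.I) - 1‖ ≤
        D * Real.exp (-(γ / 16)) := by
  obtain ⟨K, D, hD, h⟩ := exists_norm_gammaRegular_wedge_le
  have hN : (2 * (Real.pi : ℂ) * Complex.I) ≠ 0 := Complex.two_pi_I_ne_zero
  refine ⟨(D * ‖(-4 - 3 * Complex.I : ℂ)‖ + D * ‖(-4 + 3 * Complex.I : ℂ)‖) /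
    ‖2 * (Real.pi : ℂ) * Complex.I‖, ?_⟩
  filter_upwards [eventually_gt_atTop 0, eventually_ge_atTop (K + 1),
    Real.tendsto_sqrt_atTop.eventually (eventually_ge_atTop (16 * |M|))] with γ hγ hγK hq u hu
  rw [hankelIntegral_gammaIntegrand_eq hc hε hγ, add_div, div_self hN, add_sub_cancel_left,
    norm_div, div_mul_eq_mul_div]
  gcongr
  have hq2 : √γ * √γ = γ := Real.mul_self_sqrt hγ.le
  have hq0 : 0 ≤ √γ := Real.sqrt_nonneg γ
  have hray : ∀ σ : ℝ, |σ| = 1 → ‖rayIntegral ((-(1 / 2) : ℝ) : ℂ) (-4 + 3 * σ * Complex.I)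
      (fun t => gammaRegular t * gaussExp γ (√γ * u) t)‖ ≤
      D * Real.exp (-(γ / 16)) * ‖(-4 + 3 * σ * Complex.I : ℂ)‖ := by
    intro σ hσ
    refine norm_rayIntegral_le fun r hr => ?_
    have hσ2 : σ ^ 2 = 1 := by rw [← sq_abs, hσ, one_pow]
    have hre : (((-(1 / 2) : ℝ) : ℂ) + r * (-4 + 3 * σ * Complex.I)).re = -(1 / 2) - 4 * r := by
      simp; ring
    have him : (((-(1 / 2) : ℝ) : ℂ) + r * (-4 + 3 * σ * Complex.I)).im = 3 * σ * r := by
      simp; ring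
    rw [norm_mul, norm_gaussExp, hre, him]
    calc _ ≤ D * Real.exp (K * r) * Real.exp (-(γ * ((-(1 / 2) - 4 * r) ^ 2 - (3 * σ * r) ^ 2) / 2) +
          √γ * u * (-(1 / 2) - 4 * r)) := by
          gcongr
          exact h σ hσ r hr.le
      _ = D * Real.exp (K * r + (-(γ * ((-(1 / 2) - 4 * r) ^ 2 - (3 * σ * r) ^ 2) / 2) +
          √γ * u * (-(1 / 2) - 4 * r))) := by rw [mul_assoc, ← Real.exp_add]
      _ ≤ D * Real.exp (-(γ / 16) + -r) := by
          refine mul_le_mul_of_nonneg_left (Real.exp_le_exp.2 ?_) hD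
          have e1 : (-(1 / 2) - 4 * r) ^ 2 - (3 * σ * r) ^ 2 = 1 / 4 + 4 * r + 7 * r ^ 2 := by
            linear_combination -9 * r ^ 2 * hσ2
          -- `√γ ≥ 16 |M|` makes the linear term small against `γ (Re t)² / 2 ≥ γ / 8`
          have e2 : √γ * u * (-(1 / 2) - 4 * r) ≤ γ / 16 * (1 / 2 + 4 * r) := by
            have h3 : -u ≤ |M| := by linarith [le_abs_self M]
            have h4 : √γ * -u ≤ γ / 16 := by
              calc √γ * -u ≤ √γ * |M| := by gcongr
                _ ≤ √γ * (√γ / 16) := by gcongr; linarith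
                _ = γ / 16 := by rw [mul_div_assoc', hq2]
            nlinarith
          rw [e1]
          have h5 : K * r ≤ (γ - 1) * r := by gcongr; linarith
          nlinarith [mul_pos hγ hr, mul_nonneg hγ.le (sq_nonneg r)]
      _ = _ := by rw [Real.exp_add, ← mul_assoc]
  have h1 := hray 1 (by simp)
  have h2 := hray (-1) (by simp)
  have e1 : (-4 + 3 * ((1 : ℝ) : ℂ) * Complex.I) = -4 + 3 * Complex.I := by push_cast; ring
  have e2 : (-4 + 3 * ((-1 : ℝ) : ℂ) * Complex.I) = -4 - 3 * Complex.I := by push_cast; ring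
  rw [e1] at h1
  rw [e2] at h2
  unfold wedgeIntegral
  refine (norm_add_le _ _).trans ?_
  rw [norm_neg]
  refine (add_le_add h2 h1).trans_eq ?_
  ring

/-- The density of the `s`-integral at scale `√γ` on the line `Re w = 1`, `w = √γ s`. -/
def gaussDensity (γ v : ℝ) : ℂ :=
  (1 + v * Complex.I) * (Complex.Gamma (1 + (1 + v * Complex.I) / √γ))⁻¹ *
    Complex.exp ((1 + v * Complex.I) ^ 2 / 2) / (2 * Real.pi)

/-- The limit of `gaussDensity`. -/
def gaussDensityLimit (v : ℝ) : ℂ :=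
  (1 + v * Complex.I) * Complex.exp ((1 + v * Complex.I) ^ 2 / 2) / (2 * Real.pi)

/-- Substituting `s = w / √γ`; the line `Re s = 1` is first moved to `Re s = 1 / √γ`. -/
theorem verticalIntegral_eq_gaussDensity {γ : ℝ} (hγ : 1 ≤ γ) (u : ℝ) :
    (γ : ℂ) * (verticalIntegral 1 (gammaInvIntegrand γ (√γ * u)) /
        (2 * (Real.pi : ℂ) * Complex.I)) =
      ∫ v, gaussDensity γ v * Complex.exp (-(u * (1 + v * Complex.I))) := by
  have hγ0 : 0 < γ := by linarith
  have hq : 0 < √γ := Real.sqrt_pos.2 hγ0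
  have hq1 : 1 ≤ √γ := Real.one_le_sqrt.2 hγ
  have hqC : ((√γ : ℝ) : ℂ) ≠ 0 := by exact_mod_cast hq.ne'
  have hq2 : ((√γ : ℝ) : ℂ) * (√γ : ℝ) = γ := by rw [← Complex.ofReal_mul, Real.mul_self_sqrt hγ0.le]
  obtain ⟨C, hC⟩ := exists_norm_gammaInvIntegrand_le hγ0 (√γ * u) 1
  have hshift := verticalIntegral_eq_of_le (differentiable_gammaInvIntegrand γ (√γ * u))
    (α := 1 / √γ) (β := 1) (C := C) (by rw [div_le_one hq]; exact hq1)
    (fun z h1 h2 => hC z (le_trans (by positivity) h1) h2)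
  rw [← hshift, verticalIntegral]
  rw [one_div]
  have hval := integral_eq_inv_mul_integral_comp hq fun v : ℝ =>
    gammaInvIntegrand γ (√γ * u) (((√γ)⁻¹ : ℝ) + v * Complex.I) * Complex.I
  rw [hval, ← integral_const_mul, ← integral_div, ← integral_const_mul]
  congr 1
  ext v
  have hs : ((((√γ)⁻¹ : ℝ) : ℂ) + (((√γ)⁻¹ * v : ℝ) : ℂ) * Complex.I) =
      (1 + v * Complex.I) / (√γ : ℝ) := by push_cast; field_simp
  rw [hs, gammaInvIntegrand, gaussDensity]
  generalize (1 + (v : ℂ) * Complex.I) = w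
  rw [Complex.one_div_Gamma_eq_self_mul_one_div_Gamma_add_one, add_comm (w / _) 1]
  have he : (γ : ℂ) * (w / (√γ : ℝ)) ^ 2 / 2 - ((√γ * u : ℝ) : ℂ) * (w / (√γ : ℝ)) =
      w ^ 2 / 2 + -(u * w) := by
    rw [← hq2]
    push_cast
    field_simp
    ring
  rw [he, Complex.exp_add, ← hq2]
  have hI := Complex.I_ne_zero
  have hpi : (Real.pi : ℂ) ≠ 0 := by exact_mod_cast Real.pi_ne_zero
  push_cast
  field_simp

theorem one_le_norm_two_pi : 1 ≤ ‖(2 * (Real.pi : ℂ))‖ := by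
  rw [show (2 * (Real.pi : ℂ)) = ((2 * Real.pi : ℝ) : ℂ) by push_cast; ring,
    Complex.norm_real, Real.norm_of_nonneg (by positivity)]
  linarith [Real.pi_gt_three]

theorem norm_one_add_mul_I_le (v : ℝ) : ‖1 + (v : ℂ) * Complex.I‖ ≤ Real.exp |v| := by
  refine (norm_add_le _ _).trans ?_
  rw [norm_one, norm_mul, Complex.norm_I, mul_one, Complex.norm_real, Real.norm_eq_abs, add_comm]
  exact Real.add_one_le_exp _

theorem norm_exp_sq_half (v : ℝ) :
    ‖Complex.exp ((1 + (v : ℂ) * Complex.I) ^ 2 / 2)‖ = Real.exp ((1 - v ^ 2) / 2) := by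
  have := norm_exp_sq 1 0 (1 + v * Complex.I)
  simpa using this

/-- Undoing the separation removes the integral over `l` and leaves a Gaussian integral. -/
theorem integral_gaussDensityLimit (y : ℝ) :
    ∫ l in Ioi (0 : ℝ), (∫ v, gaussDensityLimit v *
        Complex.exp (-(((y + l : ℝ) : ℂ) * (1 + v * Complex.I)))) * 1 =
      ((1 / √(2 * Real.pi) * Real.exp (-(y ^ 2) / 2) : ℝ) : ℂ) := by
  set φ : ℝ → ℂ := fun v => gaussDensityLimit v * Complex.exp (-(y * (1 + v * Complex.I))) with hφ
  set ψ : ℝ → ℂ := indicator (Ioc (0 : ℝ) 1) 1 with hψ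
  have hψint : ∫ r, ψ r = 1 := by
    rw [hψ, integral_indicator measurableSet_Ioc]
    simp
  have iψ : Integrable ψ := by
    rw [hψ, integrable_indicator_iff measurableSet_Ioc]
    exact integrableOn_const (by simp)
  have iφ : Integrable φ := by
    refine integrable_of_norm_le_exp_neg_abs (C := Real.exp (1 / 2 + 2 + |y|)) ?_ fun v => ?_
    · rw [hφ]
      unfold gaussDensityLimit
      fun_prop
    · rw [hφ]
      simp only [gaussDensityLimit]
      rw [norm_mul, norm_div, norm_mul, norm_exp_sq_half, Complex.norm_exp]
      have hre : (-((y : ℂ) * (1 + v * Complex.I))).re = -y := by simp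
      rw [hre]
      calc _ ≤ Real.exp |v| * Real.exp ((1 - v ^ 2) / 2) * Real.exp |y| := by
            gcongr
            · refine (div_le_self (by positivity) one_le_norm_two_pi).trans ?_
              gcongr
              exact norm_one_add_mul_I_le v
            · exact neg_le_abs y
        _ = Real.exp (|v| + (1 - v ^ 2) / 2 + |y|) := by rw [Real.exp_add, Real.exp_add]
        _ ≤ Real.exp (1 / 2 + 2 + |y| + -|v|) := by
            refine Real.exp_le_exp.2 ?_
            rw [← sq_abs v]
            nlinarith [sq_nonneg (|v| - 2)]
        _ = _ := by rw [Real.exp_add]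
  -- the factor `1` is written as the integral of `ψ` over a `t`-contour shrunk to the point `0`
  have h := (integral_integral_div_sub (s := fun v : ℝ => 1 + v * Complex.I)
    (t := fun _ => (0 : ℂ)) (σ := 1) (τ := 0) iφ iψ (by fun_prop) measurable_const (by norm_num)
    (fun v => by simp) (fun _ => by simp)).2
  have e1 : ∀ l : ℝ, (∫ v, φ v * Complex.exp (-(l * (1 + v * Complex.I)))) =
      ∫ v, gaussDensityLimit v * Complex.exp (-(((y + l : ℝ) : ℂ) * (1 + v * Complex.I))) := by
    intro l
    congr 1
    ext v
    simp only [hφ]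
    rw [mul_assoc, ← Complex.exp_add]
    congr 2
    push_cast
    ring
  simp only [mul_zero, Complex.exp_zero, mul_one, hψint, sub_zero, e1, integral_div] at h
  simp only [mul_one]
  rw [← h]
  have e2 : ∀ v : ℝ, φ v * (1 / (1 + v * Complex.I)) = (2 * Real.pi : ℂ)⁻¹ *
      Complex.exp (-(1 / 2) * (v : ℂ) ^ 2 + Complex.I * (1 - y) * v + (1 / 2 - y)) := by
    intro v
    have hne : 1 + (v : ℂ) * Complex.I ≠ 0 := by
      intro h0
      have := congrArg Complex.re h0
      simp at this
    simp only [hφ, gaussDensityLimit]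
    have : -(1 / 2) * (v : ℂ) ^ 2 + Complex.I * (1 - y) * v + (1 / 2 - y) =
        (1 + v * Complex.I) ^ 2 / 2 + -(y * (1 + v * Complex.I)) := by
      linear_combination (-(v : ℂ) ^ 2 / 2) * Complex.I_sq
    rw [this, Complex.exp_add]
    field_simp
  have e3 : ∀ v : ℝ, (∫ r, ψ r / (1 + (v : ℂ) * Complex.I)) = 1 / (1 + v * Complex.I) := by
    intro v; rw [integral_div, hψint]
  simp only [e2, integral_const_mul] at h ⊢
  rw [integral_cexp_quadratic (by norm_num)]
  have e4 : (1 / 2 - (y : ℂ)) - (Complex.I * (1 - y)) ^ 2 / (4 * -(1 / 2)) =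
      ((-(y ^ 2) / 2 : ℝ) : ℂ) := by
    push_cast
    linear_combination ((1 - (y : ℂ)) ^ 2 / 2) * Complex.I_sq
  have e5 : ((Real.pi : ℂ) / -(-(1 / 2))) ^ (1 / 2 : ℂ) = ((√(2 * Real.pi) : ℝ) : ℂ) := by
    rw [Real.sqrt_eq_rpow, Complex.ofReal_cpow (by positivity)]
    push_cast
    congr 1
    ring
  rw [e4, e5, ← Complex.ofReal_exp]
  have hs : √(2 * Real.pi) * √(2 * Real.pi) = 2 * Real.pi :=
    Real.mul_self_sqrt (by positivity)
  have hs0 : √(2 * Real.pi) ≠ 0 := by positivity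
  rw [show (2 * (Real.pi : ℂ))⁻¹ = (((2 * Real.pi)⁻¹ : ℝ) : ℂ) by push_cast; ring,
    ← Complex.ofReal_mul, ← Complex.ofReal_mul]
  congr 1
  rw [show (2 * Real.pi)⁻¹ = (√(2 * Real.pi) * √(2 * Real.pi))⁻¹ by rw [hs], mul_inv]
  generalize √(2 * Real.pi) = q at hs0
  field_simp

theorem measurable_gaussDensity (γ : ℝ) : Measurable (gaussDensity γ) := by
  have := Complex.differentiable_one_div_Gamma.continuous.measurable
  have h : Measurable fun v : ℝ => (Complex.Gamma (1 + (1 + v * Complex.I) / √γ))⁻¹ :=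
    this.comp (by fun_prop)
  unfold gaussDensity
  fun_prop

theorem tendsto_gaussDensity (v : ℝ) :
    Tendsto (fun γ => gaussDensity γ v) atTop (𝓝 (gaussDensityLimit v)) := by
  have h0 : Tendsto (fun γ : ℝ => ((√γ)⁻¹ : ℝ)) atTop (𝓝 0) :=
    Real.tendsto_sqrt_atTop.inv_tendsto_atTop
  have h1 : Tendsto (fun γ : ℝ => 1 + (1 + v * Complex.I) * (((√γ)⁻¹ : ℝ) : ℂ)) atTop (𝓝 1) := by
    have := (((Complex.continuous_ofReal.tendsto 0).comp h0).const_mul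
      (1 + v * Complex.I)).const_add 1
    simpa using this
  have h2 := (Complex.differentiable_one_div_Gamma.continuous.tendsto 1).comp h1
  rw [Complex.Gamma_one, inv_one] at h2
  have h3 := ((h2.const_mul (1 + v * Complex.I)).mul_const
    (Complex.exp ((1 + v * Complex.I) ^ 2 / 2))).div_const (2 * (Real.pi : ℂ))
  rw [mul_one] at h3
  refine h3.congr fun γ => ?_
  simp [gaussDensity, div_eq_mul_inv]

/-- The Gaussian beats the factor `1 / Γ`, uniformly in `γ ≥ 1`. -/
theorem exists_norm_gaussDensity_le : ∃ D : ℝ,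
    (∀ γ : ℝ, 1 ≤ γ → ∀ v, ‖gaussDensity γ v‖ ≤ D * Real.exp (-|v|)) ∧
      ∀ v, ‖gaussDensityLimit v‖ ≤ D * Real.exp (-|v|) := by
  obtain ⟨C, hC, h⟩ := exists_norm_inv_Gamma_le 2
  have key : ∀ (q : ℂ) (v : ℝ), ‖q‖ ≤ (C + 1) * Real.exp (2 * |v|) →
      ‖(1 + v * Complex.I) * q * Complex.exp ((1 + v * Complex.I) ^ 2 / 2) / (2 * Real.pi)‖ ≤
        (C + 1) * Real.exp (1 / 2 + 8) * Real.exp (-|v|) := by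
    intro q v hq
    rw [norm_div, norm_mul, norm_mul, norm_exp_sq_half]
    calc _ ≤ Real.exp |v| * ((C + 1) * Real.exp (2 * |v|)) * Real.exp ((1 - v ^ 2) / 2) := by
          refine (div_le_self (by positivity) one_le_norm_two_pi).trans ?_
          gcongr
          exact norm_one_add_mul_I_le v
      _ = (C + 1) * Real.exp (|v| + 2 * |v| + (1 - v ^ 2) / 2) := by
          rw [Real.exp_add, Real.exp_add]; ring
      _ ≤ (C + 1) * Real.exp (1 / 2 + 8 + -|v|) := by
          refine mul_le_mul_of_nonneg_left (Real.exp_le_exp.2 ?_) (by positivity)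
          rw [← sq_abs v]
          nlinarith [sq_nonneg (|v| - 4)]
      _ = _ := by rw [Real.exp_add, mul_assoc]
  refine ⟨(C + 1) * Real.exp (1 / 2 + 8), fun γ hγ v => key _ v ?_, fun v => ?_⟩
  · have hq1 : 1 ≤ √γ := Real.one_le_sqrt.2 hγ
    have hz : (1 : ℂ) + (1 + v * Complex.I) / (√γ : ℝ) =
        ((1 + 1 / √γ : ℝ) : ℂ) + ((v / √γ : ℝ) : ℂ) * Complex.I := by
      push_cast; ring
    have hdiv : 1 / √γ ≤ 1 := by rw [div_le_one (by linarith)]; exact hq1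
    have h0 : 0 ≤ 1 / √γ := by positivity
    have hre : ((1 : ℂ) + (1 + v * Complex.I) / (√γ : ℝ)).re = 1 + 1 / √γ := by rw [hz]; simp
    have him : ((1 : ℂ) + (1 + v * Complex.I) / (√γ : ℝ)).im = v / √γ := by rw [hz]; simp
    have := h _ (by rw [hre]; linarith) (by rw [hre]; linarith)
    rw [him] at this
    refine this.trans ?_
    have : |v / √γ| ≤ |v| := by
      rw [abs_div, abs_of_pos (show 0 < √γ by linarith)]
      exact div_le_self (abs_nonneg _) hq1
    gcongr
    linarith
  · have := key 1 v (by
      rw [norm_one]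
      have := Real.one_le_exp (show 0 ≤ 2 * |v| by positivity)
      nlinarith)
    simpa [gaussDensityLimit] using this

theorem measurable_hankelIntegral_gammaIntegrand {c ε γ : ℝ} (hc : 0 < c) (hε : 0 < ε) (hγ : 0 < γ)
    (q : ℝ) : Measurable fun u : ℝ => hankelIntegral c ε (gammaIntegrand γ (q * u)) := by
  have hf : ∀ (u : ℝ) (z : ℂ), z - (0 : ℝ) ∈ Complex.slitPlane →
      DifferentiableAt ℂ (gammaIntegrand γ u) z :=
    fun u z hz => differentiableAt_gammaIntegrand γ u hz
  have e : ∀ u : ℝ, hankelIntegral c ε (gammaIntegrand γ (q * u)) =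
      ∫ r, (gammaIntegrand γ 0 (hankelPath c ε r) * hankelVel ε r) *
        Complex.exp (-(u * (-(q * hankelPath c ε r)))) := by
    intro u
    have hd := decaysLeft_gammaIntegrand hγ hε (q * u) 0
    have i₁ := hd.integrableOn_hankel (c := c) (hf _) hε (σ := -1) (by simp)
    have i₂ := hd.integrableOn_hankel (c := c) (hf _) hε (σ := 1) (by simp)
    simp only [Complex.ofReal_one, Complex.ofReal_neg, neg_mul, one_mul, ← sub_eq_add_neg]
      at i₁ i₂
    rw [(hankelIntegral_eq hε i₁ i₂ (continuousOn_hankel_segment (hf _) hc _)).2]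
    congr 1
    ext r
    simp only [gammaIntegrand]
    rw [show -((γ : ℂ) * hankelPath c ε r ^ 2 / 2) + ((q * u : ℝ) : ℂ) * hankelPath c ε r =
      (-(γ * hankelPath c ε r ^ 2 / 2) + ((0 : ℝ) : ℂ) * hankelPath c ε r) +
        -(u * -(q * hankelPath c ε r)) by push_cast; ring, Complex.exp_add]
    ring
  simp only [e]
  have hp := measurable_hankelPath c ε
  have hv : Measurable (hankelVel ε) :=
    Measurable.ite measurableSet_Iic measurable_const
      (Measurable.ite measurableSet_Iic measurable_const measurable_const)
  have hΓ := measurable_Gamma.comp hp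
  refine measurable_laplace ?_ (by fun_prop)
  unfold gammaIntegrand
  have h2 : Measurable fun r => Complex.Gamma (hankelPath c ε r) := hΓ
  fun_prop

theorem tendstoUniformlyOn_Kcrit_gaussian {c ε : ℝ} (hc₀ : 0 < c) (hc₁ : c < 1) (hε : 0 < ε)
    {K : Set ℝ} (hK : IsCompact K) :
    TendstoUniformlyOn
      (fun (γ : ℝ) (p : ℝ × ℝ) => (√γ : ℂ) * Kcrit c ε (√γ * p.1) (√γ * p.2) γ)
      (fun p : ℝ × ℝ => ((1 / √(2 * Real.pi) * Real.exp (-(p.2 ^ 2) / 2) : ℝ) : ℂ))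
      atTop (K ×ˢ K) := by
  obtain ⟨M, hM⟩ := hK.isBounded.subset_closedBall 0
  rw [Real.closedBall_eq_Icc, zero_sub, zero_add] at hM
  obtain ⟨D, hD, hD₀⟩ := exists_norm_gaussDensity_le
  have hz : Measurable fun v : ℝ => 1 + (v : ℂ) * Complex.I := by fun_prop
  have hm₀ : Measurable gaussDensityLimit := by unfold gaussDensityLimit; fun_prop
  obtain ⟨C, δ, hδ, b₀, b⟩ := laplace_limit (L := atTop) (φ := gaussDensity)
    (φ₀ := gaussDensityLimit) (z := fun v => 1 + v * Complex.I) (g := fun v => D * Real.exp (-|v|))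
    (σ := 1) (M := M) (Eventually.of_forall measurable_gaussDensity) hm₀ hz (fun v => by simp)
    (integrable_exp_neg_abs.const_mul D)
    (by
      filter_upwards [eventually_ge_atTop 1] with γ hγ v
      simpa using hD γ hγ v)
    (fun v => by simpa using hD₀ v) tendsto_gaussDensity
  simp only [one_mul] at b₀ b
  obtain ⟨D', hD'⟩ := exists_norm_hankelIntegral_sub_one_le hc₀ hε M
  have hδ' : Tendsto (fun γ : ℝ => D' * Real.exp (-(γ / 16))) atTop (𝓝 0) := by
    have := (Real.tendsto_exp_neg_atTop_nhds_zero.comp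
      (tendsto_id.atTop_div_const (show (0 : ℝ) < 16 by norm_num))).const_mul D'
    simpa using this
  have key := tendstoUniformlyOn_separated (L := atTop)
    (F := fun γ u => ∫ v, gaussDensity γ v * Complex.exp (-(u * (1 + v * Complex.I))))
    (G := fun γ u => hankelIntegral c ε (gammaIntegrand γ (√γ * u)) / (2 * (Real.pi : ℂ) * Complex.I))
    (F₀ := fun u => ∫ v, gaussDensityLimit v * Complex.exp (-(u * (1 + v * Complex.I))))
    (G₀ := fun _ => 1) (C' := 1) (M := M)
    (Eventually.of_forall fun γ => measurable_laplace (measurable_gaussDensity γ) hz)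
    (measurable_laplace hm₀ hz)
    (by
      filter_upwards [eventually_gt_atTop 0] with γ hγ
      exact (measurable_hankelIntegral_gammaIntegrand hc₀ hε hγ _).div_const _)
    measurable_const b₀ (fun u _ => by simp) hδ hδ' b hD'
  have key' := key.mono (prod_mono hM hM)
  have hval : EqOn (fun p : ℝ × ℝ => ∫ l in Ioi (0 : ℝ), (∫ v, gaussDensityLimit v *
      Complex.exp (-(((p.2 + l : ℝ) : ℂ) * (1 + v * Complex.I)))) * 1)
      (fun p : ℝ × ℝ => ((1 / √(2 * Real.pi) * Real.exp (-(p.2 ^ 2) / 2) : ℝ) : ℂ)) (K ×ˢ K) :=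
    fun p _ => integral_gaussDensityLimit p.2
  refine (key'.congr_right hval).congr ?_
  filter_upwards [eventually_ge_atTop 1] with γ hγ p _
  have hγ0 : 0 < γ := by linarith
  have h := Kcrit_scaled_eq_integral hc₀ hc₁ hε hγ0 (Real.sqrt_pos.2 hγ0) 0 p.1 p.2
  simp only [zero_add] at h
  simp only
  rw [h, ← mul_assoc, ← Complex.ofReal_mul, Real.mul_self_sqrt hγ0.le, ← integral_const_mul]
  congr 1
  ext l
  rw [← verticalIntegral_eq_gaussDensity hγ]
  ring

/-! ### The Airy limit -/

section Saddle

variable {ι : Type*} {L : Filter ι} [L.NeBot] {t k : ι → ℝ}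

/-- Near a double critical point only the cubic term survives at the scale `1 / k` with
`k³ ~ f'''(t₀) / 2 = ∑ j, 1 / (t₀ + j)³`. -/
theorem tendsto_saddleRatio (ht : ∀ᶠ i in L, 0 < t i) (hk : ∀ᶠ i in L, 0 < k i)
    (hkt : Tendsto (fun i => k i * t i) L atTop)
    (hS : Tendsto (fun i => recipPowSum 3 (t i) / k i ^ 3) L (𝓝 1)) (s : ℂ) :
    Tendsto (fun i => saddleRatio (t i) (s / k i)) L (𝓝 (Complex.exp (s ^ 3 / 3))) := by
  have hex : ∀ᶠ i in L, ∃ e : ℂ, ‖e‖ ≤ ‖s‖ ^ 4 * (recipPowSum 3 (t i) / k i ^ 3) / (k i * t i) ∧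
      saddleRatio (t i) (s / k i) =
        Complex.exp (s ^ 3 / 3 * ((recipPowSum 3 (t i) / k i ^ 3 : ℝ) : ℂ) + e) := by
    filter_upwards [ht, hk, hkt.eventually (eventually_ge_atTop (2 * ‖s‖))] with i h1 h2 h3
    have hn : ‖s / (k i : ℂ)‖ = ‖s‖ / k i := by
      rw [norm_div, Complex.norm_real, Real.norm_of_nonneg h2.le]
    obtain ⟨e, he, h⟩ := exists_saddleRatio_eq_exp h1 (w := s / k i) (by
      rw [hn, div_le_iff₀ h2]; linarith)
    refine ⟨e, he.trans ?_, ?_⟩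
    · rw [hn]
      calc (‖s‖ / k i) ^ 4 * recipPowSum 4 (t i)
          ≤ (‖s‖ / k i) ^ 4 * (1 / t i * recipPowSum 3 (t i)) := by
            gcongr
            exact recipPowSum_four_le h1
        _ = _ := by field_simp
    · rw [h]
      congr 2
      push_cast
      ring
  obtain ⟨e, he⟩ := hex.choice
  have he0 : Tendsto e L (𝓝 0) := by
    refine squeeze_zero_norm' (he.mono fun i h => h.1) ?_
    have := (hS.const_mul (‖s‖ ^ 4)).mul hkt.inv_tendsto_atTop
    rw [mul_zero] at this
    exact this
  have h1 := ((((Complex.continuous_ofReal.tendsto 1).comp hS).const_mul (s ^ 3 / 3)).add he0)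
  have h2 := (Complex.continuous_exp.tendsto _).comp h1
  rw [Complex.ofReal_one, mul_one, add_zero] at h2
  refine h2.congr' ?_
  filter_upwards [he] with i hi
  rw [hi.2]
  rfl

end Saddle

theorem measurable_saddleRatio (t : ℝ) : Measurable (saddleRatio t) := by
  have h : Measurable fun w : ℂ => Complex.Gamma (t + w) := measurable_Gamma.comp (by fun_prop)
  unfold saddleRatio
  fun_prop

/-- The density of the rescaled `s`-integral at the double critical point. -/
def saddleDensityRight (t k v : ℝ) : ℂ :=
  saddleRatio t ((1 + v * Complex.I) / k) / (2 * Real.pi)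

/-- The limit of `saddleDensityRight`. -/
def airyDensityRight (v : ℝ) : ℂ :=
  Complex.exp ((1 + v * Complex.I) ^ 3 / 3) / (2 * Real.pi)

/-- The wedge for the `t`-integral, relative to the double critical point. -/
def leftPath (r : ℝ) : ℂ := wedgePath 0 (-4 - 3 * Complex.I) (-4 + 3 * Complex.I) r

/-- The velocity of `leftPath`. -/
def leftVel (r : ℝ) : ℂ := wedgeVel (-4 - 3 * Complex.I) (-4 + 3 * Complex.I) r

/-- The density of the rescaled `t`-integral at the double critical point. -/
def saddleDensityLeft (t k r : ℝ) : ℂ :=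
  (saddleRatio t (leftPath r / k))⁻¹ * leftVel r / (2 * (Real.pi : ℂ) * Complex.I)

/-- The limit of `saddleDensityLeft`. -/
def airyDensityLeft (r : ℝ) : ℂ :=
  (Complex.exp (leftPath r ^ 3 / 3))⁻¹ * leftVel r / (2 * (Real.pi : ℂ) * Complex.I)

theorem leftPath_eq (r : ℝ) :
    ∃ σ : ℝ, |σ| = 1 ∧ leftPath r = (|r| : ℝ) * (-4 + 3 * σ * Complex.I) := by
  unfold leftPath wedgePath
  split_ifs with h
  · refine ⟨-1, by simp, ?_⟩
    rw [abs_of_nonpos h]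
    push_cast
    ring
  · refine ⟨1, by simp, ?_⟩
    rw [abs_of_pos (not_le.1 h)]
    push_cast
    ring

theorem re_leftPath (r : ℝ) : (leftPath r).re = -4 * |r| := by
  obtain ⟨σ, -, h⟩ := leftPath_eq r
  rw [h]
  simp
  ring

theorem norm_leftVel_le (r : ℝ) : ‖leftVel r‖ ≤ 7 := by
  have h : ∀ σ : ℝ, |σ| = 1 → ‖(-4 + 3 * σ * Complex.I : ℂ)‖ ≤ 7 := by
    intro σ hσ
    refine (norm_add_le _ _).trans ?_
    rw [norm_mul, norm_mul, Complex.norm_real, Real.norm_eq_abs, hσ]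
    norm_num
  unfold leftVel wedgeVel
  split_ifs
  · rw [norm_neg]
    simpa [sub_eq_add_neg] using h (-1) (by simp)
  · simpa using h 1 (by simp)

theorem measurable_leftPath : Measurable leftPath := measurable_wedgePath _ _ _

theorem measurable_leftVel : Measurable leftVel := measurable_wedgeVel _ _

theorem norm_saddleDensityRight_le {t k : ℝ} (ht : 0 < t) (hk : 0 < k) (hkt : 1 ≤ k * t)
    (hS : 1 / 2 ≤ recipPowSum 3 t / k ^ 3) (h1 : ‖saddleRatio t (1 / k)‖ ≤ 2) (v : ℝ) :
    ‖saddleDensityRight t k v‖ ≤ 2 * Real.exp 2 * Real.exp (-|v|) := by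
  have e : (1 + v * Complex.I) / k = ((1 / k : ℝ) : ℂ) + ((v / k : ℝ) : ℂ) * Complex.I := by
    push_cast; ring
  have h := norm_saddleRatio_vertical_le ht (a := 1 / k) (by positivity)
    (by rw [div_le_iff₀ hk]; linarith) (v / k)
  rw [← e] at h
  rw [saddleDensityRight, norm_div, mul_assoc, ← Real.exp_add]
  refine (div_le_self (norm_nonneg _) one_le_norm_two_pi).trans (h.trans ?_)
  have e2 : 1 / k * (v / k) ^ 2 / 4 * recipPowSum 3 t =
      v ^ 2 / 4 * (recipPowSum 3 t / k ^ 3) := by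
    field_simp
  rw [e2]
  gcongr
  · simpa using h1
  · have : v ^ 2 / 4 * (1 / 2) ≤ v ^ 2 / 4 * (recipPowSum 3 t / k ^ 3) := by gcongr
    rw [← sq_abs v] at this ⊢
    nlinarith [sq_nonneg (|v| - 4)]

theorem norm_saddleDensityLeft_le {t k : ℝ} (ht : 0 < t) (hk : 0 < k) (hkt : 1 ≤ k * t)
    (hS : 1 / 2 ≤ recipPowSum 3 t / k ^ 3) (M r : ℝ) :
    ‖saddleDensityLeft t k r‖ * Real.exp (M * (4 * |r|)) ≤
      7 * Real.exp ((4 * |M| + 5 / 4) ^ 2) * Real.exp (-|r|) := by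
  obtain ⟨σ, hσ, hp⟩ := leftPath_eq r
  set ρ := |r| with hρ
  have hρ0 : 0 ≤ ρ := abs_nonneg r
  have h := exp_le_norm_saddleRatio ht (ρ := ρ / k) (by positivity) hσ
  have e : ((ρ / k : ℝ) : ℂ) * (-4 + 3 * σ * Complex.I) = leftPath r / k := by
    rw [hp]; push_cast; ring
  rw [e] at h
  have e2 : (ρ / k) ^ 3 / (1 + ρ / k / t) / 2 * recipPowSum 3 t =
      ρ ^ 3 / (1 + ρ / (k * t)) / 2 * (recipPowSum 3 t / k ^ 3) := by
    field_simp
  have hlow : (ρ ^ 2 - ρ) / 4 ≤ (ρ / k) ^ 3 / (1 + ρ / k / t) / 2 * recipPowSum 3 t := by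
    rw [e2]
    -- `ρ² - ρ ≤ ρ³ / (1 + ρ)`: the growth is quadratic, so it also beats `e^{4 M ρ}`
    calc (ρ ^ 2 - ρ) / 4 ≤ ρ ^ 3 / (1 + ρ) / 4 := by
          gcongr
          rw [le_div_iff₀ (by positivity)]
          nlinarith
      _ = ρ ^ 3 / (1 + ρ) / 2 * (1 / 2) := by ring
      _ ≤ _ := by
          gcongr
          exact div_le_self hρ0 hkt
  have hinv : ‖(saddleRatio t (leftPath r / k))⁻¹‖ ≤ Real.exp (-((ρ ^ 2 - ρ) / 4)) := by
    rw [norm_inv, Real.exp_neg]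
    gcongr
    exact (Real.exp_le_exp.2 hlow).trans h
  have hpi : 1 ≤ ‖(2 * (Real.pi : ℂ) * Complex.I)‖ := by
    rw [norm_mul, Complex.norm_I, mul_one]
    exact one_le_norm_two_pi
  rw [saddleDensityLeft, norm_div, norm_mul]
  calc _ ≤ (Real.exp (-((ρ ^ 2 - ρ) / 4)) * 7) * Real.exp (M * (4 * ρ)) := by
        gcongr
        refine (div_le_self (by positivity) hpi).trans ?_
        gcongr
        exact norm_leftVel_le r
    _ = 7 * Real.exp (-((ρ ^ 2 - ρ) / 4) + M * (4 * ρ)) := by rw [Real.exp_add]; ring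
    _ ≤ 7 * Real.exp ((4 * |M| + 5 / 4) ^ 2 + -ρ) := by
        refine mul_le_mul_of_nonneg_left (Real.exp_le_exp.2 ?_) (by norm_num)
        have : M * ρ ≤ |M| * ρ := by gcongr; exact le_abs_self M
        nlinarith [sq_nonneg (ρ / 2 - (4 * |M| + 5 / 4))]
    _ = _ := by rw [Real.exp_add, mul_assoc]

theorem integral_airyDensityRight (u : ℝ) :
    ∫ v, airyDensityRight v * Complex.exp (-(u * (1 + v * Complex.I))) = airyFun u := by
  have hi : IntegrableOn (fun r : ℝ => airyIntegrand u (1 + r * -Complex.I)) (Ioi 0) ∧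
      IntegrableOn (fun r : ℝ => airyIntegrand u (1 + r * Complex.I)) (Ioi 0) := by
    obtain ⟨i₁, i₂, -⟩ := airy_wedge (u := u) (a := 1) (d₁ := -Complex.I) (d₂ := Complex.I) (b := 1)
      (r₀ := 0) one_pos (by simp) (by simp) (by simp) (by simp) (fun r hr => by simp; positivity)
    exact ⟨by simpa using i₁, by simpa using i₂⟩
  rw [airyFun, (wedgeIntegral_eq hi.1 hi.2).2, ← integral_div]
  congr 1
  ext v
  have e1 : wedgePath 1 (-Complex.I) Complex.I v = 1 + v * Complex.I := by
    unfold wedgePath; split_ifs <;> ring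
  have e2 : wedgeVel (-Complex.I) Complex.I v = Complex.I := by
    unfold wedgeVel; split_ifs <;> ring
  rw [e1, e2, airyIntegrand, airyDensityRight, sub_eq_add_neg, Complex.exp_add]
  have := Complex.I_ne_zero
  have hpi : (Real.pi : ℂ) ≠ 0 := by exact_mod_cast Real.pi_ne_zero
  field_simp

theorem integral_airyDensityLeft (u : ℝ) :
    ∫ r, airyDensityLeft r * Complex.exp (-(u * -leftPath r)) = airyFun u := by
  obtain ⟨i₁, i₂, e⟩ := airy_wedge (u := u) (a := 0) (d₁ := 4 - 3 * Complex.I)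
    (d₂ := 4 + 3 * Complex.I) (b := 3) (r₀ := 1) (by norm_num) (by simp) (by simp) (by simp)
    (fun r hr => by simp; linarith) (fun r hr => by simp; linarith)
  simp only [Complex.ofReal_zero] at i₁ i₂ e
  have hflip := wedgeIntegral_comp_neg (airyIntegrand u) 0 (-4 - 3 * Complex.I) (-4 + 3 * Complex.I)
  rw [show -(-4 + 3 * Complex.I) = 4 - 3 * Complex.I by ring,
    show -(-4 - 3 * Complex.I) = 4 + 3 * Complex.I by ring, e, neg_zero] at hflip
  rw [airyFun, ← hflip, (wedgeIntegral_eq (f := fun z => airyIntegrand u (-z)) ?_ ?_).2,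
    ← integral_div]
  · congr 1
    ext r
    change _ = airyIntegrand u (-leftPath r) * leftVel r / _
    rw [airyIntegrand, airyDensityLeft, sub_eq_add_neg, Complex.exp_add, ← Complex.exp_neg]
    ring_nf
  · refine i₂.congr_fun (fun r _ => ?_) measurableSet_Ioi
    simp only
    congr 1
    ring
  · refine i₁.congr_fun (fun r _ => ?_) measurableSet_Ioi
    simp only
    congr 1
    ring

/-- `e^{f(t)}`, with `f` as for `saddleRatio`, at the critical point `t`; it
cancels between the `s`- and the `t`-integral. -/
def criticalValue (t : ℝ) : ℂ :=
  Complex.exp (recipPowSum 2 t * t ^ 2 / 2 - (recipPowSum 2 t * t - digamma t : ℝ) * t) /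
    Complex.Gamma t

/-- Moving the line `Re s = 1` to `Re s = t + 1 / k` and substituting `s = t + w / k`. -/
theorem verticalIntegral_eq_saddle {t k : ℝ} (ht : 1 ≤ t) (hk : 0 < k) (u : ℝ) :
    verticalIntegral 1 (gammaInvIntegrand (recipPowSum 2 t)
        (recipPowSum 2 t * t - digamma t + k * u)) / (2 * (Real.pi : ℂ) * Complex.I) =
      criticalValue t * Complex.exp (-(k * t * u : ℝ)) / k *
        ∫ v, saddleDensityRight t k v * Complex.exp (-(u * (1 + v * Complex.I))) := by
  have ht0 : 0 < t := by linarith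
  have hkC : (k : ℂ) ≠ 0 := by exact_mod_cast hk.ne'
  have hγ : 0 < recipPowSum 2 t := lt_of_lt_of_le (by positivity) (recipPowSum_two_bounds ht0).1
  set γ := recipPowSum 2 t with hγdef
  set A := γ * t - digamma t with hA
  obtain ⟨C, hC⟩ := exists_norm_gammaInvIntegrand_le hγ (A + k * u) (t + 1 / k)
  have hshift := verticalIntegral_eq_of_le (differentiable_gammaInvIntegrand γ (A + k * u))
    (α := 1) (β := t + 1 / k) (C := C) (by have : 0 < 1 / k := by positivity
                                           linarith)
    (fun z h1 h2 => hC z (by linarith) h2)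
  rw [hshift, verticalIntegral]
  rw [one_div]
  have hval := integral_eq_inv_mul_integral_comp hk fun v : ℝ =>
    gammaInvIntegrand γ (A + k * u) (((t + k⁻¹ : ℝ) : ℂ) + v * Complex.I) * Complex.I
  rw [hval, ← integral_const_mul, ← integral_div, ← integral_const_mul]
  congr 1
  ext v
  have hs : (((t + k⁻¹ : ℝ) : ℂ) + ((k⁻¹ * v : ℝ) : ℂ) * Complex.I) =
      t + (1 + v * Complex.I) / k := by push_cast; field_simp; ring
  rw [hs, gammaInvIntegrand, saddleDensityRight, criticalValue, saddleRatio, ← hγdef, ← hA]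
  obtain ⟨w, hw⟩ : ∃ w : ℂ, w = (1 + (v : ℂ) * Complex.I) / k := ⟨_, rfl⟩
  have hw' : 1 + (v : ℂ) * Complex.I = k * w := by rw [hw]; field_simp
  rw [← hw, hw']
  have he : (γ : ℂ) * (t + w) ^ 2 / 2 - ((A + k * u : ℝ) : ℂ) * (t + w) =
      (γ * t ^ 2 / 2 - A * t) + -((k * t * u : ℝ) : ℂ) + (digamma t * w + γ * w ^ 2 / 2) +
        -(u * (k * w)) := by
    rw [hA]; push_cast; ring
  have hΓ : Complex.Gamma t ≠ 0 := Complex.Gamma_ne_zero_of_re_pos (by simpa using ht0)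
  rw [he, Complex.exp_add, Complex.exp_add, Complex.exp_add]
  have hI := Complex.I_ne_zero
  have hpi : (Real.pi : ℂ) ≠ 0 := by exact_mod_cast Real.pi_ne_zero
  push_cast
  field_simp

/-- Opening the Hankel contour to the wedge with vertex at the critical point and substituting
`z = t + w / k`. -/
theorem hankelIntegral_eq_saddle {c ε t k : ℝ} (hc : 0 < c) (hε : 0 < ε) (ht : 0 < t) (hk : 0 < k)
    (u : ℝ) :
    hankelIntegral c ε (gammaIntegrand (recipPowSum 2 t)
        (recipPowSum 2 t * t - digamma t + k * u)) / (2 * (Real.pi : ℂ) * Complex.I) =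
      (criticalValue t)⁻¹ * Complex.exp (k * t * u : ℝ) / k *
        ∫ r, saddleDensityLeft t k r * Complex.exp (-(u * -leftPath r)) := by
  have hkC : (k : ℂ) ≠ 0 := by exact_mod_cast hk.ne'
  have hγ : 0 < recipPowSum 2 t := lt_of_lt_of_le (by positivity) (recipPowSum_two_bounds ht).1
  set γ := recipPowSum 2 t with hγdef
  set A := γ * t - digamma t with hA
  have hd := decaysLeft_gammaIntegrand hγ hε (A + k * u) t
  have hf : ∀ z : ℂ, z - (0 : ℝ) ∈ Complex.slitPlane →
      DifferentiableAt ℂ (gammaIntegrand γ (A + k * u)) z :=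
    fun z hz => differentiableAt_gammaIntegrand γ _ hz
  have i₁ := hd.integrableOn_wedge hf ht (σ := -1) (by simp)
  have i₂ := hd.integrableOn_wedge hf ht (σ := 1) (by simp)
  simp only [Complex.ofReal_one, Complex.ofReal_neg, mul_one, mul_neg, neg_mul,
    ← sub_eq_add_neg] at i₁ i₂
  rw [hankelIntegral_eq_wedgeIntegral hd hf ht hc hε, (wedgeIntegral_eq i₁ i₂).2]
  have hval := integral_eq_inv_mul_integral_comp hk fun r : ℝ => gammaIntegrand γ (A + k * u)
    (wedgePath t (-4 - 3 * Complex.I) (-4 + 3 * Complex.I) r) *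
      wedgeVel (-4 - 3 * Complex.I) (-4 + 3 * Complex.I) r
  rw [hval, ← integral_const_mul, ← integral_div, ← integral_const_mul]
  congr 1
  ext r
  have hsgn : k⁻¹ * r ≤ 0 ↔ r ≤ 0 := by
    rw [inv_mul_le_iff₀ hk, mul_zero]
  have hp : wedgePath t (-4 - 3 * Complex.I) (-4 + 3 * Complex.I) (k⁻¹ * r) =
      t + leftPath r / k := by
    simp only [leftPath, wedgePath, hsgn]
    split_ifs <;> push_cast <;> field_simp <;> ring
  have hv : wedgeVel (-4 - 3 * Complex.I) (-4 + 3 * Complex.I) (k⁻¹ * r) = leftVel r := by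
    simp only [leftVel, wedgeVel, hsgn]
  rw [hp, hv, gammaIntegrand, saddleDensityLeft, criticalValue, saddleRatio, ← hγdef, ← hA]
  obtain ⟨w, hw⟩ : ∃ w : ℂ, w = leftPath r / k := ⟨_, rfl⟩
  have hw' : leftPath r = k * w := by rw [hw]; field_simp
  rw [← hw, hw']
  have he : -((γ : ℂ) * (t + w) ^ 2 / 2) + ((A + k * u : ℝ) : ℂ) * (t + w) =
      -(γ * t ^ 2 / 2 - A * t) + ((k * t * u : ℝ) : ℂ) + -(digamma t * w + γ * w ^ 2 / 2) +
        -(u * -(k * w)) := by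
    rw [hA]; push_cast; ring
  have hΓ : Complex.Gamma t ≠ 0 := Complex.Gamma_ne_zero_of_re_pos (by simpa using ht)
  rw [he, Complex.exp_add, Complex.exp_add, Complex.exp_add, Complex.exp_neg (_ - _),
    Complex.exp_neg (_ + _), inv_div, mul_inv, inv_div]
  push_cast
  field_simp

theorem measurable_saddleDensityRight (t k : ℝ) : Measurable (saddleDensityRight t k) := by
  have h : Measurable fun v : ℝ => saddleRatio t ((1 + v * Complex.I) / k) :=
    (measurable_saddleRatio t).comp (by fun_prop)
  unfold saddleDensityRight
  fun_prop

theorem measurable_saddleDensityLeft (t k : ℝ) : Measurable (saddleDensityLeft t k) := by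
  have h0 := measurable_leftPath
  have h1 := measurable_leftVel
  have h : Measurable fun r : ℝ => saddleRatio t (leftPath r / k) :=
    (measurable_saddleRatio t).comp (by fun_prop)
  unfold saddleDensityLeft
  fun_prop

/-- The orders of magnitude at the critical point: `k t₀ → ∞` and `∑ j, 1 / (t₀ + j)³ ~ k³`. -/
theorem tendsto_scale {t₀ : ℝ → ℝ}
    (h : ∀ γ : ℝ, 0 < γ → 0 < t₀ γ ∧ deriv digamma (t₀ γ) = γ) :
    Tendsto t₀ (𝓝[>] 0) atTop ∧ Tendsto (fun γ => scale γ * t₀ γ) (𝓝[>] 0) atTop ∧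
      Tendsto (fun γ => recipPowSum 3 (t₀ γ) / scale γ ^ 3) (𝓝[>] 0) (𝓝 1) := by
  have hpos : ∀ᶠ γ : ℝ in 𝓝[>] 0, 0 < γ := self_mem_nhdsWithin
  have hb : ∀ γ : ℝ, 0 < γ → 0 < t₀ γ ∧ 1 ≤ γ * t₀ γ ∧ γ * t₀ γ ≤ 1 + 1 / t₀ γ := by
    intro γ hγ
    obtain ⟨ht, hd⟩ := h γ hγ
    rw [(hasDerivAt_digamma ht).deriv] at hd
    obtain ⟨b1, b2⟩ := recipPowSum_two_bounds ht
    rw [hd] at b1 b2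
    refine ⟨ht, ?_, ?_⟩
    · rwa [div_le_iff₀ ht] at b1
    · calc γ * t₀ γ ≤ (1 / t₀ γ + 1 / t₀ γ ^ 2) * t₀ γ := by gcongr
        _ = _ := by field_simp
  have ht : Tendsto t₀ (𝓝[>] 0) atTop := by
    refine tendsto_atTop_mono' _ ?_ tendsto_inv_nhdsGT_zero
    filter_upwards [hpos] with γ hγ
    rw [inv_le_iff_one_le_mul₀' hγ]
    exact (hb γ hγ).2.1
  have hscale : ∀ γ : ℝ, 0 < γ → 0 < scale γ ∧ scale γ ^ 3 = γ ^ 2 / 2 := by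
    intro γ hγ
    refine ⟨by unfold scale; positivity, ?_⟩
    rw [scale, mul_pow, ← Real.rpow_natCast, ← Real.rpow_natCast, ← Real.rpow_mul (by norm_num),
      ← Real.rpow_mul hγ.le]
    norm_num
    ring
  have hγt : Tendsto (fun γ => γ * t₀ γ) (𝓝[>] 0) (𝓝 1) := by
    have hu : Tendsto (fun γ => 1 + 1 / t₀ γ) (𝓝[>] 0) (𝓝 1) := by
      have := ht.inv_tendsto_atTop.const_add 1
      simpa [one_div] using this
    refine tendsto_of_tendsto_of_tendsto_of_le_of_le' tendsto_const_nhds hu ?_ ?_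
    · filter_upwards [hpos] with γ hγ using (hb γ hγ).2.1
    · filter_upwards [hpos] with γ hγ using (hb γ hγ).2.2
  refine ⟨ht, ?_, ?_⟩
  · rw [tendsto_atTop]
    intro b
    filter_upwards [hpos, ht.eventually (eventually_ge_atTop (2 * |b| ^ 3))] with γ hγ hb3
    obtain ⟨h0, h1, -⟩ := hb γ hγ
    obtain ⟨hs, hs3⟩ := hscale γ hγ
    refine (le_abs_self b).trans (le_of_pow_le_pow_left₀ three_ne_zero (by positivity) ?_)
    rw [mul_pow, hs3]
    -- `(k t₀)³ = (γ t₀)² t₀ / 2`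
    have h2 : 1 ≤ (γ * t₀ γ) ^ 2 := one_le_pow₀ h1
    nlinarith
  · have hl : Tendsto (fun γ => ((γ * t₀ γ) ^ 2)⁻¹) (𝓝[>] 0) (𝓝 1) := by
      simpa using (hγt.pow 2).inv₀ (by norm_num)
    have hu : Tendsto (fun γ => ((γ * t₀ γ) ^ 2)⁻¹ * (1 + 2 * (t₀ γ)⁻¹)) (𝓝[>] 0) (𝓝 1) := by
      simpa using hl.mul ((ht.inv_tendsto_atTop.const_mul 2).const_add 1)
    refine tendsto_of_tendsto_of_tendsto_of_le_of_le' hl hu ?_ ?_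
    all_goals
      filter_upwards [hpos] with γ hγ
      obtain ⟨h0, -, -⟩ := hb γ hγ
      obtain ⟨b1, b2⟩ := recipPowSum_three_bounds h0
      rw [(hscale γ hγ).2]
    · rw [le_div_iff₀ (by positivity)]
      refine le_trans (le_of_eq ?_) b1
      field_simp
    · rw [div_le_iff₀ (by positivity)]
      refine b2.trans (le_of_eq ?_)
      field_simp

theorem tendstoUniformlyOn_Kcrit_airy {c ε : ℝ} (hc₀ : 0 < c) (hc₁ : c < 1) (hε : 0 < ε)
    {t₀ : ℝ → ℝ} (h : ∀ γ : ℝ, 0 < γ → 0 < t₀ γ ∧ deriv digamma (t₀ γ) = γ)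
    {K : Set ℝ} (hK : IsCompact K) :
    TendstoUniformlyOn
      (fun (γ : ℝ) (p : ℝ × ℝ) =>
        ((scale γ * Real.exp (scale γ * t₀ γ * (p.2 - p.1)) : ℝ) : ℂ) *
          Kcrit c ε (γ * t₀ γ - digamma (t₀ γ) + scale γ * p.1)
            (γ * t₀ γ - digamma (t₀ γ) + scale γ * p.2) γ)
      (fun p : ℝ × ℝ => Kairy p.1 p.2) (𝓝[>] 0) (K ×ˢ K) := by
  obtain ⟨M, hM⟩ := hK.isBounded.subset_closedBall 0
  rw [Real.closedBall_eq_Icc, zero_sub, zero_add] at hM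
  obtain ⟨ht, hkt, hS⟩ := tendsto_scale h
  have hpos : ∀ᶠ γ : ℝ in 𝓝[>] 0, 0 < γ := self_mem_nhdsWithin
  have hk : ∀ γ : ℝ, 0 < γ → 0 < scale γ := fun γ hγ => by unfold scale; positivity
  have hsad := tendsto_saddleRatio (hpos.mono fun γ hγ => (h γ hγ).1) (hpos.mono hk) hkt hS
  have hS' : ∀ᶠ γ in 𝓝[>] 0, 1 / 2 ≤ recipPowSum 3 (t₀ γ) / scale γ ^ 3 :=
    (hS.eventually (lt_mem_nhds (by norm_num))).mono fun _ => le_of_lt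
  have hkt' := hkt.eventually (eventually_ge_atTop 1)
  have h13 : ∀ᶠ γ in 𝓝[>] 0, ‖saddleRatio (t₀ γ) (1 / scale γ)‖ ≤ 2 := by
    have h2 := (hsad 1).norm
    rw [Complex.norm_exp] at h2
    refine (h2.eventually (gt_mem_nhds ?_)).mono fun _ => le_of_lt
    have : ((1 : ℂ) ^ 3 / 3).re = 1 / 3 := by norm_num
    rw [this]
    -- `e < 2 ^ 3`
    have h3 : Real.exp (1 / 3) ^ 3 = Real.exp 1 := by rw [← Real.exp_nat_mul]; norm_num
    by_contra! hcon
    have h4 : (2 : ℝ) ^ 3 ≤ Real.exp (1 / 3) ^ 3 := by gcongr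
    rw [h3] at h4
    linarith [Real.exp_one_lt_d9]
  have hlimR : ∀ v, Tendsto (fun γ => saddleDensityRight (t₀ γ) (scale γ) v) (𝓝[>] 0)
      (𝓝 (airyDensityRight v)) := fun v => (hsad _).div_const _
  have hlimL : ∀ r, Tendsto (fun γ => saddleDensityLeft (t₀ γ) (scale γ) r) (𝓝[>] 0)
      (𝓝 (airyDensityLeft r)) := fun r =>
    (((hsad _).inv₀ (Complex.exp_ne_zero _)).mul_const _).div_const _
  have hdomR : ∀ᶠ γ in 𝓝[>] 0, ∀ v, ‖saddleDensityRight (t₀ γ) (scale γ) v‖ ≤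
      2 * Real.exp 2 * Real.exp (-|v|) := by
    filter_upwards [hpos, hkt', hS', h13] with γ h1 h2 h3 h4 v
    exact norm_saddleDensityRight_le (h γ h1).1 (hk γ h1) h2 h3 h4 v
  have hdomL : ∀ᶠ γ in 𝓝[>] 0, ∀ r,
      ‖saddleDensityLeft (t₀ γ) (scale γ) r‖ * Real.exp (M * (4 * |r|)) ≤
        7 * Real.exp ((4 * |M| + 5 / 4) ^ 2) * Real.exp (-|r|) := by
    filter_upwards [hpos, hkt', hS'] with γ h1 h2 h3 r
    exact norm_saddleDensityLeft_le (h γ h1).1 (hk γ h1) h2 h3 M r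
  have hdomR₀ : ∀ v, ‖airyDensityRight v‖ ≤ 2 * Real.exp 2 * Real.exp (-|v|) := fun v =>
    le_of_tendsto (hlimR v).norm (hdomR.mono fun γ hγ => hγ v)
  have hdomL₀ : ∀ r, ‖airyDensityLeft r‖ * Real.exp (M * (4 * |r|)) ≤
      7 * Real.exp ((4 * |M| + 5 / 4) ^ 2) * Real.exp (-|r|) := fun r =>
    le_of_tendsto ((hlimL r).norm.mul_const _) (hdomL.mono fun γ hγ => hγ r)
  have hm := measurable_leftPath
  have hm' := measurable_leftVel
  have hz : Measurable fun v : ℝ => 1 + (v : ℂ) * Complex.I := by fun_prop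
  have hmR : Measurable airyDensityRight := by unfold airyDensityRight; fun_prop
  have hmL : Measurable airyDensityLeft := by unfold airyDensityLeft; fun_prop
  obtain ⟨C, δ, hδ, b₀, b⟩ := laplace_limit (M := M) (σ := 1) (z := fun v => 1 + v * Complex.I)
    (Eventually.of_forall fun γ => measurable_saddleDensityRight (t₀ γ) (scale γ)) hmR hz
    (fun v => by simp) (integrable_exp_neg_abs.const_mul (2 * Real.exp 2))
    (by
      filter_upwards [hdomR] with γ hγ v
      simpa using hγ v)
    (fun v => by simpa using hdomR₀ v) hlimR
  obtain ⟨C', δ', hδ', b₀', b'⟩ := laplace_limit (M := M) (σ := 0) (z := fun r => -leftPath r)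
    (Eventually.of_forall fun γ => measurable_saddleDensityLeft (t₀ γ) (scale γ)) hmL hm.neg
    (fun r => by rw [Complex.neg_re, re_leftPath]; linarith [abs_nonneg r])
    (integrable_exp_neg_abs.const_mul (7 * Real.exp ((4 * |M| + 5 / 4) ^ 2)))
    (by
      filter_upwards [hdomL] with γ hγ r
      rw [Complex.neg_re, re_leftPath, sub_zero, neg_mul, neg_neg]
      exact hγ r)
    (fun r => by
      rw [Complex.neg_re, re_leftPath, sub_zero, neg_mul, neg_neg]
      exact hdomL₀ r) hlimL
  simp only [one_mul, zero_mul, neg_zero, Real.exp_zero, mul_one, integral_airyDensityRight,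
    integral_airyDensityLeft] at b₀ b b₀' b'
  have hmA : Measurable airyFun := by
    have := measurable_laplace hmR hz
    simpa only [integral_airyDensityRight] using this
  have key := tendstoUniformlyOn_separated
    (Eventually.of_forall fun γ =>
      measurable_laplace (measurable_saddleDensityRight (t₀ γ) (scale γ)) hz) hmA
    (Eventually.of_forall fun γ =>
      measurable_laplace (measurable_saddleDensityLeft (t₀ γ) (scale γ)) hm.neg) hmA
    b₀ b₀' hδ hδ' b b'
  refine ((key.mono (prod_mono hM hM)).congr_right
    fun p _ => (Kairy_eq_integral p.1 p.2).symm).congr ?_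
  filter_upwards [hpos, ht.eventually (eventually_ge_atTop 1)] with γ hγ ht1 p _
  have hk0 := hk γ hγ
  have hkC : (scale γ : ℂ) ≠ 0 := by exact_mod_cast hk0.ne'
  have ht0 := (h γ hγ).1
  have hγt : recipPowSum 2 (t₀ γ) = γ := by
    rw [← (hasDerivAt_digamma ht0).deriv]
    exact (h γ hγ).2
  have e1 := fun u => verticalIntegral_eq_saddle ht1 hk0 u
  have e2 := fun u => hankelIntegral_eq_saddle hc₀ hε ht0 hk0 u
  rw [hγt] at e1 e2
  simp only
  rw [Kcrit_scaled_eq_integral hc₀ hc₁ hε hγ hk0, ← mul_assoc, ← integral_const_mul]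
  congr 1
  ext l
  rw [e1, e2]
  have hΓ : Complex.Gamma (t₀ γ) ≠ 0 := Complex.Gamma_ne_zero_of_re_pos (by simpa using ht0)
  have hE : criticalValue (t₀ γ) ≠ 0 := div_ne_zero (Complex.exp_ne_zero _) hΓ
  have hexp : Complex.exp ((scale γ * t₀ γ * (p.2 - p.1) : ℝ) : ℂ) *
      Complex.exp (-(scale γ * t₀ γ * (p.2 + l) : ℝ)) *
        Complex.exp (scale γ * t₀ γ * (p.1 + l) : ℝ) = 1 := by
    rw [← Complex.exp_add, ← Complex.exp_add, ← Complex.exp_zero]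
    congr 1
    push_cast
    ring
  rw [Complex.ofReal_mul, Complex.ofReal_exp]
  generalize Complex.exp ((scale γ * t₀ γ * (p.2 - p.1) : ℝ) : ℂ) = X at *
  generalize Complex.exp (-(scale γ * t₀ γ * (p.2 + l) : ℝ)) = Y at *
  generalize Complex.exp (scale γ * t₀ γ * (p.1 + l) : ℝ) = Z at *
  simp only [Pi.neg_apply]
  generalize (∫ v, saddleDensityRight (t₀ γ) (scale γ) v *
    Complex.exp (-(((p.2 + l : ℝ) : ℂ) * (1 + v * Complex.I)))) = P
  generalize (∫ r, saddleDensityLeft (t₀ γ) (scale γ) r *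
    Complex.exp (-(((p.1 + l : ℝ) : ℂ) * -leftPath r))) = Q
  field_simp
  linear_combination (-(P * Q)) * hexp

end CriticalKernel

end

theorem theorem3p2 (c ε : ℝ) (hc₀ : 0 < c) (hc₁ : c < 1) (hε : 0 < ε) :
    (∀ K : Set ℝ, IsCompact K →
      TendstoUniformlyOn
        (fun (γ : ℝ) (p : ℝ × ℝ) =>
          (Real.sqrt γ : ℂ)
            * CriticalKernel.Kcrit c ε (Real.sqrt γ * p.1) (Real.sqrt γ * p.2) γ)
        (fun p : ℝ × ℝ => ((1 / Real.sqrt (2 * Real.pi) * Real.exp (-(p.2 ^ 2) / 2) : ℝ) : ℂ))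
        atTop (K ×ˢ K)) ∧
    (∀ γ : ℝ, 0 < γ → ∃! t : ℝ, 0 < t ∧ deriv CriticalKernel.digamma t = γ) ∧
    (∀ t₀ : ℝ → ℝ,
      (∀ γ : ℝ, 0 < γ → 0 < t₀ γ ∧ deriv CriticalKernel.digamma (t₀ γ) = γ) →
      ∀ K : Set ℝ, IsCompact K →
        TendstoUniformlyOn
          (fun (γ : ℝ) (p : ℝ × ℝ) =>
            ((CriticalKernel.scale γ
                * Real.exp (CriticalKernel.scale γ * t₀ γ * (p.2 - p.1)) : ℝ) : ℂ)
              * CriticalKernel.Kcrit c ε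
                  (γ * t₀ γ - CriticalKernel.digamma (t₀ γ) + CriticalKernel.scale γ * p.1)
                  (γ * t₀ γ - CriticalKernel.digamma (t₀ γ) + CriticalKernel.scale γ * p.2) γ)
          (fun p : ℝ × ℝ => CriticalKernel.Kairy p.1 p.2)
          (𝓝[>] 0) (K ×ˢ K)) := by
  exact ⟨fun K hK => CriticalKernel.tendstoUniformlyOn_Kcrit_gaussian hc₀ hc₁ hε hK,
    fun γ hγ => CriticalKernel.existsUnique_deriv_digamma_eq hγ,
    fun t₀ h K hK => CriticalKernel.tendstoUniformlyOn_Kcrit_airy hc₀ hc₁ hε h hK⟩
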